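/- **Setting.** For $0<\varepsilon<1$ put $\eta=\frac{2\varepsilon}{1-\varepsilon}$. The self-similar Einstein--Euler system in the Schwarzschild variable $x$ is $$D'=-\frac{2x(1-\varepsilon)D(W+\varepsilon)(D-W)}{B},\qquad W'=\frac{1-3W}{x}+\frac{2x(1+\varepsilon)W(W+\varepsilon)(D-W)}{B},$$ $$B=D^{-\eta}-\left[(W+\varepsilon)^2-\varepsilon(W-1)^2+4\varepsilon DW\right]x^2 .$$ Fix $\delta_0>0$ and set $x_{\min}=2+\delta_0$, and let $x_{\max}(\varepsilon)=3^{\eta/2}/(\tfrac13+\varepsilon)$ (the value of $x$ at which $B=0$ when $D=W=\frac13$). For $x_*\in[x_{\min},x_{\max}(\varepsilon)]$ an *RLP-type solution* with sonic point $x_*$ is a pair $(D,W)$, real analytic on a neighbourhood of $[x_*,\infty)$, with $D>0$ on $[x_*,\infty)$, with $D(x_*)=W(x_*)=:W_0$ and $B=0$ at $x_*$, which solves the system with $B\neq0$ for $x>x_*$, and whose first Taylor coefficients at $x_*$ are of relativistic Larson--Penston type. The last condition means the following. The coefficients $(\mathcal R_1,\mathcal W_1)=(x_*D'(x_*),x_*W'(x_*))$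 of any analytic solution satisfy the two first-order Taylor relations at the sonic point; elimination of $\mathcal R_1$ gives a monic cubic equation for $\mathcal W_1$ with coefficients depending on $\varepsilon$ and $W_0$, and then $\mathcal R_1$ is a rational function of $\mathcal W_1$. The root of the cubic that tends to $-1/x_*$ as $\varepsilon\to0$ (its least real root) is discarded, $\mathcal W_1$ is the larger of the two remaining roots (it tends to $1-2/x_*$ as $\varepsilon\to 0$), and $\mathcal R_1$ is the corresponding value. The associated comoving radius $\tilde r$ is the solution of $\tilde r'=\frac{\tilde r\,(W(\tilde r)+\varepsilon)}{(1+\varepsilon)y}$ on $[y_*,\infty)$, where $y_*>0$, with $\tilde r(y_*)=x_*$, $\tilde r>x_*$ on $(y_*,\infty)$ and $\tilde r(y)/y\to1$ as $y\to\infty$. With $Y=y^{-1/(1+\eta)}$, the functions $\chi(Y)=\tilde r(y)/y$, $d(Y)=D(\tilde r(y))$, $w(Y)=W(\tilde r(y))$ solve, for $Y>0$, the system $$d'=\frac{2\chi^2}{Y}\frac{d(w+\varepsilon)^2(d-w)}{\mathcal C},\quad w'=-\frac{(w+\varepsilon)(1-3w)}{(1-\varepsilon)Y}-\frac{2(1+\varepsilon)\chi^2}{(1-\varepsilon)Y}\frac{w(w+\varepsilon)^2(d-w)}{\mathcal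 C},\quad \chi'=\frac{1-w}{(1-\varepsilon)Y}\chi,\tag{1}$$ $$\mathcal C=(dY^{-2})^{-\eta}Y^2-\chi^2\left[(w+\varepsilon)^2-\varepsilon(w-1)^2+4\varepsilon wd\right].$$ **Theorem (local extension).** For every $\delta_0>0$ there exist $\varepsilon_0\in(0,1)$, $Y_0<0$ and positive constants $\delta,c_0,\tilde\delta,c_w$, all depending only on $\delta_0$, such that for every $\varepsilon\in(0,\varepsilon_0]$ and every $x_*\in[x_{\min},x_{\max}(\varepsilon)]$ the following holds. There is a unique RLP-type solution $(D,W)$ on $[x_*,\infty)$ with sonic point $x_*$; it has an associated comoving radius $\tilde r$ on some $[y_*,\infty)$; and the limits $$d_2=\lim_{x\to\infty}D(x)\,x^{\frac{2}{1+\eta}},\qquad w_1=\lim_{x\to\infty}(W(x)-1)\,x^{\frac1{1+\eta}}$$ exist. There is a unique real analytic solution $(d,w,\chi)$ of (1) on $(-|Y_0|,|Y_0|)$ (the equations being imposed for $Y\ne0$), with $d>0$ for $Y\neq0$, such that $$\lim_{Y\to0}\frac{d(Y)}{Y^2}=d_2,\quad w(0)=1,\quad w'(0)=w_1,\quad \chi(0)=1,\quad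 \mathcal C(Y)<0\ \text{ on }(-|Y_0|,|Y_0|).$$ It extends analytically, as a solution with these properties, to a neighbourhood of each point of $[-|Y_0|,|Y_0|]$, and $\mathcal C<0$ on $[-|Y_0|,|Y_0|]$. Moreover: (a) $d(Y_0)>\delta$, $\chi(Y_0)>\delta$ and $w(Y_0)<\frac1\delta$; (b) $\chi^2w\,(dY^{-2})^{1+\eta}>1+c_0$ for all $Y\in[Y_0,0]$, where $dY^{-2}$ is given the value $d_2$ at $Y=0$; (c) $\frac1{100}>\frac{d(Y_0)}{w(Y_0)}>\tilde\delta$; (d) $w(Y_0)>1+c_w$. Finally, for every $0<Y\le|Y_0|$, with $y=Y^{-(1+\eta)}$, one has $y>y_*$ and $d(Y)=D(\tilde r(y))$, $w(Y)=W(\tilde r(y))$, $\chi(Y)=\tilde r(y)/y$; that is, the solution coincides with the RLP-type solution for $Y>0$. -/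

import Mathlib

open Filter Topology Set

noncomputable section

namespace RLP

/-- The exponent `η = 2ε/(1-ε)`; note `1 + η = (1+ε)/(1-ε)`. -/
def eta (ε : ℝ) : ℝ := 2 * ε / (1 - ε)

/-! ### The self-similar Einstein-Euler system in Schwarzschild coordinates -/

/-- The sonic denominator
`B[x; D, W] = D^(-η) - [(W+ε)² - ε(W-1)² + 4εDW] x²`. -/
def sonicDen (ε x D W : ℝ) : ℝ :=
  D ^ (-eta ε) - ((W + ε) ^ 2 - ε * (W - 1) ^ 2 + 4 * ε * D * W) * x ^ 2

/-- `D' = -2x(1-ε) D (W+ε)(D-W) / B`. -/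
def rhsD (ε x D W : ℝ) : ℝ :=
  -(2 * x * (1 - ε) * D * (W + ε) * (D - W) / sonicDen ε x D W)

/-- `W' = (1-3W)/x + 2x(1+ε) W (W+ε)(D-W) / B`. -/
def rhsW (ε x D W : ℝ) : ℝ :=
  (1 - 3 * W) / x + 2 * x * (1 + ε) * W * (W + ε) * (D - W) / sonicDen ε x D W

/-! ### First Taylor coefficients at a sonic point

In the variable `z = x / x⋆` the first Taylor coefficients `(R₁, W₁)` at a sonic point satisfy two
algebraic relations; eliminating `R₁` gives a cubic equation for `W₁` with coefficients depending
on `ε` and on the common value `W₀` of `D` and `W` at the sonic point. -/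

/-- `H₀ = (1-ε)W₀² + 4εW₀ + 4εW₀² + ε² - ε`. -/
def cH (ε W₀ : ℝ) : ℝ := (1 - ε) * W₀ ^ 2 + 4 * ε * W₀ + 4 * ε * W₀ ^ 2 + ε ^ 2 - ε

def ca (ε W₀ : ℝ) : ℝ := W₀ * (W₀ + ε)

def cb (ε W₀ : ℝ) : ℝ := eta ε / 2 * (cH ε W₀ / W₀) + 2 * ε * W₀

def cc (W₀ : ℝ) : ℝ := 3 * W₀ - 1

def cd (ε W₀ : ℝ) : ℝ := (1 + ε) * W₀ + 2 * ε

def ce (ε W₀ : ℝ) : ℝ :=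
  (3 + 5 * ε) * W₀ ^ 2 - (1 - 8 * ε + ε ^ 2) * W₀ - (3 * ε - ε ^ 2)

def cf (ε W₀ : ℝ) : ℝ := (1 - ε) * ca ε W₀ - cH ε W₀

def ch (ε W₀ : ℝ) : ℝ := (1 + ε) * ca ε W₀ + cb ε W₀ * cc W₀

def a₃ (ε W₀ : ℝ) : ℝ :=
  cd ε W₀ * (cd ε W₀ * ch ε W₀ - cb ε W₀ * ce ε W₀)
    - cb ε W₀ * (cf ε W₀ * cd ε W₀ + (1 - ε) * ca ε W₀ * cb ε W₀)

def a₂ (ε W₀ : ℝ) : ℝ :=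
  -(cb ε W₀ * cc W₀ * cd ε W₀ * cH ε W₀
    - ce ε W₀ * (cd ε W₀ * ch ε W₀ - cb ε W₀ * ce ε W₀)
    + ch ε W₀ * (cf ε W₀ * cd ε W₀ + (1 - ε) * ca ε W₀ * cb ε W₀)
    + cb ε W₀ * (cf ε W₀ * ce ε W₀ + (1 - ε) * ca ε W₀ * ch ε W₀))

def a₁ (ε W₀ : ℝ) : ℝ :=
  -(cb ε W₀ * cc W₀ * ce ε W₀ * cH ε W₀
    - cc W₀ * cH ε W₀ * (cd ε W₀ * ch ε W₀ - cb ε W₀ * ce ε W₀)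
    + cb ε W₀ * cc W₀ * cf ε W₀ * cH ε W₀
    + ch ε W₀ * (cf ε W₀ * ce ε W₀ + (1 - ε) * ca ε W₀ * ch ε W₀))

def a₀ (ε W₀ : ℝ) : ℝ :=
  -(cc W₀ * cH ε W₀ * (cb ε W₀ * cc W₀ * cH ε W₀ + cf ε W₀ * ch ε W₀))

/-- The cubic polynomial `P(X) = X³ + (a₂/a₃) X² + (a₁/a₃) X + a₀/a₃`. -/
def cubic (ε W₀ X : ℝ) : ℝ :=
  X ^ 3 + a₂ ε W₀ / a₃ ε W₀ * X ^ 2 + a₁ ε W₀ / a₃ ε W₀ * X + a₀ ε W₀ / a₃ ε W₀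

/-- The ghost root: the root of the cubic which tends to `-1/x⋆` as `ε → 0`. The other two roots
tend to `0` and `1 - 2/x⋆ > 0`, so it is the least real root. -/
def W1gh (ε W₀ : ℝ) : ℝ := sInf {X : ℝ | cubic ε W₀ X = 0}

/-- The relativistic Larson-Penston slope: the larger root of the quadratic polynomial
`X² + (a₂/a₃ + W₁ᵍʰ) X - a₀/(a₃ W₁ᵍʰ)` left after removing the ghost root from the cubic. It tends
to `1 - 2/x⋆` as `ε → 0`. -/
def W1RLP (ε W₀ : ℝ) : ℝ :=
  (-(a₂ ε W₀ / a₃ ε W₀ + W1gh ε W₀)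
    + √((a₂ ε W₀ / a₃ ε W₀ + W1gh ε W₀) ^ 2
        + 4 * a₀ ε W₀ / (a₃ ε W₀ * W1gh ε W₀))) / 2

/-- The coefficient `R₁` that corresponds to the slope `W1RLP`. -/
def R1RLP (ε W₀ : ℝ) : ℝ :=
  -((cd ε W₀ * W1RLP ε W₀ ^ 2 + ce ε W₀ * W1RLP ε W₀ + cc W₀ * cH ε W₀)
    / (ch ε W₀ + cb ε W₀ * W1RLP ε W₀))

/-- The right end point `x_max(ε)` of the sonic window: the sonic point at which the common value
of `D` and `W` is the Friedmann value `1/3`. -/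
def xMax (ε : ℝ) : ℝ := 3 ^ (eta ε / 2) / (1 / 3 + ε)

theorem sonicDen_xMax {ε : ℝ} (hε : 0 < ε) : sonicDen ε (xMax ε) (1 / 3) (1 / 3) = 0 := by
  have h1 : (1 / 3 : ℝ) ^ (-eta ε) = 3 ^ eta ε := by
    rw [one_div, Real.inv_rpow (by norm_num), Real.rpow_neg (by norm_num), inv_inv]
  have h2 : ((3 : ℝ) ^ (eta ε / 2)) ^ 2 = 3 ^ eta ε := by
    rw [← Real.rpow_natCast, ← Real.rpow_mul (by norm_num)]
    congr 1
    push_cast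
    ring
  have h3 : (1 / 3 + ε) ≠ 0 := by positivity
  unfold sonicDen xMax
  rw [h1, div_pow, h2]
  field_simp
  ring

/-- `(D, W)` is a solution of relativistic Larson-Penston type on `[x⋆, ∞)` with sonic point `x⋆`:
real analytic (in particular in a full neighbourhood of `x⋆`), with the sonic conditions and the
Larson-Penston first Taylor coefficients at `x⋆`, and solving the system to the right of `x⋆`.
Analyticity and the equations determine the higher Taylor coefficients at `x⋆`. -/
structure IsRLPSolution (ε xs : ℝ) (D W : ℝ → ℝ) : Prop where
  analytic_D : AnalyticOnNhd ℝ D (Ici xs)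
  analytic_W : AnalyticOnNhd ℝ W (Ici xs)
  pos_D : ∀ x ∈ Ici xs, 0 < D x
  sonic_eq : D xs = W xs
  sonic_den : sonicDen ε xs (D xs) (W xs) = 0
  slope_W : xs * deriv W xs = W1RLP ε (W xs)
  slope_D : xs * deriv D xs = R1RLP ε (W xs)
  den_ne : ∀ x ∈ Ioi xs, sonicDen ε x (D x) (W x) ≠ 0
  eq_D : ∀ x ∈ Ioi xs, HasDerivAt D (rhsD ε x (D x) (W x)) x
  eq_W : ∀ x ∈ Ioi xs, HasDerivAt W (rhsW ε x (D x) (W x)) x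

/-- The comoving self-similar variable `y ∈ [y⋆, ∞)` of a solution on `[x⋆, ∞)`: `x = r̃(y)` with
`r̃' = r̃ (𝐰 + ε) / ((1+ε) y)`, `𝐰(y) = W(r̃(y))`, `r̃(y⋆) = x⋆`, and the labelling gauge fixed by
`r̃(y)/y → 1` as `y → ∞`. -/
structure IsComovingRadius (ε xs : ℝ) (W : ℝ → ℝ) (r : ℝ → ℝ) (ys : ℝ) : Prop where
  pos : 0 < ys
  cont : ContinuousOn r (Ici ys)
  init : r ys = xs
  gt : ∀ y ∈ Ioi ys, xs < r y
  eq_r : ∀ y ∈ Ioi ys, HasDerivAt r (r y * (W (r y) + ε) / ((1 + ε) * y)) y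
  gauge : Tendsto (fun y => r y / y) atTop (𝓝 1)

/-! ### The system in the adapted comoving variable `Y` -/

/-- `𝒞 = (d Y⁻²)^(-η) Y² - χ² [(w+ε)² - ε(w-1)² + 4εwd]`. -/
def denC (ε Y d w χ : ℝ) : ℝ :=
  (d / Y ^ 2) ^ (-eta ε) * Y ^ 2
    - χ ^ 2 * ((w + ε) ^ 2 - ε * (w - 1) ^ 2 + 4 * ε * w * d)

/-- `(d, w, χ)` is a real analytic solution of the `(d, w, χ)` system on `I` (at `Y = 0` the
equations hold in the sense of limits, by analyticity), with `d > 0` away from `Y = 0`, negative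
denominator `𝒞`, and the conditions
`d/Y² → d₂`, `w(0) = 1`, `w'(0) = w₁`, `χ(0) = 1` at `Y = 0`. -/
structure IsExtension (ε d₂ w₁ : ℝ) (I : Set ℝ) (d w χ : ℝ → ℝ) : Prop where
  analytic_d : AnalyticOnNhd ℝ d I
  analytic_w : AnalyticOnNhd ℝ w I
  analytic_chi : AnalyticOnNhd ℝ χ I
  pos_d : ∀ Y ∈ I, Y ≠ 0 → 0 < d Y
  den_neg : ∀ Y ∈ I, denC ε Y (d Y) (w Y) (χ Y) < 0
  eq_d : ∀ Y ∈ I, Y ≠ 0 →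
    HasDerivAt d
      (2 * χ Y ^ 2 / Y * (d Y * (w Y + ε) ^ 2 * (d Y - w Y) / denC ε Y (d Y) (w Y) (χ Y))) Y
  eq_w : ∀ Y ∈ I, Y ≠ 0 →
    HasDerivAt w
      (-((w Y + ε) * (1 - 3 * w Y) / ((1 - ε) * Y))
        - 2 * (1 + ε) * χ Y ^ 2 / ((1 - ε) * Y)
          * (w Y * (w Y + ε) ^ 2 * (d Y - w Y) / denC ε Y (d Y) (w Y) (χ Y))) Y
  eq_chi : ∀ Y ∈ I, Y ≠ 0 → HasDerivAt χ ((1 - w Y) / ((1 - ε) * Y) * χ Y) Y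
  lim_d : Tendsto (fun Y => d Y / Y ^ 2) (𝓝[≠] 0) (𝓝 d₂)
  w_zero : w 0 = 1
  deriv_w_zero : deriv w 0 = w₁
  chi_zero : χ 0 = 1

end RLP

end

noncomputable section

namespace RLP

open scoped ContDiff

section Nemytskii
variable {E F : Type*} [NormedAddCommGroup E] [NormedSpace ℝ E] [NormedAddCommGroup F]
  [NormedSpace ℝ F] {K : Type*} [TopologicalSpace K] [CompactSpace K]

/-- A continuous multilinear map acts pointwise on tuples of continuous functions. -/
def pointwiseMultilinear {n : ℕ} (p : ContinuousMultilinearMap ℝ (fun _ : Fin n => E) F) :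
    ContinuousMultilinearMap ℝ (fun _ : Fin n => C(K, E)) C(K, F) :=
  MultilinearMap.mkContinuous
    { toFun := fun u => ⟨fun s => p fun i => u i s, by fun_prop⟩
      map_update_add' := by
        intro _ u i x y
        ext s
        have h : ∀ z : C(K, E), (fun j => (Function.update u i z) j s)
            = Function.update (fun j => u j s) i (z s) := by
          intro z; ext j; by_cases hj : j = i
          · subst hj; simp
          · simp [hj]
        simp only [ContinuousMap.coe_mk, ContinuousMap.add_apply]
        convert p.map_update_add (fun j => u j s) i (x s) (y s) using 2 <;>
          (try congr 1) <;> (ext j; by_cases hj : j = i <;> [(subst hj; simp); simp [hj]])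
      map_update_smul' := by
        intro _ u i c x
        ext s
        simp only [ContinuousMap.coe_mk, ContinuousMap.smul_apply]
        convert p.map_update_smul (fun j => u j s) i c (x s) using 2 <;>
          (try congr 1) <;> (ext j; by_cases hj : j = i <;> [(subst hj; simp); simp [hj]]) }
    ‖p‖ (by
      intro u
      rw [ContinuousMap.norm_le _ (by positivity)]
      intro s
      refine (p.le_opNorm _).trans ?_
      gcongr with i
      exact (u i).norm_coe_le_norm s)

theorem norm_pointwiseMultilinear_le {n : ℕ}
    (p : ContinuousMultilinearMap ℝ (fun _ : Fin n => E) F) :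
    ‖pointwiseMultilinear (K := K) p‖ ≤ ‖p‖ :=
  MultilinearMap.mkContinuous_norm_le _ (norm_nonneg _) _

/-- The superposition operator of an analytic function is analytic on spaces of continuous
functions. -/
theorem exists_superposition [CompleteSpace F] {f : E → F} {x : E} (hf : AnalyticAt ℝ f x) :
    ∃ (N : C(K, E) → C(K, F)) (r : ℝ), 0 < r ∧
      AnalyticAt ℝ N (ContinuousMap.const K x) ∧
      ∀ u : C(K, E), ‖u - ContinuousMap.const K x‖ < r → ∀ s, N u s = f (u s) := by
  obtain ⟨p, ρ, hp⟩ := hf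
  let q : FormalMultilinearSeries ℝ C(K, E) C(K, F) := fun n => pointwiseMultilinear (p n)
  have hrad : p.radius ≤ q.radius := FormalMultilinearSeries.radius_le_of_le
    fun n => norm_pointwiseMultilinear_le (p n)
  have hρ : ρ ≤ q.radius := hp.r_le.trans hrad
  have hq : 0 < q.radius := hp.r_pos.trans_le hρ
  obtain ⟨r, hr0, hrρ⟩ := ENNReal.lt_iff_exists_nnreal_btwn.1 hp.r_pos
  refine ⟨fun u => q.sum (u - ContinuousMap.const K x), r, by exact_mod_cast hr0, ?_, ?_⟩
  · have h := (q.hasFPowerSeriesOnBall hq).analyticAt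
    have h2 : AnalyticAt ℝ (fun u : C(K, E) => u - ContinuousMap.const K x)
      (ContinuousMap.const K x) := by fun_prop
    exact AnalyticAt.fun_comp (by simpa using h) h2
  · intro u hu s
    set v := u - ContinuousMap.const K x with hv
    have hvr : v ∈ Metric.eball (0 : C(K, E)) q.radius := by
      rw [Metric.mem_eball, edist_zero_right]
      refine lt_of_lt_of_le ?_ (hrρ.le.trans hρ)
      rw [← ofReal_norm]
      rw [ENNReal.ofReal_lt_iff_lt_toReal (norm_nonneg _) (by simp)]
      simpa using hu
    have h1 := (q.hasSum hvr)
    have h2 : HasSum (fun n => (q n fun _ => v) s) (q.sum v s) :=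
      h1.map (⟨⟨fun g : C(K, F) => g s, rfl⟩, fun _ _ => rfl⟩ : C(K, F) →+ F)
        (continuous_eval_const s)
    have hvs : v s ∈ Metric.eball (0 : E) ρ := by
      rw [Metric.mem_eball, edist_zero_right]
      refine lt_of_lt_of_le ?_ hrρ.le
      rw [← ofReal_norm, ENNReal.ofReal_lt_iff_lt_toReal (norm_nonneg _) (by simp)]
      exact (v.norm_coe_le_norm s).trans_lt (by simpa using hu)
    have h3 := hp.hasSum hvs
    have h4 : x + v s = u s := by simp [hv]
    rw [h4] at h3
    exact h2.unique h3

end Nemytskii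

section Average

open scoped unitInterval

variable {E : Type*} [NormedAddCommGroup E] [NormedSpace ℝ E]

/-- The averaging operator `(avg h)(s) = ∫₀¹ h(τ s) dτ`. -/
def avg : C(I, E) →L[ℝ] C(I, E) :=
  LinearMap.mkContinuous
    { toFun := fun h => ⟨fun s => ∫ τ : I, h (τ * s), by
        apply MeasureTheory.continuous_of_dominated (bound := fun _ => ‖h‖)
        · intro s
          exact (h.continuous.comp (by fun_prop)).aestronglyMeasurable
        · intro s; exact Eventually.of_forall fun τ => h.norm_coe_le_norm _
        · exact MeasureTheory.integrable_const _
        · exact Eventually.of_forall fun τ => h.continuous.comp (by fun_prop)⟩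
      map_add' := by
        intro f g; ext s
        have hi : ∀ h : C(I, E), MeasureTheory.Integrable (fun τ : I => h (τ * s)) := fun h =>
          (h.continuous.comp (by fun_prop)).integrable_of_hasCompactSupport
            (HasCompactSupport.of_compactSpace _)
        exact MeasureTheory.integral_add (hi f) (hi g)
      map_smul' := by
        intro c f; ext s
        exact MeasureTheory.integral_smul c _ }
    1 (by
      intro h
      rw [one_mul, ContinuousMap.norm_le _ (norm_nonneg _)]
      intro s
      refine (MeasureTheory.norm_integral_le_of_norm_le_const
        (Eventually.of_forall fun τ => h.norm_coe_le_norm _)).trans ?_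
      simp)

theorem avg_apply (h : C(I, E)) (s : I) : avg h s = ∫ τ : I, h (τ * s) := rfl

theorem integral_unitInterval (g : ℝ → E) : ∫ τ : I, g τ = ∫ τ in (0 : ℝ)..1, g τ := by
  rw [intervalIntegral.integral_of_le zero_le_one, ← MeasureTheory.integral_Icc_eq_integral_Ioc]
  exact MeasureTheory.integral_subtype measurableSet_Icc g

/-- Rescaling of a continuous function on the unit interval. -/
def rescale {E : Type*} [TopologicalSpace E] (h : C(I, E)) (a : I) : C(I, E) :=
  ⟨fun s => h (a * s), by fun_prop⟩

theorem rescale_apply {E : Type*} [TopologicalSpace E] (h : C(I, E)) (a s : I) :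
    rescale h a s = h (a * s) := rfl

theorem avg_rescale (h : C(I, E)) (a : I) : avg (rescale h a) = rescale (avg h) a := by
  ext s
  simp only [avg_apply, rescale_apply]
  congr 1; ext τ; congr 1
  exact mul_left_comm _ _ _

/-- `μ · (avg of t ↦ g(λ t))(1) = ∫₀^λ g`. -/
theorem mul_avg_eq [CompleteSpace E] (h : C(I, E)) (g : ℝ → E) (a : ℝ)
    (hg : ∀ s : I, h s = g (a * s)) (s : I) :
    (a * s) • avg h s = ∫ t in (0 : ℝ)..(a * s), g t := by
  have h1 : avg h s = ∫ τ in (0 : ℝ)..1, g ((a * s) * τ) := by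
    rw [← integral_unitInterval, avg_apply]
    congr 1; ext τ; rw [hg]; congr 1; push_cast; ring
  rw [h1]
  simp

theorem norm_avg_apply_le (h : C(I, E)) (s : I) : ‖avg h s‖ ≤ ‖h‖ := by
  refine (MeasureTheory.norm_integral_le_of_norm_le_const
    (Eventually.of_forall fun τ => h.norm_coe_le_norm _)).trans ?_
  simp

/-- The primitive vanishing at `0`, as an operator on `C(I, E)`. -/
def prim : C(I, E) →L[ℝ] C(I, E) :=
  LinearMap.mkContinuous
    { toFun := fun h => ⟨fun s => (s : ℝ) • avg h s,
        continuous_subtype_val.smul (avg h).continuous⟩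
      map_add' := by
        intro f g; ext s
        simp only [map_add, ContinuousMap.add_apply, ContinuousMap.coe_mk, smul_add]
      map_smul' := by
        intro c f; ext s
        simp only [map_smul, ContinuousMap.smul_apply, ContinuousMap.coe_mk, RingHom.id_apply]
        rw [smul_comm] }
    1 (by
      intro h
      rw [one_mul, ContinuousMap.norm_le _ (norm_nonneg _)]
      intro s
      change ‖(s : ℝ) • avg h s‖ ≤ ‖h‖
      rw [norm_smul, Real.norm_of_nonneg s.2.1]
      exact (mul_le_of_le_one_left (norm_nonneg _) s.2.2).trans (norm_avg_apply_le h s))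

theorem prim_apply (h : C(I, E)) (s : I) : prim h s = (s : ℝ) • avg h s := rfl

end Average

theorem fderiv_comp_inr {E₁ E₂ F : Type*} [NormedAddCommGroup E₁] [NormedSpace ℝ E₁]
    [NormedAddCommGroup E₂] [NormedSpace ℝ E₂] [NormedAddCommGroup F] [NormedSpace ℝ F]
    {Φ : E₁ × E₂ → F} {p : E₁ × E₂} (h : DifferentiableAt ℝ Φ p) {L : E₂ →L[ℝ] F}
    (hL : HasFDerivAt (fun y => Φ (p.1, y)) L p.2) : fderiv ℝ Φ p ∘L .inr ℝ E₁ E₂ = L := by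
  have h1 : HasFDerivAt (fun y : E₂ => (p.1, y)) (.inr ℝ E₁ E₂) p.2 := hasFDerivAt_prodMk_right _ _
  have h2 : HasFDerivAt Φ (fderiv ℝ Φ p) (p.1, p.2) := h.hasFDerivAt
  exact (h2.comp p.2 h1).unique hL

section AnalyticODE

open scoped unitInterval

variable {E : Type*} [NormedAddCommGroup E] [NormedSpace ℝ E] [CompleteSpace E]

/-- Solutions of an autonomous differential equation with analytic right-hand side are analytic. -/
theorem analyticAt_of_hasDerivAt {f : E → E} {γ : ℝ → E} {t₀ : ℝ} (hf : AnalyticAt ℝ f (γ t₀))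
    (hγ : ∀ᶠ t in 𝓝 t₀, HasDerivAt γ (f (γ t)) t) : AnalyticAt ℝ γ t₀ := by
  obtain ⟨N, r, hr, hN, hNf⟩ := exists_superposition (K := I) hf
  set c : C(I, E) := ContinuousMap.const I (γ t₀) with hc
  let Φ : ℝ × C(I, E) → C(I, E) := fun p => p.2 - c - p.1 • prim (N p.2)
  have hΦ : ContDiffAt ℝ ω Φ (0, c) := by
    have h1 : ContDiffAt ℝ ω N (((0, c) : ℝ × C(I, E)).2) := hN.contDiffAt
    have h2 : ContDiffAt ℝ ω (fun p : ℝ × C(I, E) => N p.2) (0, c) := h1.comp _ contDiffAt_snd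
    have h3 : ContDiffAt ℝ ω (fun p : ℝ × C(I, E) => prim (N p.2)) (0, c) :=
      h2.continuousLinearMap_comp (prim (E := E))
    exact (contDiffAt_snd.sub contDiffAt_const).sub (contDiffAt_fst.smul h3)
  have hinv : (fderiv ℝ Φ (0, c) ∘L .inr ℝ ℝ C(I, E)).IsInvertible := by
    have h1 : HasFDerivAt (fun y => Φ (((0, c) : ℝ × C(I, E)).1, y))
        (ContinuousLinearMap.id ℝ C(I, E)) ((0, c) : ℝ × C(I, E)).2 := by
      have : (fun y => Φ (((0, c) : ℝ × C(I, E)).1, y)) = fun y => y - c := by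
        ext y; simp [Φ]
      rw [this]
      exact (hasFDerivAt_id c).sub_const c
    rw [fderiv_comp_inr (hΦ.differentiableAt (by simp)) h1]
    exact ContinuousLinearMap.isInvertible_equiv (f := ContinuousLinearEquiv.refl ℝ C(I, E))
  set ψ := hΦ.implicitFunction (by simp) hinv with hψ
  have hψa : ContDiffAt ℝ ω ψ 0 := hΦ.contDiffAt_implicitFunction (by simp) hinv
  have hev := hΦ.eventually_apply_eq_iff_implicitFunction (by simp) hinv
  -- the rescaled solutions
  have hγf : ∀ᶠ t in 𝓝 t₀, HasDerivAt γ (f (γ t)) t ∧ ContinuousAt f (γ t) :=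
    hγ.and ((hγ.self_of_nhds.continuousAt.eventually hf.eventually_analyticAt).mono
      fun _ h => h.continuousAt)
  obtain ⟨δ, hδ, hball'⟩ := Metric.eventually_nhds_iff_ball.1 hγf
  have hball := fun t ht => (hball' t ht).1
  have hcont : ContinuousOn γ (Metric.ball t₀ δ) := fun t ht =>
    (hball t ht).continuousAt.continuousWithinAt
  have hcl : ∀ l : ℝ, |l| < δ → ∀ s : I, t₀ + l * s ∈ Metric.ball t₀ δ := by
    intro l hl s
    rw [Metric.mem_ball, Real.dist_eq, add_sub_cancel_left, abs_mul, abs_of_nonneg s.2.1]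
    exact lt_of_le_of_lt (mul_le_of_le_one_right (abs_nonneg _) s.2.2) hl
  classical
  let U : ℝ → C(I, E) := fun l => if hl : |l| < δ then
    ⟨fun s => γ (t₀ + l * s), hcont.comp_continuous (by fun_prop) (hcl l hl)⟩ else c
  have hU : ∀ l, |l| < δ → ∀ s, U l s = γ (t₀ + l * s) := by
    intro l hl s; simp only [U, dif_pos hl]; rfl
  have hsmall : ∀ᶠ l : ℝ in 𝓝 0, |l| < δ := by
    have := (continuous_abs (G := ℝ)).tendsto 0
    rw [abs_zero] at this
    exact this.eventually_lt_const hδ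
  have hUt : Tendsto U (𝓝 0) (𝓝 c) := by
    rw [Metric.tendsto_nhds]
    intro e he
    obtain ⟨d, hd, hd'⟩ := Metric.continuousAt_iff.1 (hball t₀ (Metric.mem_ball_self hδ)).continuousAt
      (e / 2) (by positivity)
    have h2 : ∀ᶠ l : ℝ in 𝓝 0, |l| < d := by
      have := (continuous_abs (G := ℝ)).tendsto 0
      rw [abs_zero] at this
      exact this.eventually_lt_const hd
    filter_upwards [hsmall, h2] with l h3 h4
    refine lt_of_le_of_lt ((ContinuousMap.dist_le (by positivity)).2 fun s => ?_) (half_lt_self he)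
    rw [hU l h3]
    refine (hd' ?_).le
    rw [Real.dist_eq, add_sub_cancel_left, abs_mul, abs_of_nonneg s.2.1]
    exact lt_of_le_of_lt (mul_le_of_le_one_right (abs_nonneg _) s.2.2) h4
  have hfU : ∀ᶠ l in 𝓝 (0 : ℝ), Φ (l, U l) = Φ (0, c) := by
    have hclose : ∀ᶠ l in 𝓝 (0 : ℝ), ‖U l - c‖ < r := by
      have := (hUt.sub_const c).norm
      rw [sub_self, norm_zero] at this
      exact this.eventually_lt_const hr
    filter_upwards [hsmall, hclose] with l hl hl2
    have hΦ0 : Φ (0, c) = 0 := by simp [Φ]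
    rw [hΦ0]
    ext s
    have hN2 : ∀ s : I, N (U l) s = f (γ (t₀ + l * s)) := fun s => by rw [hNf _ hl2, hU l hl]
    have h5 := mul_avg_eq (N (U l)) (fun t => f (γ (t₀ + t))) l hN2 s
    have h6 : ∀ t ∈ uIcc 0 (l * s), t₀ + t ∈ Metric.ball t₀ δ := by
      intro t ht
      rw [Metric.mem_ball, Real.dist_eq, add_sub_cancel_left]
      have : |t| ≤ |l * s| := by
        rcases abs_sub_left_of_mem_uIcc ht with h; simpa using h
      refine this.trans_lt ?_
      have := hcl l hl s
      rwa [Metric.mem_ball, Real.dist_eq, add_sub_cancel_left] at this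
    have h7 : ∫ t in (0 : ℝ)..(l * s), f (γ (t₀ + t)) = γ (t₀ + l * s) - γ (t₀ + 0) := by
      refine intervalIntegral.integral_eq_sub_of_hasDerivAt (f := fun t => γ (t₀ + t))
        (fun t ht => ?_) ?_
      · simpa using (hball _ (h6 t ht)).comp_const_add t₀ t
      · refine ContinuousOn.intervalIntegrable ?_
        intro t ht
        have h8 := hball' _ (h6 t ht)
        have h9 : ContinuousAt (fun t => γ (t₀ + t)) t :=
          ContinuousAt.comp (f := fun t => t₀ + t) h8.1.continuousAt (by fun_prop)
        exact (ContinuousAt.comp (f := fun t => γ (t₀ + t)) h8.2 h9).continuousWithinAt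
    simp only [Φ, ContinuousMap.sub_apply, ContinuousMap.smul_apply, prim_apply, hU l hl,
      ContinuousMap.zero_apply, smul_smul, hc, ContinuousMap.const_apply]
    rw [h5, h7, add_zero, sub_self]
  have hfin : ∀ᶠ l in 𝓝 (0 : ℝ), ψ l = U l := by
    have h8 : Tendsto (fun l => (l, U l)) (𝓝 0) (𝓝 ((0 : ℝ), c)) := tendsto_id.prodMk_nhds hUt
    filter_upwards [h8.eventually hev, hfU] with l h9 h10
    exact h9.1 h10
  have hev1 : ∀ᶠ l in 𝓝 (0 : ℝ), ψ l 1 = γ (t₀ + l) := by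
    filter_upwards [hfin, hsmall] with l h1 h2
    rw [h1, hU l h2]; simp
  have hA : AnalyticAt ℝ (fun l => ψ l 1) 0 := by
    have : ContDiffAt ℝ ω (fun l => (ContinuousMap.evalCLM ℝ (1 : I)) (ψ l)) 0 :=
      (ContinuousLinearMap.contDiff _).contDiffAt.comp _ hψa
    exact this.analyticAt
  have hB : AnalyticAt ℝ (fun l => γ (t₀ + l)) 0 := hA.congr hev1
  have hC : AnalyticAt ℝ (fun t : ℝ => t - t₀) t₀ := by fun_prop
  have := AnalyticAt.fun_comp (g := fun l => γ (t₀ + l)) (f := fun t : ℝ => t - t₀) (x := t₀)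
    (by simpa using hB) hC
  simpa using this

end AnalyticODE

section Fields
variable {A : Type*} [CommRing A] [Algebra ℝ A]

/-- `x D' ` in terms of `q = (D - W) / b`. -/
def velD (ε : ℝ) (D W q : A) : A := (-2 * (1 - ε)) • (D * (W + ε • 1) * q)

/-- `x W'` in terms of `q`. -/
def velW (ε : ℝ) (W q : A) : A := 1 - (3 : ℝ) • W + (2 * (1 + ε)) • (W * (W + ε • 1) * q)

/-- `x E'` for `E = D^(-η) x^(-2)`. -/
def velE (ε : ℝ) (W E q : A) : A := (-2 : ℝ) • E + (4 * ε) • (E * (W + ε • 1) * q)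

/-- The quotient `b / τ` for `D = w + τ P`, `W = w + τ S`, `E = cH + τ G`. -/
def denSlope (ε w : ℝ) (τ P S G : A) : A :=
  G - (S * ((2 * w + 2 * ε) • 1 + τ * S) - ε • (S * ((2 * w - 2) • 1 + τ * S))
    + (4 * ε) • (w • P + w • S + τ * P * S))

end Fields

/-- The bracket `J` in the sonic denominator. -/
def brJ (ε D W : ℝ) : ℝ := (W + ε) ^ 2 - ε * (W - 1) ^ 2 + 4 * ε * D * W

theorem denSlope_mul (ε w τ P S G : ℝ) :
    τ * denSlope ε w τ P S G = (cH ε w + τ * G) - brJ ε (w + τ * P) (w + τ * S) := by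
  simp only [denSlope, cH, brJ, smul_eq_mul]; ring

abbrev CA := C(unitInterval, ℝ)

/-- The coordinate function on the unit interval. -/
def coordI : CA := ⟨fun s => s, continuous_subtype_val⟩

theorem coordI_apply (s : unitInterval) : coordI s = s := rfl

/-- The fixed-point equation for the slopes `(P, S, G, q)` along `[0, λ]`, rescaled to `[0, 1]`. -/
def sonicMap (p : (ℝ × ℝ × ℝ) × (CA × CA × CA × CA)) : CA × CA × CA × CA :=
  let l := p.1.1
  let ε := p.1.2.1
  let w := p.1.2.2
  let P := p.2.1
  let S := p.2.2.1
  let G := p.2.2.2.1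
  let q := p.2.2.2.2
  let τ := l • coordI
  (P - avg (velD ε (w • 1 + τ * P) (w • 1 + τ * S) q),
    S - avg (velW ε (w • 1 + τ * S) q),
    G - avg (velE ε (w • 1 + τ * S) ((cH ε w) • 1 + τ * G) q),
    denSlope ε w τ P S G * q - (P - S))

theorem contDiff_sonicMap : ContDiff ℝ ω sonicMap := by
  have havg : ContDiff ℝ ω (avg : CA →L[ℝ] CA) := (avg : CA →L[ℝ] CA).contDiff
  unfold sonicMap
  refine ContDiff.prodMk ?_ (ContDiff.prodMk ?_ (ContDiff.prodMk ?_ ?_))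
  · refine ContDiff.sub (by fun_prop) (havg.comp ?_)
    unfold velD; fun_prop
  · refine ContDiff.sub (by fun_prop) (havg.comp ?_)
    unfold velW; fun_prop
  · refine ContDiff.sub (by fun_prop) (havg.comp ?_)
    unfold velE cH; fun_prop
  · unfold denSlope; fun_prop

theorem avg_one : avg (1 : CA) = 1 := by
  ext s; simp [avg_apply]

/-- The Larson-Penston slopes at `ε = 0`. -/
def baseSlopes (σ : ℝ) : ℝ × ℝ × ℝ × ℝ := (-σ, 1 - 2 * σ, -2 * σ ^ 2, 1 / (2 * σ))

def constCA (u : ℝ × ℝ × ℝ × ℝ) : CA × CA × CA × CA :=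
  (u.1 • 1, u.2.1 • 1, u.2.2.1 • 1, u.2.2.2 • 1)

theorem sonicMap_zero (σ : ℝ) (u : CA × CA × CA × CA) :
    sonicMap ((0, 0, σ), u) = (u.1 + (2 * σ ^ 2) • avg u.2.2.2,
      u.2.1 - (1 - 3 * σ) • 1 - (2 * σ ^ 2) • avg u.2.2.2, u.2.2.1 + (2 * σ ^ 2) • 1,
      (u.2.2.1 - (2 * σ) • u.2.1) * u.2.2.2 - (u.1 - u.2.1)) := by
  unfold sonicMap velD velW velE denSlope cH
  have h1 : ∀ c : ℝ, avg (c • u.2.2.2) = c • avg u.2.2.2 := fun c => map_smul _ _ _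
  have h2 : (σ • (1 : CA)) * (σ • 1) * u.2.2.2 = σ ^ 2 • u.2.2.2 := by
    ext s; simp; ring
  have h3 : (σ ^ 2 • (1 : CA)) * (σ • 1) * u.2.2.2 = σ ^ 3 • u.2.2.2 := by
    ext s; simp; ring
  ext s <;> simp [avg_one, h1] <;> ring

theorem sonicMap_base {σ : ℝ} (hσ : 0 < σ) :
    sonicMap ((0, 0, σ), constCA (baseSlopes σ)) = 0 := by
  rw [sonicMap_zero]
  unfold constCA baseSlopes
  ext s <;> simp [avg_one] <;> field_simp <;> ring

/-- The derivative of the fixed-point equation with respect to the unknowns. -/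
def sonicDeriv (σ : ℝ) : (CA × CA × CA × CA) →L[ℝ] (CA × CA × CA × CA) :=
  let p1 : (CA × CA × CA × CA) →L[ℝ] CA := .fst ℝ CA (CA × CA × CA)
  let p2 : (CA × CA × CA × CA) →L[ℝ] CA := .fst ℝ CA (CA × CA) ∘L .snd ℝ CA (CA × CA × CA)
  let p3 : (CA × CA × CA × CA) →L[ℝ] CA :=
    .fst ℝ CA CA ∘L .snd ℝ CA (CA × CA) ∘L .snd ℝ CA (CA × CA × CA)
  let p4 : (CA × CA × CA × CA) →L[ℝ] CA :=
    .snd ℝ CA CA ∘L .snd ℝ CA (CA × CA) ∘L .snd ℝ CA (CA × CA × CA)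
  (p1 + (2 * σ ^ 2) • (avg ∘L p4)).prod ((p2 - (2 * σ ^ 2) • (avg ∘L p4)).prod
    (p3.prod ((1 / (2 * σ)) • p3 - (2 * σ * (1 - σ)) • p4 - p1)))

theorem sonicDeriv_apply (σ : ℝ) (u : CA × CA × CA × CA) : sonicDeriv σ u =
    (u.1 + (2 * σ ^ 2) • avg u.2.2.2, u.2.1 - (2 * σ ^ 2) • avg u.2.2.2, u.2.2.1,
      (1 / (2 * σ)) • u.2.2.1 - (2 * σ * (1 - σ)) • u.2.2.2 - u.1) := rfl

theorem hasFDerivAt_sonicMap_zero {σ : ℝ} (hσ : 0 < σ) :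
    HasFDerivAt (fun u => sonicMap ((0, 0, σ), u)) (sonicDeriv σ) (constCA (baseSlopes σ)) := by
  have hfun : (fun u => sonicMap ((0, 0, σ), u)) = fun u => (u.1 + (2 * σ ^ 2) • avg u.2.2.2,
      u.2.1 - (1 - 3 * σ) • 1 - (2 * σ ^ 2) • avg u.2.2.2, u.2.2.1 + (2 * σ ^ 2) • 1,
      (u.2.2.1 - (2 * σ) • u.2.1) * u.2.2.2 - (u.1 - u.2.1)) := funext fun u => sonicMap_zero σ u
  rw [hfun]
  set c := constCA (baseSlopes σ) with hc
  have h1 : HasFDerivAt (fun u : CA × CA × CA × CA => u.1) (.fst ℝ CA (CA × CA × CA)) c :=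
    hasFDerivAt_fst
  have hs : HasFDerivAt (fun u : CA × CA × CA × CA => u.2) (.snd ℝ CA (CA × CA × CA)) c :=
    hasFDerivAt_snd
  have h2 := hs.fst
  have h3 := hs.snd.fst
  have h4 := hs.snd.snd
  have ha := ((avg (E := ℝ)).hasFDerivAt (x := c.2.2.2)).comp c h4
  have := (h1.add (ha.const_smul (2 * σ ^ 2))).prodMk
    (((h2.sub_const ((1 - 3 * σ) • 1)).sub (ha.const_smul (2 * σ ^ 2))).prodMk
      ((h3.add_const ((2 * σ ^ 2) • 1)).prodMk
        (((h3.sub (h2.const_smul (2 * σ))).mul h4).sub (h1.sub h2))))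
  refine this.congr_fderiv ?_
  refine ContinuousLinearMap.ext fun u => ?_
  rw [sonicDeriv_apply]
  refine Prod.ext rfl (Prod.ext rfl (Prod.ext rfl ?_))
  ext s
  simp [hc, constCA, baseSlopes]
  field_simp
  ring

theorem isInvertible_sonicDeriv {σ : ℝ} (hσ : 0 < σ) (hσ' : σ < 1 / 2) :
    (sonicDeriv σ).IsInvertible := by
  have h1σ : 0 < 1 - σ := by linarith
  set c : ℝ := σ / (1 - σ) with hc
  have hc1 : c < 1 := by rw [hc, div_lt_one h1σ]; linarith
  have hc0 : 0 < c := by positivity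
  have hnorm : ‖c • (avg : CA →L[ℝ] CA)‖ < 1 := by
    refine lt_of_le_of_lt (ContinuousLinearMap.opNorm_le_bound _ hc0.le fun h => ?_) hc1
    change ‖c • avg h‖ ≤ c * ‖h‖
    rw [ContinuousMap.norm_le _ (by positivity)]
    intro s
    rw [ContinuousMap.smul_apply, norm_smul, Real.norm_of_nonneg hc0.le]
    exact mul_le_mul_of_nonneg_left (norm_avg_apply_le h s) hc0.le
  set M := Units.oneSub (c • (avg : CA →L[ℝ] CA)) hnorm with hM
  have hMv : ∀ v : CA, (M : CA →L[ℝ] CA) v = v - c • avg v := by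
    intro v; simp [hM]
  have hMi1 : ∀ v : CA, (M⁻¹ : (CA →L[ℝ] CA)ˣ).val (M.val v) = v := by
    intro v
    change ((M⁻¹ : (CA →L[ℝ] CA)ˣ).val * M.val) v = v
    rw [M.inv_mul]; rfl
  have hMi2 : ∀ v : CA, M.val ((M⁻¹ : (CA →L[ℝ] CA)ˣ).val v) = v := by
    intro v
    change (M.val * (M⁻¹ : (CA →L[ℝ] CA)ˣ).val) v = v
    rw [M.mul_inv]; rfl
  have hcσ : (2 * σ * (1 - σ)) * c = 2 * σ ^ 2 := by rw [hc]; field_simp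
  have key : ∀ v : CA, (2 * σ * (1 - σ)) • M.val v
      = (2 * σ * (1 - σ)) • v - (2 * σ ^ 2) • avg v := by
    intro v; rw [hMv, smul_sub, smul_smul, hcσ]
  have hne : 2 * σ * (1 - σ) ≠ 0 := by positivity
  have hbij : Function.Bijective (sonicDeriv σ) := by
    constructor
    · rw [injective_iff_map_eq_zero]
      rintro ⟨P, S, G, q⟩ h
      rw [sonicDeriv_apply] at h
      simp only [Prod.mk_eq_zero] at h
      obtain ⟨e1, e2, e3, e4⟩ := h
      have e5 : (2 * σ * (1 - σ)) • M.val q = 0 := by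
        rw [key]
        rw [e3, smul_zero, zero_sub] at e4
        linear_combination (norm := module) (-1 : ℝ) • e1 - e4
      have e6 : q = 0 := by
        have := (smul_eq_zero.1 e5).resolve_left hne
        rw [← hMi1 q, this, map_zero]
      subst e6
      simp only [map_zero, smul_zero, add_zero, sub_zero] at e1 e2
      simp [e1, e2, e3]
    · rintro ⟨a, b, g, d⟩
      set q := (M⁻¹ : (CA →L[ℝ] CA)ˣ).val
        ((2 * σ * (1 - σ))⁻¹ • ((1 / (2 * σ)) • g - a - d)) with hq
      have hk := key q
      rw [hq, hMi2, smul_smul, mul_inv_cancel₀ hne, one_smul, ← hq] at hk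
      refine ⟨(a - (2 * σ ^ 2) • avg q, b + (2 * σ ^ 2) • avg q, g, q), ?_⟩
      rw [sonicDeriv_apply]
      simp only [Prod.mk.injEq, sub_add_cancel, add_sub_cancel_right, true_and]
      linear_combination (norm := module) hk
  exact ⟨ContinuousLinearEquiv.ofBijective (sonicDeriv σ) (LinearMap.ker_eq_bot.2 hbij.1)
    (LinearMap.range_eq_top.2 hbij.2), rfl⟩

theorem velD_apply (ε : ℝ) (D W q : CA) (s : unitInterval) :
    velD ε D W q s = velD ε (D s) (W s) (q s) := by
  simp [velD]

theorem velW_apply (ε : ℝ) (W q : CA) (s : unitInterval) :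
    velW ε W q s = velW ε (W s) (q s) := by
  simp [velW]

theorem velE_apply (ε : ℝ) (W E q : CA) (s : unitInterval) :
    velE ε W E q s = velE ε (W s) (E s) (q s) := by
  simp [velE]

theorem denSlope_apply (ε w : ℝ) (τ P S G : CA) (s : unitInterval) :
    denSlope ε w τ P S G s = denSlope ε w (τ s) (P s) (S s) (G s) := by
  simp [denSlope]
  ring

/-- The functions `(P, S, G, q)` on `[0, l]` are the slopes of a solution with sonic values
`(w, w, cH)` at `0`. -/
structure IsSonicSlopes (ε w l : ℝ) (u : ℝ → ℝ × ℝ × ℝ × ℝ) : Prop where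
  cont : ContinuousOn u (uIcc 0 l)
  eqP : ∀ t ∈ uIcc 0 l, t * (u t).1 = ∫ s in (0 : ℝ)..t,
    velD ε (w + s * (u s).1) (w + s * (u s).2.1) (u s).2.2.2
  eqS : ∀ t ∈ uIcc 0 l, t * (u t).2.1 = ∫ s in (0 : ℝ)..t,
    velW ε (w + s * (u s).2.1) (u s).2.2.2
  eqG : ∀ t ∈ uIcc 0 l, t * (u t).2.2.1 = ∫ s in (0 : ℝ)..t,
    velE ε (w + s * (u s).2.1) (cH ε w + s * (u s).2.2.1) (u s).2.2.2
  alg : ∀ t ∈ uIcc 0 l, denSlope ε w t (u t).1 (u t).2.1 (u t).2.2.1 * (u t).2.2.2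
    = (u t).1 - (u t).2.1
  initP : (u 0).1 = velD ε w w (u 0).2.2.2
  initS : (u 0).2.1 = velW ε w (u 0).2.2.2
  initG : (u 0).2.2.1 = velE ε w (cH ε w) (u 0).2.2.2

theorem mul_mem_uIcc (l : ℝ) (s : unitInterval) : l * s ∈ uIcc 0 l := by
  rw [mem_uIcc]
  rcases le_total 0 l with h | h
  · exact Or.inl ⟨mul_nonneg h s.2.1, mul_le_of_le_one_right h s.2.2⟩
  · exact Or.inr ⟨by nlinarith [s.2.2], mul_nonpos_of_nonpos_of_nonneg h s.2.1⟩

/-- The slopes rescaled to the unit interval. -/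
def slopesCA (l : ℝ) (u : ℝ → ℝ × ℝ × ℝ × ℝ) (hu : ContinuousOn u (uIcc 0 l)) :
    CA × CA × CA × CA :=
  have h : Continuous fun s : unitInterval => u (l * s) :=
    hu.comp_continuous (by fun_prop) (mul_mem_uIcc l)
  (⟨fun s => (u (l * s)).1, h.fst⟩, ⟨fun s => (u (l * s)).2.1, h.snd.fst⟩,
    ⟨fun s => (u (l * s)).2.2.1, h.snd.snd.fst⟩, ⟨fun s => (u (l * s)).2.2.2, h.snd.snd.snd⟩)

theorem sonicMap_slopesCA {ε w l : ℝ} {u : ℝ → ℝ × ℝ × ℝ × ℝ} (h : IsSonicSlopes ε w l u) :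
    sonicMap ((l, ε, w), slopesCA l u h.cont) = 0 := by
  have key : ∀ (a h : CA) (g : ℝ → ℝ), (∀ s, h s = g (l * s)) →
      (∀ s : unitInterval, (l * s) * a s = ∫ t in (0 : ℝ)..(l * s), g t) →
      (∀ s : unitInterval, l * s = 0 → a s = g 0) → a - avg h = 0 := by
    intro a h g hg ha h0
    ext s
    rw [ContinuousMap.sub_apply, ContinuousMap.zero_apply, sub_eq_zero]
    by_cases hs : l * s = 0
    · rw [h0 s hs, avg_apply]
      have : ∀ τ : unitInterval, h (τ * s) = g 0 := by
        intro τ; rw [hg]; congr 1; push_cast; rw [mul_left_comm, hs, mul_zero]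
      simp [this]
    · have h1 := mul_avg_eq h g l hg s
      rw [← ha s, smul_eq_mul] at h1
      exact (mul_left_cancel₀ hs h1).symm
  unfold sonicMap slopesCA
  refine Prod.ext ?_ (Prod.ext ?_ (Prod.ext ?_ ?_))
  · refine key _ _ (fun s => velD ε (w + s * (u s).1) (w + s * (u s).2.1) (u s).2.2.2)
      (fun s => ?_) (fun s => h.eqP _ (mul_mem_uIcc l s)) (fun s hs => ?_)
    · rw [velD_apply]; simp [coordI_apply, ← mul_assoc]
    · change (u (l * s)).1 = _
      rw [hs, h.initP]; simp
  · refine key _ _ (fun s => velW ε (w + s * (u s).2.1) (u s).2.2.2)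
      (fun s => ?_) (fun s => h.eqS _ (mul_mem_uIcc l s)) (fun s hs => ?_)
    · rw [velW_apply]; simp [coordI_apply, ← mul_assoc]
    · change (u (l * s)).2.1 = _
      rw [hs, h.initS]; simp
  · refine key _ _ (fun s => velE ε (w + s * (u s).2.1) (cH ε w + s * (u s).2.2.1) (u s).2.2.2)
      (fun s => ?_) (fun s => h.eqG _ (mul_mem_uIcc l s)) (fun s hs => ?_)
    · rw [velE_apply]; simp [coordI_apply, ← mul_assoc]
    · change (u (l * s)).2.2.1 = _
      rw [hs, h.initG]; simp
  · ext s
    have := h.alg _ (mul_mem_uIcc l s)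
    simp only [ContinuousMap.sub_apply, ContinuousMap.mul_apply, denSlope_apply,
      ContinuousMap.coe_mk, ContinuousMap.smul_apply, coordI_apply, smul_eq_mul]
    rw [this]; simp

theorem slopesCA_eq_constCA_dist {l r : ℝ} (hr : 0 < r) {u : ℝ → ℝ × ℝ × ℝ × ℝ}
    (hu : ContinuousOn u (uIcc 0 l)) {b : ℝ × ℝ × ℝ × ℝ} (h : ∀ t ∈ uIcc 0 l, dist (u t) b < r) :
    dist (slopesCA l u hu) (constCA b) < r := by
  have h' : ∀ s : unitInterval, dist (u (l * s)) b < r := fun s => h _ (mul_mem_uIcc l s)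
  simp only [Prod.dist_eq, max_lt_iff] at h' ⊢
  refine ⟨?_, ?_, ?_, ?_⟩ <;> rw [ContinuousMap.dist_lt_iff hr] <;> intro s
  · simpa [slopesCA, constCA] using (h' s).1
  · simpa [slopesCA, constCA] using (h' s).2.1
  · simpa [slopesCA, constCA] using (h' s).2.2.1
  · simpa [slopesCA, constCA] using (h' s).2.2.2

def evalOne (v : CA × CA × CA × CA) : ℝ × ℝ × ℝ × ℝ := (v.1 1, v.2.1 1, v.2.2.1 1, v.2.2.2 1)

theorem analyticAt_evalOne (v : CA × CA × CA × CA) : AnalyticAt ℝ evalOne v := by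
  have h : AnalyticAt ℝ (fun a : CA => a 1) = fun _ => True := by
    ext a
    exact iff_true_intro ((ContinuousMap.evalCLM ℝ (1 : unitInterval)).analyticAt a)
  have h' : ∀ a : CA, AnalyticAt ℝ (fun a : CA => a 1) a := fun a => by rw [h]; trivial
  unfold evalOne
  exact ((h' _).fun_comp analyticAt_fst).prod (((h' _).fun_comp
    (analyticAt_fst.fun_comp analyticAt_snd)).prod
    (((h' _).fun_comp (analyticAt_fst.fun_comp (analyticAt_snd.fun_comp analyticAt_snd))).prod
      ((h' _).fun_comp (analyticAt_snd.fun_comp (analyticAt_snd.fun_comp analyticAt_snd)))))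

def rescale4 (v : CA × CA × CA × CA) (a : unitInterval) : CA × CA × CA × CA :=
  (rescale v.1 a, rescale v.2.1 a, rescale v.2.2.1 a, rescale v.2.2.2 a)

theorem sonicMap_rescale4 {l ε w : ℝ} {v : CA × CA × CA × CA} (h : sonicMap ((l, ε, w), v) = 0)
    (a : unitInterval) : sonicMap ((l * a, ε, w), rescale4 v a) = 0 := by
  unfold sonicMap at h
  simp only [Prod.mk_eq_zero] at h
  obtain ⟨h1, h2, h3, h4⟩ := h
  have key : ∀ (f h k : CA), f - avg h = 0 → k = rescale h a → rescale f a - avg k = 0 := by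
    intro f h k hf hk
    rw [hk, avg_rescale, sub_eq_zero.1 hf, sub_self]
  unfold sonicMap rescale4
  refine Prod.ext (key _ _ _ h1 ?_) (Prod.ext (key _ _ _ h2 ?_) (Prod.ext (key _ _ _ h3 ?_) ?_))
  · ext s
    simp only [velD_apply, rescale_apply, ContinuousMap.add_apply, ContinuousMap.smul_apply,
      ContinuousMap.mul_apply, coordI_apply, ContinuousMap.one_apply, smul_eq_mul, mul_assoc,
      Set.Icc.coe_mul]
  · ext s
    simp only [velW_apply, rescale_apply, ContinuousMap.add_apply, ContinuousMap.smul_apply,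
      ContinuousMap.mul_apply, coordI_apply, ContinuousMap.one_apply, smul_eq_mul, mul_assoc,
      Set.Icc.coe_mul]
  · ext s
    simp only [velE_apply, rescale_apply, ContinuousMap.add_apply, ContinuousMap.smul_apply,
      ContinuousMap.mul_apply, coordI_apply, ContinuousMap.one_apply, smul_eq_mul, mul_assoc,
      Set.Icc.coe_mul]
  · ext s
    have := congrArg (fun f : CA => f (a * s)) h4
    simp only [denSlope_apply, rescale_apply, ContinuousMap.sub_apply, ContinuousMap.smul_apply,
      ContinuousMap.mul_apply, coordI_apply, smul_eq_mul, mul_assoc,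
      Set.Icc.coe_mul, ContinuousMap.zero_apply] at this ⊢
    exact this

theorem dist_rescale4_le (v : CA × CA × CA × CA) (b : ℝ × ℝ × ℝ × ℝ) {r : ℝ} (hr : 0 < r)
    (h : dist v (constCA b) < r) (a : unitInterval) : dist (rescale4 v a) (constCA b) < r := by
  simp only [Prod.dist_eq, max_lt_iff] at h ⊢
  obtain ⟨h1, h2, h3, h4⟩ := h
  refine ⟨?_, ?_, ?_, ?_⟩ <;> rw [ContinuousMap.dist_lt_iff hr] at * <;> intro s
  · simpa [rescale4, constCA, rescale_apply] using h1 (a * s)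
  · simpa [rescale4, constCA, rescale_apply] using h2 (a * s)
  · simpa [rescale4, constCA, rescale_apply] using h3 (a * s)
  · simpa [rescale4, constCA, rescale_apply] using h4 (a * s)

theorem IsSonicSlopes.mono {ε w l l' : ℝ} {u : ℝ → ℝ × ℝ × ℝ × ℝ} (h : IsSonicSlopes ε w l u)
    (hl : l' ∈ uIcc 0 l) : IsSonicSlopes ε w l' u :=
  have hs : uIcc 0 l' ⊆ uIcc 0 l := uIcc_subset_uIcc left_mem_uIcc hl
  ⟨h.cont.mono hs, fun t ht => h.eqP t (hs ht), fun t ht => h.eqS t (hs ht),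
    fun t ht => h.eqG t (hs ht), fun t ht => h.alg t (hs ht), h.initP, h.initS, h.initG⟩

/-- Existence, analyticity and uniqueness of the sonic germ of Larson-Penston type. -/
theorem exists_sonic_germ {σ : ℝ} (hσ : 0 < σ) (hσ' : σ < 1 / 2) :
    ∃ (g : ℝ × ℝ × ℝ → ℝ × ℝ × ℝ × ℝ) (r : ℝ), 0 < r ∧ g (0, 0, σ) = baseSlopes σ ∧
      (∀ l ε w, |l| < r → |ε| < r → |w - σ| < r → AnalyticAt ℝ g (l, ε, w)) ∧
      (∀ l ε w, |l| < r → |ε| < r → |w - σ| < r →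
        IsSonicSlopes ε w l (fun t => g (t, ε, w))) ∧
      (∀ l ε w u, 0 ≤ l → |ε| < r → |w - σ| < r → IsSonicSlopes ε w l u →
        dist (u 0) (baseSlopes σ) < r →
        ∃ l' > 0, ∀ t ∈ Icc 0 l, t ≤ l' → u t = g (t, ε, w)) := by
  set u₀ := constCA (baseSlopes σ) with hu₀
  have hc : ContDiffAt ℝ ω sonicMap ((0, 0, σ), u₀) := contDiff_sonicMap.contDiffAt
  have hinv : (fderiv ℝ sonicMap ((0, 0, σ), u₀) ∘L .inr ℝ (ℝ × ℝ × ℝ) (CA × CA × CA × CA)).IsInvertible := by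
    rw [fderiv_comp_inr (hc.differentiableAt (by simp)) (hasFDerivAt_sonicMap_zero hσ)]
    exact isInvertible_sonicDeriv hσ hσ'
  set ψ := hc.implicitFunction (by simp) hinv with hψ
  have hψa : AnalyticAt ℝ ψ (0, 0, σ) :=
    (hc.contDiffAt_implicitFunction (by simp) hinv).analyticAt
  have hev := hc.eventually_apply_eq_iff_implicitFunction (by simp) hinv
  have hψ0 : ψ (0, 0, σ) = u₀ := hc.implicitFunction_apply_self (by simp) hinv
  rw [sonicMap_base hσ] at hev
  obtain ⟨r₀, hr₀, hball⟩ := Metric.eventually_nhds_iff_ball.1 hev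
  have hnear : ∀ᶠ p in 𝓝 ((0, 0, σ) : ℝ × ℝ × ℝ), AnalyticAt ℝ ψ p ∧ dist (ψ p) u₀ < r₀ := by
    refine hψa.eventually_analyticAt.and ?_
    have := hψa.continuousAt.eventually (Metric.ball_mem_nhds (ψ (0, 0, σ)) hr₀)
    rw [hψ0] at this
    exact this
  obtain ⟨r₁, hr₁, hball₁⟩ := Metric.eventually_nhds_iff_ball.1 hnear
  set r := min r₀ r₁ with hr
  have hrpos : 0 < r := lt_min hr₀ hr₁
  have hmem : ∀ l ε w : ℝ, |l| < r → |ε| < r → |w - σ| < r →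
      dist ((l, ε, w) : ℝ × ℝ × ℝ) (0, 0, σ) < r := by
    intro l ε w h1 h2 h3
    simp only [Prod.dist_eq, Real.dist_eq, sub_zero, max_lt_iff]
    exact ⟨h1, h2, h3⟩
  have hiff : ∀ l ε w v, |l| < r → |ε| < r → |w - σ| < r → dist v u₀ < r₀ →
      (sonicMap ((l, ε, w), v) = 0 ↔ ψ (l, ε, w) = v) := by
    intro l ε w v h1 h2 h3 hv
    refine hball ((l, ε, w), v) ?_
    rw [Metric.mem_ball, Prod.dist_eq, max_lt_iff]
    exact ⟨(hmem l ε w h1 h2 h3).trans_le (min_le_left _ _), hv⟩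
  have hψr : ∀ l ε w, |l| < r → |ε| < r → |w - σ| < r →
      AnalyticAt ℝ ψ (l, ε, w) ∧ dist (ψ (l, ε, w)) u₀ < r₀ := fun l ε w h1 h2 h3 =>
    hball₁ _ (Metric.mem_ball.2 ((hmem l ε w h1 h2 h3).trans_le (min_le_right _ _)))
  have hzero : ∀ l ε w, |l| < r → |ε| < r → |w - σ| < r → sonicMap ((l, ε, w), ψ (l, ε, w)) = 0 :=
    fun l ε w h1 h2 h3 => (hiff l ε w _ h1 h2 h3 (hψr l ε w h1 h2 h3).2).2 rfl
  have habs : ∀ (l : ℝ) (a : unitInterval), |l| < r → |l * a| < r := by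
    intro l a h
    rw [abs_mul, abs_of_nonneg a.2.1]
    exact (mul_le_of_le_one_right (abs_nonneg _) a.2.2).trans_lt h
  have hresc : ∀ (l ε w : ℝ) (a : unitInterval), |l| < r → |ε| < r → |w - σ| < r →
      ψ (l * a, ε, w) = rescale4 (ψ (l, ε, w)) a := by
    intro l ε w a h1 h2 h3
    exact (hiff _ _ _ _ (habs l a h1) h2 h3
      (dist_rescale4_le _ _ hr₀ (hψr l ε w h1 h2 h3).2 a)).1
      (sonicMap_rescale4 (hzero l ε w h1 h2 h3) a)
  have hval : ∀ (l ε w : ℝ) (a : unitInterval), |l| < r → |ε| < r → |w - σ| < r →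
      evalOne (ψ (l * a, ε, w)) = ((ψ (l, ε, w)).1 a, (ψ (l, ε, w)).2.1 a,
        (ψ (l, ε, w)).2.2.1 a, (ψ (l, ε, w)).2.2.2 a) := by
    intro l ε w a h1 h2 h3
    rw [hresc l ε w a h1 h2 h3]
    simp [evalOne, rescale4, rescale_apply]
  have han : ∀ l ε w, |l| < r → |ε| < r → |w - σ| < r →
      AnalyticAt ℝ (fun p => evalOne (ψ p)) (l, ε, w) := fun l ε w h1 h2 h3 =>
    (analyticAt_evalOne _).fun_comp (hψr l ε w h1 h2 h3).1
  refine ⟨fun p => evalOne (ψ p), r, hrpos, ?_, han, ?_, ?_⟩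
  · simp only [hψ0, hu₀]
    simp [evalOne, constCA]
  · intro l ε w h1 h2 h3
    have ht : ∀ t ∈ uIcc 0 l, |t| < r := fun t ht => by
      have : |t - 0| ≤ |l - 0| := abs_sub_left_of_mem_uIcc ht
      simpa using this.trans_lt (by simpa using h1)
    have hpt : ∀ t, |t| < r → ∀ (f h : CA) (g : ℝ → ℝ), f - avg h = 0 →
        (∀ s : unitInterval, h s = g (t * s)) →
        t * f 1 = (∫ s in (0 : ℝ)..t, g s) ∧ (t = 0 → f 1 = g 0) := by
      intro t ht f h g hf hg
      rw [sub_eq_zero.1 hf]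
      constructor
      · have := mul_avg_eq h g t hg 1
        simpa using this
      · rintro rfl
        have : ∀ s : unitInterval, h s = g 0 := by intro s; rw [hg]; simp
        rw [avg_apply]; simp [this]
    have hz := fun t ht' => hzero t ε w (ht t ht') h2 h3
    have hv := fun t ht' a => hval t ε w a (ht t ht') h2 h3
    have hP : ∀ t ∈ uIcc 0 l, _ := fun t ht' => hpt t (ht t ht') _ _
      (fun s => velD ε (w + s * (evalOne (ψ (s, ε, w))).1) (w + s * (evalOne (ψ (s, ε, w))).2.1)
        (evalOne (ψ (s, ε, w))).2.2.2) (congrArg (fun v => v.1) (hz t ht')) (fun s => by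
          simp only [hv t ht' s, velD_apply]
          simp [coordI_apply, mul_assoc])
    have hS : ∀ t ∈ uIcc 0 l, _ := fun t ht' => hpt t (ht t ht') _ _
      (fun s => velW ε (w + s * (evalOne (ψ (s, ε, w))).2.1)
        (evalOne (ψ (s, ε, w))).2.2.2) (congrArg (fun v => v.2.1) (hz t ht')) (fun s => by
          simp only [hv t ht' s, velW_apply]
          simp [coordI_apply, mul_assoc])
    have hG : ∀ t ∈ uIcc 0 l, _ := fun t ht' => hpt t (ht t ht') _ _
      (fun s => velE ε (w + s * (evalOne (ψ (s, ε, w))).2.1)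
        (cH ε w + s * (evalOne (ψ (s, ε, w))).2.2.1)
        (evalOne (ψ (s, ε, w))).2.2.2) (congrArg (fun v => v.2.2.1) (hz t ht')) (fun s => by
          simp only [hv t ht' s, velE_apply]
          simp [coordI_apply, mul_assoc])
    refine ⟨?_, fun t ht' => (hP t ht').1, fun t ht' => (hS t ht').1, fun t ht' => (hG t ht').1,
      ?_, ?_, ?_, ?_⟩
    · intro t ht'
      have h4 : ContinuousAt (fun p => evalOne (ψ p)) (t, ε, w) :=
        (han t ε w (ht t ht') h2 h3).continuousAt
      exact (ContinuousAt.comp (f := fun t : ℝ => (t, ε, w)) h4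
        (by fun_prop)).continuousWithinAt
    · intro t ht'
      have := congrArg (fun v : CA × CA × CA × CA => v.2.2.2 1) (hz t ht')
      simp only [sonicMap, ContinuousMap.sub_apply, ContinuousMap.mul_apply, denSlope_apply,
        ContinuousMap.smul_apply, coordI_apply] at this
      simp only [evalOne]
      have := sub_eq_zero.1 this
      simpa using this
    · have := (hP 0 left_mem_uIcc).2 rfl
      simp only [zero_mul, add_zero] at this
      exact this
    · have := (hS 0 left_mem_uIcc).2 rfl
      simp only [zero_mul, add_zero] at this
      exact this
    · have := (hG 0 left_mem_uIcc).2 rfl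
      simp only [zero_mul, add_zero] at this
      exact this
  · intro l ε w u hl h2 h3 hu hu0
    have hcw : ContinuousWithinAt u (uIcc 0 l) 0 := hu.cont 0 left_mem_uIcc
    have hu0' : u 0 ∈ Metric.ball (baseSlopes σ) r₀ :=
      Metric.mem_ball.2 (hu0.trans_le (min_le_left _ _))
    have hclose := hcw.eventually (Metric.isOpen_ball.mem_nhds hu0')
    rw [Filter.Eventually, Metric.mem_nhdsWithin_iff] at hclose
    obtain ⟨d, hd, hdsub⟩ := hclose
    refine ⟨min (d / 2) (r / 2), by positivity, fun t ht htl => ?_⟩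
    have htd : t < d := by have := htl.trans (min_le_left _ _); linarith
    have htr : |t| < r := by
      rw [abs_of_nonneg ht.1]; have := htl.trans (min_le_right _ _); linarith
    have htl' : t ∈ uIcc 0 l := by rw [uIcc_of_le hl]; exact ht
    have hut := hu.mono htl'
    have hd1 : dist (slopesCA t u hut.cont) u₀ < r₀ := by
      refine slopesCA_eq_constCA_dist hr₀ _ fun s hs => ?_
      refine hdsub ⟨?_, (uIcc_subset_uIcc left_mem_uIcc htl') hs⟩
      rw [uIcc_of_le ht.1] at hs
      rw [Metric.mem_ball, Real.dist_eq, sub_zero, abs_of_nonneg hs.1]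
      exact hs.2.trans_lt htd
    have := (hiff t ε w _ htr h2 h3 hd1).1 (sonicMap_slopesCA hut)
    simp only [this]
    simp [evalOne, slopesCA]

section Flow
variable {E : Type*} [NormedAddCommGroup E] [NormedSpace ℝ E] [FiniteDimensional ℝ E]

open scoped Manifold in
/-- A `C¹` vector field near a compact set agrees there with a bounded Lipschitz one. -/
theorem exists_lipschitz_eq_near {f : E → E} {U K : Set E} (hU : IsOpen U)
    (hf : ContDiffOn ℝ 1 f U) (hK : IsCompact K) (hKU : K ⊆ U) :
    ∃ (g : E → E) (C : NNReal) (B : NNReal) (V : Set E), LipschitzWith C g ∧ (∀ x, ‖g x‖ ≤ B) ∧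
      IsOpen V ∧ K ⊆ V ∧ V ⊆ U ∧ ∀ x ∈ V, g x = f x := by
  obtain ⟨K', hK', hKK', hK'U⟩ := exists_compact_between hK hU hKU
  have hdisj : Disjoint (interior K')ᶜ K :=
    disjoint_left.2 fun x hx hx' => hx (hKK' hx')
  obtain ⟨φ, hφ0, hφ1, -⟩ := exists_contMDiffMap_zero_one_nhds_of_isClosed (n := 1)
    (modelWithCornersSelf ℝ E) isOpen_interior.isClosed_compl hK.isClosed hdisj
  have hφ : ContDiff ℝ 1 φ := φ.contMDiff.contDiff
  have hg : ContDiff ℝ 1 fun x => φ x • f x := by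
    rw [contDiff_iff_contDiffAt]
    intro x
    by_cases hx : x ∈ U
    · exact hφ.contDiffAt.smul (hf.contDiffAt (hU.mem_nhds hx))
    · have hx' : x ∈ (interior K')ᶜ := fun h => hx (hK'U (interior_subset h))
      have h0 : ∀ᶠ y in 𝓝 x, φ y = 0 := (eventually_nhdsSet_iff_forall.1 hφ0) x hx'
      refine (contDiffAt_const (c := (0 : E))).congr_of_eventuallyEq ?_
      filter_upwards [h0] with y hy
      rw [hy, zero_smul]
  have hsupp : HasCompactSupport fun x => φ x • f x := by
    refine HasCompactSupport.intro hK' fun x hx => ?_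
    have : φ x = 0 := hφ0.self_of_nhdsSet x fun h => hx (interior_subset h)
    rw [this, zero_smul]
  obtain ⟨C, hC⟩ := hg.lipschitzWith_of_hasCompactSupport hsupp one_ne_zero
  obtain ⟨B, hB⟩ := hsupp.exists_bound_of_continuous hg.continuous
  obtain ⟨V, hV, hKV, hV1⟩ := eventually_nhdsSet_iff_exists.1 hφ1
  refine ⟨_, C, B.toNNReal, V ∩ U, hC, fun x => (hB x).trans (Real.le_coe_toNNReal B),
    hV.inter hU, subset_inter hKV hKU, inter_subset_right, fun x hx => ?_⟩
  rw [hV1 x hx.1, one_smul]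

theorem exists_bounded_flow {g : E → E} {C B : NNReal} (hg : LipschitzWith C g)
    (hB : ∀ x, ‖g x‖ ≤ B) (T : ℝ) (hT : 0 < T) (x₀ : E) :
    ∃ γ : ℝ → E, γ 0 = x₀ ∧ ∀ t ∈ Ioo (-T) T, HasDerivAt γ (g (γ t)) t := by
  have : CompleteSpace E := FiniteDimensional.complete ℝ E
  have h0 : (0 : ℝ) ∈ Icc (-T) T := ⟨by linarith, hT.le⟩
  have hp : IsPicardLindelof (fun _ : ℝ => g) (⟨0, h0⟩ : Icc (-T) T) x₀
      (B * ⟨T, hT.le⟩) 0 B C := by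
    refine ⟨fun t _ => hg.lipschitzOnWith, fun x _ => continuousOn_const, fun t _ x _ => hB x, ?_⟩
    simp only [sub_zero, sub_neg_eq_add, zero_add, max_self, NNReal.coe_zero]
    exact le_rfl
  obtain ⟨γ, h1, h2⟩ := hp.exists_eq_forall_mem_Icc_hasDerivWithinAt₀
  exact ⟨γ, h1, fun t ht => (h2 t (Ioo_subset_Icc_self ht)).hasDerivAt (Icc_mem_nhds ht.1 ht.2)⟩

/-- Solutions starting near the initial value of a given solution stay in a given open set. -/
theorem exists_nearby_solution {f : E → E} {U : Set E} (hU : IsOpen U)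
    (hf : ContDiffOn ℝ 1 f U) {T : ℝ} (hT : 0 ≤ T) {γ : ℝ → E}
    (hγ : ∀ t ∈ Icc 0 T, HasDerivAt γ (f (γ t)) t ∧ γ t ∈ U) :
    ∃ δ > 0, ∀ y, dist y (γ 0) < δ → ∃ β : ℝ → E, β 0 = y ∧
      (∀ t ∈ Icc 0 T, HasDerivAt β (f (β t)) t ∧ β t ∈ U) ∧
      ∀ᶠ t in 𝓝 0, HasDerivAt β (f (β t)) t := by
  have hcont : ContinuousOn γ (Icc 0 T) := fun t ht => (hγ t ht).1.continuousAt.continuousWithinAt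
  have hK := isCompact_Icc.image_of_continuousOn hcont
  obtain ⟨g, C, B, V, hg, hB, hV, hKV, hVU, hgf⟩ := exists_lipschitz_eq_near hU hf hK
    (by rintro _ ⟨t, ht, rfl⟩; exact (hγ t ht).2)
  obtain ⟨ρ, hρ, hρV⟩ := hK.exists_thickening_subset_open hV hKV
  refine ⟨ρ / Real.exp (C * T), by positivity, fun y hy => ?_⟩
  obtain ⟨β, hβ0, hβ⟩ := exists_bounded_flow hg hB (T + 1) (by linarith) y
  have hβ' : ∀ t ∈ Icc 0 T, HasDerivAt β (g (β t)) t := fun t ht =>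
    hβ t ⟨by linarith [ht.1], by linarith [ht.2]⟩
  have hdist := dist_le_of_trajectories_ODE (v := fun _ => g) (K := C) (f := β) (g := γ)
    (a := 0) (b := T) (δ := dist y (γ 0)) (fun _ => hg)
    (fun t ht => (hβ' t ht).continuousAt.continuousWithinAt)
    (fun t ht => (hβ' t (Ico_subset_Icc_self ht)).hasDerivWithinAt) hcont
    (fun t ht => by
      rw [hgf _ (hKV (mem_image_of_mem _ (Ico_subset_Icc_self ht)))]
      exact (hγ t (Ico_subset_Icc_self ht)).1.hasDerivWithinAt)
    (by rw [hβ0])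
  have hβV : ∀ t ∈ Icc 0 T, β t ∈ V := by
    intro t ht
    refine hρV (Metric.mem_thickening_iff.2 ⟨γ t, mem_image_of_mem _ ht, ?_⟩)
    refine (hdist t ht).trans_lt ?_
    rw [sub_zero]
    calc dist y (γ 0) * Real.exp (C * t) ≤ dist y (γ 0) * Real.exp (C * T) := by
          have : (C : ℝ) * t ≤ C * T := mul_le_mul_of_nonneg_left ht.2 C.2
          gcongr
      _ < ρ := (lt_div_iff₀ (Real.exp_pos _)).1 hy
  refine ⟨β, hβ0, fun t ht => ⟨hgf _ (hβV t ht) ▸ hβ' t ht, hVU (hβV t ht)⟩, ?_⟩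
  have h0 : (0 : ℝ) ∈ Icc 0 T := left_mem_Icc.2 hT
  filter_upwards [(hβ' 0 h0).continuousAt.eventually (hV.mem_nhds (hβV 0 h0)),
    Ioo_mem_nhds (by linarith : -(T + 1) < 0) (by linarith : 0 < T + 1)] with t h1 h2
  exact hgf _ h1 ▸ hβ t h2

/-- A priori bounds in a compact set give a solution beyond the time `T`. -/
theorem exists_solution_of_bounds {f : E → E} {U K : Set E} (hU : IsOpen U)
    (hf : ContDiffOn ℝ 1 f U) (hK : IsCompact K) (hKU : K ⊆ U) {T : ℝ} (hT : 0 ≤ T) {x₀ : E}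
    (hbound : ∀ t ∈ Icc 0 T, ∀ γ : ℝ → E, γ 0 = x₀ →
      (∀ s ∈ Icc 0 t, HasDerivAt γ (f (γ s)) s ∧ γ s ∈ U) → γ t ∈ K) (hx₀ : x₀ ∈ K) :
    ∃ τ > 0, ∃ γ : ℝ → E, γ 0 = x₀ ∧
      ∀ s ∈ Icc 0 (T + τ), HasDerivAt γ (f (γ s)) s ∧ γ s ∈ U := by
  obtain ⟨g, C, B, V, hg, hB, hV, hKV, hVU, hgf⟩ := exists_lipschitz_eq_near hU hf hK hKU
  obtain ⟨γ, hγ0, hγ⟩ := exists_bounded_flow hg hB (T + 1) (by linarith) x₀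
  have hγ' : ∀ t ∈ Icc 0 T, HasDerivAt γ (g (γ t)) t := fun t ht =>
    hγ t ⟨by linarith [ht.1], by linarith [ht.2]⟩
  have hcont : ContinuousOn γ (Icc 0 T) := fun t ht => (hγ' t ht).continuousAt.continuousWithinAt
  have hnear : ∀ t ∈ Icc 0 T, γ t ∈ K → ∃ τ > 0, ∀ s ∈ Icc t (t + τ), γ s ∈ V := by
    intro t ht htK
    have h1 := (hγ' t ht).continuousAt.eventually (hV.mem_nhds (hKV htK))
    obtain ⟨d, hd, hd'⟩ := Metric.eventually_nhds_iff.1 h1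
    refine ⟨d / 2, by positivity, fun s hs => hd' ?_⟩
    rw [Real.dist_eq, abs_of_nonneg (by linarith [hs.1])]
    linarith [hs.2]
  have hall : Icc 0 T ⊆ {t | γ t ∈ K ∧ ∀ s ∈ Icc 0 t, γ s ∈ K} := by
    have heq : ∀ {t}, 0 ≤ t → ((γ t ∈ K ∧ ∀ s ∈ Icc 0 t, γ s ∈ K) ↔ ∀ s ∈ Icc 0 t, γ s ∈ K) :=
      fun ht => ⟨fun h => h.2, fun h => ⟨h _ (right_mem_Icc.2 ht), h⟩⟩
    refine IsClosed.Icc_subset_of_forall_exists_gt ?_ ?_ ?_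
    · have hcl : IsClosed (Icc 0 T ∩ γ ⁻¹' K) := hcont.preimage_isClosed_of_isClosed isClosed_Icc
        hK.isClosed
      refine isClosed_of_closure_subset fun t ht => ?_
      have htI : t ∈ Icc 0 T := closure_minimal inter_subset_right isClosed_Icc ht
      have htK : ∀ s ∈ closure ({t | γ t ∈ K ∧ ∀ s ∈ Icc 0 t, γ s ∈ K} ∩ Icc 0 T), γ s ∈ K :=
        fun s hs => by
          have := closure_minimal (t := Icc 0 T ∩ γ ⁻¹' K)
            (fun x (hx : x ∈ {t | γ t ∈ K ∧ ∀ s ∈ Icc 0 t, γ s ∈ K} ∩ Icc 0 T) =>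
              ⟨hx.2, hx.1.1⟩) hcl hs
          exact this.2
      refine ⟨⟨htK t ht, fun s hs => ?_⟩, htI⟩
      rcases eq_or_lt_of_le hs.2 with h | h
      · exact h ▸ htK t ht
      · obtain ⟨z, hz, hzt⟩ := mem_closure_iff.1 ht (Ioi s) isOpen_Ioi h
        exact hzt.1.2 s ⟨hs.1, le_of_lt hz⟩
    · refine (heq le_rfl).2 fun s hs => ?_
      obtain rfl : s = 0 := le_antisymm hs.2 hs.1
      rw [hγ0]; exact hx₀
    · rintro t ⟨⟨htK, ht⟩, ht0, htT⟩ z hz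
      obtain ⟨τ, hτ, hτV⟩ := hnear t ⟨ht0, htT.le⟩ htK
      have hz' : t < z := hz
      refine ⟨min z (min (t + τ) T), ?_, lt_min hz' (lt_min (by linarith) htT), min_le_left _ _⟩
      have hle : min z (min (t + τ) T) ≤ t + τ := (min_le_right _ _).trans (min_le_left _ _)
      have hle' : min z (min (t + τ) T) ≤ T := (min_le_right _ _).trans (min_le_right _ _)
      have hge : 0 ≤ min z (min (t + τ) T) := by
        refine le_min (by linarith) (le_min (by linarith) hT)
      refine (heq hge).2 fun s hs => ?_
      refine hbound s ⟨hs.1, hs.2.trans hle'⟩ γ hγ0 fun a ha => ?_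
      have haV : γ a ∈ V := by
        rcases le_total a t with h | h
        · exact hKV (ht a ⟨ha.1, h⟩)
        · exact hτV a ⟨h, ha.2.trans (hs.2.trans hle)⟩
      exact ⟨hgf _ haV ▸ hγ' a ⟨ha.1, ha.2.trans (hs.2.trans hle')⟩, hVU haV⟩
  have hTK := hall (right_mem_Icc.2 hT)
  obtain ⟨τ, hτ, hτV⟩ := hnear T (right_mem_Icc.2 hT) hTK.1
  refine ⟨min τ (1 / 2), by positivity, γ, hγ0, fun s hs => ?_⟩
  have h1 := min_le_left τ (1 / 2)
  have h2 := min_le_right τ (1 / 2)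
  have hsV : γ s ∈ V := by
    rcases le_total s T with h | h
    · exact hKV (hTK.2 s ⟨hs.1, h⟩)
    · exact hτV s ⟨h, by linarith [hs.2]⟩
  exact ⟨hgf _ hsV ▸ hγ s ⟨by linarith [hs.1], by linarith [hs.2]⟩, hVU hsV⟩

end Flow

/-- Local uniqueness for an autonomous equation. -/
theorem eventuallyEq_of_hasDerivAt {E : Type*} [NormedAddCommGroup E] [NormedSpace ℝ E]
    {f : E → E} {γ γ' : ℝ → E} {t₀ : ℝ}
    (hf : ContDiffAt ℝ 1 f (γ t₀)) (h : ∀ᶠ t in 𝓝 t₀, HasDerivAt γ (f (γ t)) t)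
    (h' : ∀ᶠ t in 𝓝 t₀, HasDerivAt γ' (f (γ' t)) t) (h0 : γ t₀ = γ' t₀) : γ =ᶠ[𝓝 t₀] γ' := by
  obtain ⟨C, s, hs, hC⟩ := hf.exists_lipschitzOnWith
  have h1 := h.self_of_nhds.continuousAt.eventually_mem hs
  have h2 := h'.self_of_nhds.continuousAt.eventually_mem (h0 ▸ hs)
  exact ODE_solution_unique_of_eventually (v := fun _ => f) (s := fun _ => s) (K := C)
    (Eventually.of_forall fun _ => hC) (h.and h1) (h'.and h2) h0

section Newtonian

/-- The quotient `(ΔW - 1) / (W² - X²)` with `W = 1 + ΩX`. -/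
def newtonQ (Δ Ω : ℝ → ℝ) (X : ℝ) : ℝ :=
  (Δ X * (1 + Ω X * X) - 1) / ((1 + Ω X * X) ^ 2 - X ^ 2)

/-- `-dW/dX` along solutions of the Newtonian system. -/
def newtonH (Δ Ω : ℝ → ℝ) (X : ℝ) : ℝ :=
  -Ω X - 2 * X * (1 + Ω X * X) * newtonQ Δ Ω X

/-- Solutions of the Newtonian system on `[a, b]`, in the variable `X = 1/x` with `D = ΔX²`,
`W = 1 + ΩX`. -/
structure IsNewton (a b : ℝ) (Δ Ω : ℝ → ℝ) : Prop where
  eqΔ : ∀ X ∈ Icc a b, HasDerivAt Δ (-2 * X * Δ X * newtonQ Δ Ω X) X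
  eqΩ : ∀ X ∈ Icc a b, HasDerivAt Ω (2 * (1 + Ω X * X) * newtonQ Δ Ω X) X
  posΔ : ∀ X ∈ Icc a b, 0 < Δ X
  posW : ∀ X ∈ Icc a b, 0 < 1 + Ω X * X
  den : ∀ X ∈ Icc a b, X ^ 2 < (1 + Ω X * X) ^ 2

theorem pos_of_deriv_le_mul {f f' : ℝ → ℝ} {m b C : ℝ} (hmb : m ≤ b)
    (hf : ∀ x ∈ Icc m b, HasDerivAt f (f' x) x) (hle : ∀ x ∈ Ioo m b, f' x ≤ C * f x)
    (hb : 0 < f b) : 0 < f m := by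
  have h1 : ∀ x ∈ Icc m b, HasDerivAt (fun x => f x * Real.exp (-C * x))
      (f' x * Real.exp (-C * x) + f x * (Real.exp (-C * x) * (-C))) x := fun x hx =>
    (hf x hx).mul (((hasDerivAt_id x).const_mul (-C)).exp.congr_deriv (by simp))
  have h2 : AntitoneOn (fun x => f x * Real.exp (-C * x)) (Icc m b) := by
    refine antitoneOn_of_hasDerivWithinAt_nonpos (convex_Icc m b)
      (fun x hx => (h1 x hx).continuousAt.continuousWithinAt)
      (fun x hx => (h1 x (interior_subset hx)).hasDerivWithinAt) fun x hx => ?_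
    rw [interior_Icc] at hx
    have := mul_le_mul_of_nonneg_right (hle x hx) (Real.exp_pos (-C * x)).le
    linarith
  have h3 := h2 (left_mem_Icc.2 hmb) (right_mem_Icc.2 hmb) hmb
  exact pos_of_mul_pos_left (lt_of_lt_of_le (by positivity) h3) (Real.exp_pos _).le

theorem newtonH_deriv_identity {X W Δ Ω q h L : ℝ} (hL0 : L ≠ 0) (hR : Δ * W = 1 + q * L)
    (hL : L = W ^ 2 - X ^ 2) (hΩ : Ω = -h - 2 * X * W * q) (hW : W = 1 + Ω * X) :
    -4 * W * q + 2 * X * h * q - 2 * X * W * ((Δ * Ω + 2 * q * (W * h + X)) / L)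
      = (2 * X * (1 - 2 * X ^ 2 * q) / L - 2 * X * q) * h - 2 * q * (3 * W - 1) := by
  have hW' : W - 1 + X * h + 2 * X ^ 2 * W * q = 0 := by rw [hΩ] at hW; linarith
  rw [← sub_eq_zero]
  have : -4 * W * q + 2 * X * h * q - 2 * X * W * ((Δ * Ω + 2 * q * (W * h + X)) / L)
      - ((2 * X * (1 - 2 * X ^ 2 * q) / L - 2 * X * q) * h - 2 * q * (3 * W - 1))
      = ((-4 * W * q + 2 * X * h * q) * L - 2 * X * (Δ * W * Ω + 2 * q * W * (W * h + X))
        - ((2 * X * (1 - 2 * X ^ 2 * q) - 2 * X * q * L) * h - 2 * q * (3 * W - 1) * L)) / L := by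
    field_simp
  rw [this, div_eq_zero_iff]
  left
  rw [hR, hΩ]
  linear_combination (2 * q * L) * hW' + 4 * X * q * h * hL

variable {a b : ℝ} {Δ Ω : ℝ → ℝ}

theorem IsNewton.mono (hN : IsNewton a b Δ Ω) {a' : ℝ} (h : a ≤ a') : IsNewton a' b Δ Ω :=
  ⟨fun X hX => hN.eqΔ X ⟨h.trans hX.1, hX.2⟩, fun X hX => hN.eqΩ X ⟨h.trans hX.1, hX.2⟩,
    fun X hX => hN.posΔ X ⟨h.trans hX.1, hX.2⟩, fun X hX => hN.posW X ⟨h.trans hX.1, hX.2⟩,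
    fun X hX => hN.den X ⟨h.trans hX.1, hX.2⟩⟩

theorem IsNewton.den_pos (hN : IsNewton a b Δ Ω) {X : ℝ} (hX : X ∈ Icc a b) :
    0 < (1 + Ω X * X) ^ 2 - X ^ 2 := sub_pos.2 (hN.den X hX)

theorem IsNewton.hasDerivAt_W (hN : IsNewton a b Δ Ω) {X : ℝ} (hX : X ∈ Icc a b) :
    HasDerivAt (fun X => 1 + Ω X * X) (-newtonH Δ Ω X) X := by
  refine (((hN.eqΩ X hX).mul (hasDerivAt_id X)).const_add 1).congr_deriv ?_
  simp only [newtonH, id]; ring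

theorem IsNewton.hasDerivAt_R (hN : IsNewton a b Δ Ω) {X : ℝ} (hX : X ∈ Icc a b) :
    HasDerivAt (fun X => Δ X * (1 + Ω X * X)) (Δ X * Ω X) X := by
  refine ((hN.eqΔ X hX).mul (hN.hasDerivAt_W hX)).congr_deriv ?_
  simp only [newtonH]; ring

theorem IsNewton.hasDerivAt_Q (hN : IsNewton a b Δ Ω) {X : ℝ} (hX : X ∈ Icc a b) :
    HasDerivAt (newtonQ Δ Ω) ((Δ X * Ω X + 2 * newtonQ Δ Ω X *
      ((1 + Ω X * X) * newtonH Δ Ω X + X)) / ((1 + Ω X * X) ^ 2 - X ^ 2)) X := by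
  have hL := (hN.den_pos hX).ne'
  refine (((hN.hasDerivAt_R hX).sub_const 1).div
    (((hN.hasDerivAt_W hX).pow 2).sub ((hasDerivAt_id X).pow 2)) hL).congr_deriv ?_
  have hq : Δ X * (1 + Ω X * X) - 1 = newtonQ Δ Ω X * ((1 + Ω X * X) ^ 2 - X ^ 2) := by
    rw [newtonQ, div_mul_cancel₀ _ hL]
  simp only [Pi.sub_apply, Pi.pow_apply, id] at hL ⊢
  rw [hq]
  field_simp
  ring

theorem IsNewton.hasDerivAt_H (hN : IsNewton a b Δ Ω) {X : ℝ} (hX : X ∈ Icc a b) :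
    HasDerivAt (newtonH Δ Ω) ((2 * X * (1 - 2 * X ^ 2 * newtonQ Δ Ω X) /
      ((1 + Ω X * X) ^ 2 - X ^ 2) - 2 * X * newtonQ Δ Ω X) * newtonH Δ Ω X
      - 2 * newtonQ Δ Ω X * (3 * (1 + Ω X * X) - 1)) X := by
  have hL := (hN.den_pos hX).ne'
  rw [← newtonH_deriv_identity (Δ := Δ X) (Ω := Ω X) hL
    (by rw [newtonQ, div_mul_cancel₀ _ hL]; ring) rfl (by rw [newtonH]; ring) rfl]
  refine ((hN.eqΩ X hX).neg.sub ((((hasDerivAt_id X).const_mul 2).mul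
    (hN.hasDerivAt_W hX)).mul (hN.hasDerivAt_Q hX))).congr_deriv ?_
  simp only [Pi.mul_apply, id]
  ring

theorem IsNewton.continuousOn_Q (hN : IsNewton a b Δ Ω) : ContinuousOn (newtonQ Δ Ω) (Icc a b) :=
  fun _ hX => (hN.hasDerivAt_Q hX).continuousAt.continuousWithinAt

theorem IsNewton.continuousOn_W (hN : IsNewton a b Δ Ω) :
    ContinuousOn (fun X => 1 + Ω X * X) (Icc a b) :=
  fun _ hX => (hN.hasDerivAt_W hX).continuousAt.continuousWithinAt

theorem IsNewton.continuousOn_R (hN : IsNewton a b Δ Ω) :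
    ContinuousOn (fun X => Δ X * (1 + Ω X * X)) (Icc a b) :=
  fun _ hX => (hN.hasDerivAt_R hX).continuousAt.continuousWithinAt

theorem IsNewton.continuousOn_H (hN : IsNewton a b Δ Ω) : ContinuousOn (newtonH Δ Ω) (Icc a b) :=
  fun _ hX => (hN.hasDerivAt_H hX).continuousAt.continuousWithinAt

theorem IsNewton.Q_pos (hN : IsNewton a b Δ Ω) {X : ℝ} (hX : X ∈ Icc a b)
    (h : 1 < Δ X * (1 + Ω X * X)) : 0 < newtonQ Δ Ω X :=
  div_pos (sub_pos.2 h) (hN.den_pos hX)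

theorem IsNewton.Ω_neg (hN : IsNewton a b Δ Ω) {X : ℝ} (hX : X ∈ Icc a b) (hX0 : 0 ≤ X)
    (h : 1 < Δ X * (1 + Ω X * X)) (hh : 0 < newtonH Δ Ω X) : Ω X < 0 := by
  have h1 : Ω X = -newtonH Δ Ω X - 2 * X * (1 + Ω X * X) * newtonQ Δ Ω X := by
    rw [newtonH]; ring
  have h2 : 0 ≤ 2 * X * (1 + Ω X * X) * newtonQ Δ Ω X := by
    have := hN.posW X hX
    have := hN.Q_pos hX h
    positivity
  linarith

/-- The conditions `R > 1` and `W' < 0` propagate inwards in `X`. -/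
theorem IsNewton.invariant (hN : IsNewton a b Δ Ω) (ha : 0 ≤ a)
    (hW : 1 / 3 < 1 + Ω b * b) (hR : 1 < Δ b * (1 + Ω b * b)) (hH : 0 < newtonH Δ Ω b)
    {X : ℝ} (hX : X ∈ Icc a b) :
    1 < Δ X * (1 + Ω X * X) ∧ 0 < newtonH Δ Ω X := by
  by_contra hcon
  set S := {X ∈ Icc a b | min (Δ X * (1 + Ω X * X) - 1) (newtonH Δ Ω X) ∈ Iic (0 : ℝ)} with hS
  have hScl : IsClosed S := ((hN.continuousOn_R.sub continuousOn_const).inf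
    hN.continuousOn_H).preimage_isClosed_of_isClosed isClosed_Icc isClosed_Iic
  have hSc : IsCompact S := isCompact_Icc.of_isClosed_subset hScl fun x hx => hx.1
  have hmem : X ∈ S := ⟨hX, by
    rw [mem_Iic, min_le_iff]
    by_contra! h
    exact hcon ⟨by linarith [h.1], h.2⟩⟩
  obtain ⟨m, ⟨hm, hm0⟩, hmax⟩ := hSc.exists_isGreatest ⟨X, hmem⟩
  have hgood : ∀ x ∈ Ioc m b, 1 < Δ x * (1 + Ω x * x) ∧ 0 < newtonH Δ Ω x := by
    intro x hx
    by_contra h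
    have : x ∈ S := ⟨⟨hm.1.trans hx.1.le, hx.2⟩, by
      rw [mem_Iic, min_le_iff]
      by_contra! h'
      exact h ⟨by linarith [h'.1], h'.2⟩⟩
    exact absurd (hmax this) (not_le.2 hx.1)
  have hN' := hN.mono hm.1
  have hsub : ∀ x ∈ Ioo m b, x ∈ Icc m b := fun x hx => Ioo_subset_Icc_self hx
  have hRm : 1 < Δ m * (1 + Ω m * m) := by
    have : AntitoneOn (fun X => Δ X * (1 + Ω X * X)) (Icc m b) := by
      refine antitoneOn_of_hasDerivWithinAt_nonpos (convex_Icc m b) hN'.continuousOn_R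
        (fun x hx => (hN'.hasDerivAt_R (interior_subset hx)).hasDerivWithinAt) fun x hx => ?_
      rw [interior_Icc] at hx
      obtain ⟨h1, h2⟩ := hgood x ⟨hx.1, hx.2.le⟩
      exact mul_nonpos_of_nonneg_of_nonpos (hN'.posΔ x (hsub x hx)).le
        (hN'.Ω_neg (hsub x hx) (ha.trans (hm.1.trans hx.1.le)) h1 h2).le
    exact hR.trans_le (this (left_mem_Icc.2 hm.2) (right_mem_Icc.2 hm.2) hm.2)
  have hWx : ∀ x ∈ Icc m b, 1 / 3 < 1 + Ω x * x := by
    have : AntitoneOn (fun X => 1 + Ω X * X) (Icc m b) := by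
      refine antitoneOn_of_hasDerivWithinAt_nonpos (convex_Icc m b) hN'.continuousOn_W
        (fun x hx => (hN'.hasDerivAt_W (interior_subset hx)).hasDerivWithinAt) fun x hx => ?_
      rw [interior_Icc] at hx
      linarith [(hgood x ⟨hx.1, hx.2.le⟩).2]
    exact fun x hx => hW.trans_le (this hx (right_mem_Icc.2 hm.2) hx.2)
  have hcont : ContinuousOn (fun X => 2 * X * (1 - 2 * X ^ 2 * newtonQ Δ Ω X) /
      ((1 + Ω X * X) ^ 2 - X ^ 2) - 2 * X * newtonQ Δ Ω X) (Icc m b) := by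
    have hQ := hN'.continuousOn_Q
    have hW := hN'.continuousOn_W
    refine ContinuousOn.sub (ContinuousOn.div (by fun_prop) (by fun_prop)
      fun x hx => (hN'.den_pos hx).ne') (by fun_prop)
  obtain ⟨C, hC⟩ := isCompact_Icc.exists_bound_of_continuousOn hcont
  have hHm : 0 < newtonH Δ Ω m := by
    refine pos_of_deriv_le_mul (C := C) hm.2 (fun x hx => hN'.hasDerivAt_H hx) (fun x hx => ?_) hH
    obtain ⟨h1, h2⟩ := hgood x ⟨hx.1, hx.2.le⟩
    have h3 := (le_abs_self _).trans (hC x (hsub x hx))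
    have h4 := hN'.Q_pos (hsub x hx) h1
    have h5 := hWx x (hsub x hx)
    have h6 : 0 ≤ 2 * newtonQ Δ Ω x * (3 * (1 + Ω x * x) - 1) := by
      have : 0 < 3 * (1 + Ω x * x) - 1 := by linarith
      positivity
    have h7 := mul_le_mul_of_nonneg_right h3 h2.le
    linarith
  rcases min_le_iff.1 (mem_Iic.1 hm0) with h | h <;> linarith


theorem IsNewton.monotone_bounds (hN : IsNewton a b Δ Ω) (ha : 0 ≤ a)
    (hW : 1 / 3 < 1 + Ω b * b) (hR : 1 < Δ b * (1 + Ω b * b)) (hH : 0 < newtonH Δ Ω b)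
    {X : ℝ} (hX : X ∈ Icc a b) :
    Δ b ≤ Δ X ∧ Ω X ≤ Ω b ∧ 1 + Ω b * b ≤ 1 + Ω X * X ∧ 1 + Ω X * X ≤ 1 := by
  have hinv := fun x (hx : x ∈ Icc a b) => hN.invariant ha hW hR hH hx
  have hab : a ≤ b := hX.1.trans hX.2
  have hb : b ∈ Icc a b := right_mem_Icc.2 hab
  have h1 : AntitoneOn Δ (Icc a b) := by
    refine antitoneOn_of_hasDerivWithinAt_nonpos (convex_Icc a b)
      (fun x hx => (hN.eqΔ x hx).continuousAt.continuousWithinAt)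
      (fun x hx => (hN.eqΔ x (interior_subset hx)).hasDerivWithinAt) fun x hx => ?_
    have hx' := interior_subset hx
    have := mul_nonneg (mul_nonneg (ha.trans hx'.1) (hN.posΔ x hx').le)
      (hN.Q_pos hx' (hinv x hx').1).le
    linarith
  have h2 : MonotoneOn Ω (Icc a b) := by
    refine monotoneOn_of_hasDerivWithinAt_nonneg (convex_Icc a b)
      (fun x hx => (hN.eqΩ x hx).continuousAt.continuousWithinAt)
      (fun x hx => (hN.eqΩ x (interior_subset hx)).hasDerivWithinAt) fun x hx => ?_
    have hx' := interior_subset hx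
    have := mul_nonneg (hN.posW x hx').le (hN.Q_pos hx' (hinv x hx').1).le
    linarith
  have h3 : AntitoneOn (fun X => 1 + Ω X * X) (Icc a b) := by
    refine antitoneOn_of_hasDerivWithinAt_nonpos (convex_Icc a b) hN.continuousOn_W
      (fun x hx => (hN.hasDerivAt_W (interior_subset hx)).hasDerivWithinAt) fun x hx => ?_
    linarith [(hinv x (interior_subset hx)).2]
  refine ⟨h1 hX hb hX.2, h2 hX hb hX.2, h3 hX hb hX.2, ?_⟩
  have := hN.Ω_neg hX (ha.trans hX.1) (hinv X hX).1 (hinv X hX).2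
  have := mul_nonneg (neg_nonneg.2 this.le) (ha.trans hX.1)
  linarith

/-- Solutions of the Newtonian system are bounded towards `X = 0`, in terms of the data. -/
theorem exists_newton_bound {b Δ₁ Ω₁ : ℝ} (hW : 1 / 3 < 1 + Ω₁ * b)
    (hbW : b < 1 + Ω₁ * b) (hR : 1 < Δ₁ * (1 + Ω₁ * b)) :
    ∃ M, ∀ a ∈ Ioc 0 b, ∀ Δ Ω : ℝ → ℝ, IsNewton a b Δ Ω → Δ b = Δ₁ → Ω b = Ω₁ →
      0 < newtonH Δ Ω b → Δ a ≤ M ∧ -M ≤ Ω a := by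
  set W₁ := 1 + Ω₁ * b with hW₁
  set R₁ := Δ₁ * W₁ with hR₁
  have hW₁0 : 0 < W₁ := by linarith
  obtain ⟨p, hp1, hp2, hpW⟩ : ∃ p, 3 / 2 ≤ p ∧ p < 2 ∧ 1 ≤ (1 + p) * W₁ := by
    refine ⟨max (3 / 2) (1 / W₁ - 1), le_max_left _ _, max_lt (by norm_num) ?_, ?_⟩
    · have : 1 / W₁ < 3 := by rw [div_lt_iff₀ hW₁0]; linarith
      linarith
    · have h1 : 1 / W₁ ≤ 1 + max (3 / 2) (1 / W₁ - 1) := by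
        have := le_max_right (3 / 2) (1 / W₁ - 1); linarith
      calc 1 = 1 / W₁ * W₁ := by field_simp
        _ ≤ _ := by gcongr
  set c := W₁ ^ 2 - b ^ 2 with hc
  set C := 2 * (R₁ * b ^ p) / c with hC
  set B := C / (p - 1) with hB
  set B' := 3 * B / (2 - p) with hB'
  set MR := Real.exp (Real.log R₁ + -(3 * Ω₁) * b + B' * b ^ (2 - p)) with hMR
  refine ⟨max (3 * MR) (-Ω₁ + 2 * MR / c * b), fun a ha Δ Ω hN hΔb hΩb hH => ?_⟩
  have ha0 := ha.1
  have hb0 : 0 < b := ha.1.trans_le ha.2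
  have hcpos : 0 < c := by
    rw [hc, sub_pos]; gcongr
  have hp10 : 0 < p - 1 := by linarith
  have hp20 : 0 < 2 - p := by linarith
  have hbp : 0 < b ^ p := Real.rpow_pos_of_pos hb0 p
  have hC0 : 0 ≤ C := by positivity
  have hB0 : 0 ≤ B := by positivity
  have hB'0 : 0 ≤ B' := by positivity
  have hW' : 1 / 3 < 1 + Ω b * b := by rw [hΩb]; exact hW
  have hR' : 1 < Δ b * (1 + Ω b * b) := by rw [hΔb, hΩb]; exact hR
  have hinv := fun x (hx : x ∈ Icc a b) => hN.invariant ha0.le hW' hR' hH hx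
  have hmon : ∀ x ∈ Icc a b, Δ₁ ≤ Δ x ∧ Ω x ≤ Ω₁ ∧ W₁ ≤ 1 + Ω x * x ∧ 1 + Ω x * x ≤ 1 := by
    intro x hx
    have := hN.monotone_bounds ha0.le hW' hR' hH hx
    rwa [hΔb, hΩb] at this
  have hneg : ∀ x ∈ Icc a b, Ω x < 0 := fun x hx =>
    hN.Ω_neg hx (ha0.le.trans hx.1) (hinv x hx).1 (hinv x hx).2
  have hb : b ∈ Icc a b := right_mem_Icc.2 ha.2
  have hRb : Δ b * (1 + Ω b * b) = R₁ := by rw [hΔb, hΩb]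
  have hden : ∀ x ∈ Icc a b, c ≤ (1 + Ω x * x) ^ 2 - x ^ 2 := by
    intro x hx
    have h1 : W₁ ^ 2 ≤ (1 + Ω x * x) ^ 2 := by
      have := (hmon x hx).2.2.1; gcongr
    have h2 : x ^ 2 ≤ b ^ 2 := by
      have := ha0.le.trans hx.1
      have := hx.2
      gcongr
    linarith
  have hslope : ∀ x ∈ Icc a b, 2 * (1 + Ω x * x) * newtonQ Δ Ω x
      ≤ 2 * (Δ x * (1 + Ω x * x)) / c := by
    intro x hx
    have h1 := (hinv x hx).1
    have h2 : newtonQ Δ Ω x ≤ (Δ x * (1 + Ω x * x)) / c := by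
      rw [newtonQ]
      exact div_le_div₀ (by linarith) (by linarith) hcpos (hden x hx)
    have h3 := hN.posW x hx
    have h4 := (hmon x hx).2.2.2
    have h5 := hN.Q_pos hx h1
    calc 2 * (1 + Ω x * x) * newtonQ Δ Ω x ≤ 2 * 1 * newtonQ Δ Ω x := by gcongr
      _ ≤ 2 * ((Δ x * (1 + Ω x * x)) / c) := by linarith
      _ = _ := by ring
  have hpos : ∀ x ∈ Icc a b, 0 < x := fun x hx => ha0.trans_le hx.1
  have hpow : ∀ x ∈ Icc a b, ∀ q : ℝ, HasDerivAt (fun x : ℝ => x ^ q) (q * x ^ (q - 1)) x :=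
    fun x hx q => Real.hasDerivAt_rpow_const (Or.inl (hpos x hx).ne')
  have hR1 : ∀ x ∈ Icc a b, Δ x * (1 + Ω x * x) ≤ R₁ * b ^ p * x ^ (-p) := by
    have hd : ∀ x ∈ Icc a b, HasDerivAt (fun x => Δ x * (1 + Ω x * x) * x ^ p)
        (Δ x * Ω x * x ^ p + Δ x * (1 + Ω x * x) * (p * x ^ (p - 1))) x :=
      fun x hx => (hN.hasDerivAt_R hx).mul (hpow x hx p)
    have hm : MonotoneOn (fun x => Δ x * (1 + Ω x * x) * x ^ p) (Icc a b) := by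
      refine monotoneOn_of_hasDerivWithinAt_nonneg (convex_Icc a b)
        (fun x hx => (hd x hx).continuousAt.continuousWithinAt)
        (fun x hx => (hd x (interior_subset hx)).hasDerivWithinAt) fun x hx => ?_
      have hx' := interior_subset hx
      have h0 := hpos x hx'
      have h1 : x ^ p = x ^ (p - 1) * x := by
        rw [← Real.rpow_add_one h0.ne']; congr 1; ring
      have h2 : 1 ≤ (1 + p) * (1 + Ω x * x) :=
        hpW.trans (mul_le_mul_of_nonneg_left (hmon x hx').2.2.1 (by linarith))
      have h3 : 0 ≤ Δ x * x ^ (p - 1) * ((1 + p) * (1 + Ω x * x) - 1) :=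
        mul_nonneg (mul_nonneg (hN.posΔ x hx').le (Real.rpow_nonneg h0.le _)) (by linarith)
      rw [h1]
      linarith
    intro x hx
    have h := hm hx hb hx.2
    simp only [hRb] at h
    have h0 := Real.rpow_pos_of_pos (hpos x hx) p
    rw [Real.rpow_neg (hpos x hx).le, ← div_eq_mul_inv, le_div_iff₀ h0]
    exact h
  have hΩ1 : ∀ x ∈ Icc a b, Ω₁ - B * x ^ (1 - p) ≤ Ω x := by
    have hd : ∀ x ∈ Icc a b, HasDerivAt (fun x => Ω x + B * x ^ (1 - p))
        (2 * (1 + Ω x * x) * newtonQ Δ Ω x + B * ((1 - p) * x ^ (1 - p - 1))) x :=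
      fun x hx => (hN.eqΩ x hx).add ((hpow x hx (1 - p)).const_mul B)
    have hm : AntitoneOn (fun x => Ω x + B * x ^ (1 - p)) (Icc a b) := by
      refine antitoneOn_of_hasDerivWithinAt_nonpos (convex_Icc a b)
        (fun x hx => (hd x hx).continuousAt.continuousWithinAt)
        (fun x hx => (hd x (interior_subset hx)).hasDerivWithinAt) fun x hx => ?_
      have hx' := interior_subset hx
      have h1 := hslope x hx'
      have h2 : 2 * (Δ x * (1 + Ω x * x)) / c ≤ C * x ^ (-p) := by
        rw [hC, div_mul_eq_mul_div]
        have := hR1 x hx'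
        gcongr ?_ / c
        linarith
      have h3 : (1 - p - 1) = -p := by ring
      have h4 : B * ((1 - p) * x ^ (-p)) = -(C * x ^ (-p)) := by
        rw [hB]; field_simp; ring
      rw [h3, h4]
      linarith
    intro x hx
    have h := hm hx hb hx.2
    simp only [hΩb] at h
    have : 0 ≤ B * b ^ (1 - p) := mul_nonneg hB0 (Real.rpow_nonneg hb0.le _)
    linarith
  have hΩ₁0 : Ω₁ ≤ 0 := hΩb ▸ (hneg b hb).le
  have hR2 : ∀ x ∈ Icc a b, Δ x * (1 + Ω x * x) ≤ MR := by
    have hR0 : ∀ x ∈ Icc a b, 0 < Δ x * (1 + Ω x * x) := fun x hx => by linarith [(hinv x hx).1]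
    have hd : ∀ x ∈ Icc a b, HasDerivAt
        (fun x => Real.log (Δ x * (1 + Ω x * x)) + -(3 * Ω₁) * x + B' * x ^ (2 - p))
        (Δ x * Ω x / (Δ x * (1 + Ω x * x)) + -(3 * Ω₁) * 1
          + B' * ((2 - p) * x ^ (2 - p - 1))) x :=
      fun x hx => (((hN.hasDerivAt_R hx).log (hR0 x hx).ne').add
        ((hasDerivAt_id x).const_mul _)).add ((hpow x hx (2 - p)).const_mul B')
    have hm : MonotoneOn
        (fun x => Real.log (Δ x * (1 + Ω x * x)) + -(3 * Ω₁) * x + B' * x ^ (2 - p))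
        (Icc a b) := by
      refine monotoneOn_of_hasDerivWithinAt_nonneg (convex_Icc a b)
        (fun x hx => (hd x hx).continuousAt.continuousWithinAt)
        (fun x hx => (hd x (interior_subset hx)).hasDerivWithinAt) fun x hx => ?_
      have hx' := interior_subset hx
      have h3 : 2 - p - 1 = 1 - p := by ring
      have h4 : B' * ((2 - p) * x ^ (1 - p)) = 3 * (B * x ^ (1 - p)) := by
        rw [hB']; field_simp
      have h5 : Δ x * Ω x / (Δ x * (1 + Ω x * x)) = Ω x / (1 + Ω x * x) :=
        mul_div_mul_left _ _ (hN.posΔ x hx').ne'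
      have h6 : 3 * Ω x ≤ Ω x / (1 + Ω x * x) := by
        rw [le_div_iff₀ (hN.posW x hx')]
        have := (hmon x hx').2.2.1
        nlinarith [hneg x hx']
      rw [h3, h4, h5]
      linarith [hΩ1 x hx']
    intro x hx
    have h := hm hx hb hx.2
    simp only [hRb] at h
    rw [← Real.exp_log (hR0 x hx), hMR]
    refine Real.exp_le_exp.2 ?_
    have h1 : 0 ≤ B' * x ^ (2 - p) := mul_nonneg hB'0 (Real.rpow_nonneg (hpos x hx).le _)
    have h2 : 0 ≤ -(3 * Ω₁) * x := mul_nonneg (by linarith) (hpos x hx).le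
    linarith
  have hal : a ∈ Icc a b := left_mem_Icc.2 ha.2
  constructor
  · refine le_trans ?_ (le_max_left _ _)
    have h1 := hR2 a hal
    have h2 := (hmon a hal).2.2.1
    have h3 := hN.posΔ a hal
    nlinarith
  · rw [neg_le]
    refine le_trans ?_ (le_max_right _ _)
    have hd : ∀ x ∈ Icc a b, HasDerivAt (fun x => Ω x - 2 * MR / c * x)
        (2 * (1 + Ω x * x) * newtonQ Δ Ω x - 2 * MR / c * 1) x :=
      fun x hx => (hN.eqΩ x hx).sub ((hasDerivAt_id x).const_mul _)
    have hm : AntitoneOn (fun x => Ω x - 2 * MR / c * x) (Icc a b) := by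
      refine antitoneOn_of_hasDerivWithinAt_nonpos (convex_Icc a b)
        (fun x hx => (hd x hx).continuousAt.continuousWithinAt)
        (fun x hx => (hd x (interior_subset hx)).hasDerivWithinAt) fun x hx => ?_
      have hx' := interior_subset hx
      have h1 := hslope x hx'
      have h2 : 2 * (Δ x * (1 + Ω x * x)) / c ≤ 2 * MR / c := by
        have := hR2 x hx'
        gcongr
      linarith
    have h := hm hal hb ha.2
    simp only [hΩb] at h
    have : 0 ≤ 2 * MR / c * a := by
      have : 0 < MR := Real.exp_pos _
      positivity
    linarith

end Newtonian

section XSystem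

/-- The sonic denominator divided by `x²`, in the variables `X = x^(-1/(1+η))`, `D = ΔX²`,
`W = 1 + ΩX`. -/
def denX (ε X Δ Ω : ℝ) : ℝ := Δ ^ (-eta ε) * X ^ 2 - brJ ε (Δ * X ^ 2) (1 + Ω * X)

/-- Numerator of `dΔ/dX`. -/
def numΔ (ε X Δ Ω : ℝ) : ℝ :=
  -ε * (1 + ε) * Ω - 2 * ε * Ω ^ 2 * X
    + X * (Δ * ((1 + ε) * (1 + Ω * X + ε) + 4 * ε * (1 + Ω * X)) - Δ ^ (-eta ε))

/-- Numerator of `dΩ/dX`. -/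
def numΩ (ε X Δ Ω : ℝ) : ℝ :=
  2 * ε * (1 + ε) ^ 2 * Ω ^ 2 + 4 * ε * (1 + ε) * Ω ^ 3 * X
    + 2 * ε * Ω * X * (Δ ^ (-eta ε) - (1 - ε) * Ω ^ 2 - 4 * ε * Δ * (1 + Ω * X))
    - 2 * (1 + ε) * (1 + Ω * X)
      * (Δ * ((1 + ε) * (1 + Ω * X + ε) + 4 * ε * (1 + Ω * X)) - Δ ^ (-eta ε))

/-- `dΔ/dX`. -/
def rateΔ (ε X Δ Ω : ℝ) : ℝ := 2 * Δ * numΔ ε X Δ Ω / denX ε X Δ Ω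

/-- `dΩ/dX`. -/
def rateΩ (ε X Δ Ω : ℝ) : ℝ := numΩ ε X Δ Ω / ((1 - ε) * denX ε X Δ Ω)

/-- The vector field of the `X`-system on states `(X, Δ, Ω, ε)`, with time `-X`. -/
def fieldX (y : ℝ × ℝ × ℝ × ℝ) : ℝ × ℝ × ℝ × ℝ :=
  (-1, -rateΔ y.2.2.2 y.1 y.2.1 y.2.2.1, -rateΩ y.2.2.2 y.1 y.2.1 y.2.2.1, 0)

/-- The region of the states of interest. -/
def regionX (M : ℝ) : Set (ℝ × ℝ × ℝ × ℝ) :=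
  {y | (3 / 2 < y.2.1 ∧ |y.2.2.2| < 1) ∧ y.2.1 < M ∧ -M < y.2.2.1 ∧ y.2.2.1 < -1 / 2 ∧
    0 < 1 + y.2.2.1 * y.1 ∧ denX y.2.2.2 y.1 y.2.1 y.2.2.1 < 0}

theorem contDiffAt_rpow_eta {n : WithTop ℕ∞} {Δ ε : ℝ} (hΔ : 0 < Δ) (hε : ε < 1) :
    ContDiffAt ℝ n (fun p : ℝ × ℝ => p.1 ^ (-eta p.2)) (Δ, ε) := by
  refine ContDiffAt.rpow contDiffAt_fst (ContDiffAt.neg ?_) hΔ.ne'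
  unfold eta
  have : 1 - ε ≠ 0 := by linarith
  exact ContDiffAt.div (by fun_prop) (by fun_prop) this

theorem contDiffAt_rpow_eta_comp {n : WithTop ℕ∞} {y : ℝ × ℝ × ℝ × ℝ} (hΔ : 0 < y.2.1)
    (hε : y.2.2.2 < 1) :
    ContDiffAt ℝ n (fun y : ℝ × ℝ × ℝ × ℝ => y.2.1 ^ (-eta y.2.2.2)) y :=
  ContDiffAt.comp (f := fun y : ℝ × ℝ × ℝ × ℝ => (y.2.1, y.2.2.2)) y
    (contDiffAt_rpow_eta hΔ hε) (by fun_prop)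

theorem contDiffAt_denX {n : WithTop ℕ∞} {y : ℝ × ℝ × ℝ × ℝ} (hΔ : 0 < y.2.1)
    (hε : y.2.2.2 < 1) :
    ContDiffAt ℝ n (fun y : ℝ × ℝ × ℝ × ℝ => denX y.2.2.2 y.1 y.2.1 y.2.2.1) y := by
  have := contDiffAt_rpow_eta_comp (n := n) hΔ hε
  unfold denX brJ
  fun_prop

theorem contDiffAt_fieldX {n : WithTop ℕ∞} {y : ℝ × ℝ × ℝ × ℝ} (hΔ : 0 < y.2.1)
    (hε : y.2.2.2 < 1) (hd : denX y.2.2.2 y.1 y.2.1 y.2.2.1 ≠ 0) :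
    ContDiffAt ℝ n fieldX y := by
  have h1 := contDiffAt_rpow_eta_comp (n := n) hΔ hε
  have h2 := contDiffAt_denX (n := n) hΔ hε
  have h3 : (1 - y.2.2.2) * denX y.2.2.2 y.1 y.2.1 y.2.2.1 ≠ 0 :=
    mul_ne_zero (by linarith) hd
  unfold fieldX rateΔ rateΩ
  refine ContDiffAt.prodMk contDiffAt_const (ContDiffAt.prodMk (ContDiffAt.neg ?_)
    (ContDiffAt.prodMk (ContDiffAt.neg ?_) contDiffAt_const))
  · refine ContDiffAt.div ?_ h2 hd
    unfold numΔ
    fun_prop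
  · refine ContDiffAt.div ?_ (by fun_prop) h3
    unfold numΩ
    fun_prop

theorem isOpen_regionX (M : ℝ) : IsOpen (regionX M) := by
  have h0 : IsOpen {y : ℝ × ℝ × ℝ × ℝ | 3 / 2 < y.2.1 ∧ |y.2.2.2| < 1} :=
    (isOpen_lt (by fun_prop) (by fun_prop)).and (isOpen_lt (by fun_prop) (by fun_prop))
  have h1 : ContinuousOn (fun y : ℝ × ℝ × ℝ × ℝ => denX y.2.2.2 y.1 y.2.1 y.2.2.1)
      {y : ℝ × ℝ × ℝ × ℝ | 3 / 2 < y.2.1 ∧ |y.2.2.2| < 1} := fun y hy =>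
    (contDiffAt_denX (n := 0) (by linarith [hy.1])
      (lt_of_abs_lt hy.2)).continuousAt.continuousWithinAt
  have h2 := h1.isOpen_inter_preimage h0 isOpen_Iio (t := Iio (0 : ℝ))
  have h3 : IsOpen {y : ℝ × ℝ × ℝ × ℝ | y.2.1 < M ∧ -M < y.2.2.1 ∧ y.2.2.1 < -1 / 2 ∧
      0 < 1 + y.2.2.1 * y.1} :=
    (isOpen_lt (by fun_prop) (by fun_prop)).and ((isOpen_lt (by fun_prop) (by fun_prop)).and
      ((isOpen_lt (by fun_prop) (by fun_prop)).and (isOpen_lt (by fun_prop) (by fun_prop))))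
  convert h2.inter h3 using 1
  ext y
  simp only [regionX, mem_ofPred_eq, mem_inter_iff, mem_preimage, mem_Iio]
  tauto

theorem contDiffOn_fieldX (M : ℝ) : ContDiffOn ℝ 1 fieldX (regionX M) := fun _ hy =>
  (contDiffAt_fieldX (by linarith [hy.1.1]) (lt_of_abs_lt hy.1.2)
    hy.2.2.2.2.2.ne).contDiffWithinAt

theorem eta_zero : eta 0 = 0 := by simp [eta]

theorem hasDerivAt_fst {E F : Type*} [NormedAddCommGroup E] [NormedSpace ℝ E]
    [NormedAddCommGroup F] [NormedSpace ℝ F] {f : ℝ → E × F} {f' : E × F} {x : ℝ}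
    (h : HasDerivAt f f' x) : HasDerivAt (fun x => (f x).1) f'.1 x :=
  ((ContinuousLinearMap.fst ℝ E F).hasFDerivAt.comp_hasDerivAt x h)

theorem hasDerivAt_snd {E F : Type*} [NormedAddCommGroup E] [NormedSpace ℝ E]
    [NormedAddCommGroup F] [NormedSpace ℝ F] {f : ℝ → E × F} {f' : E × F} {x : ℝ}
    (h : HasDerivAt f f' x) : HasDerivAt (fun x => (f x).2) f'.2 x :=
  ((ContinuousLinearMap.snd ℝ E F).hasFDerivAt.comp_hasDerivAt x h)

theorem fieldX_components {T : ℝ} {γ : ℝ → ℝ × ℝ × ℝ × ℝ}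
    (hγ : ∀ s ∈ Icc 0 T, HasDerivAt γ (fieldX (γ s)) s) {s : ℝ} (hs : s ∈ Icc 0 T) :
    (γ s).1 = (γ 0).1 - s ∧ (γ s).2.2.2 = (γ 0).2.2.2 := by
  constructor
  · have hd : ∀ s ∈ Icc 0 T, HasDerivAt (fun s => (γ s).1 + s) 0 s := fun s hs =>
      ((hasDerivAt_fst (hγ s hs)).add (hasDerivAt_id s)).congr_deriv (by simp [fieldX])
    have := constant_of_has_deriv_right_zero
      (fun s hs => (hd s hs).continuousAt.continuousWithinAt)
      (fun s hs => (hd s (Ico_subset_Icc_self hs)).hasDerivWithinAt) s hs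
    linarith
  · have hd : ∀ s ∈ Icc 0 T, HasDerivAt (fun s => (γ s).2.2.2) 0 s := fun s hs =>
      hasDerivAt_snd (hasDerivAt_snd (hasDerivAt_snd (hγ s hs)))
    exact constant_of_has_deriv_right_zero
      (fun s hs => (hd s hs).continuousAt.continuousWithinAt)
      (fun s hs => (hd s (Ico_subset_Icc_self hs)).hasDerivWithinAt) s hs

/-- A trajectory as a pair of functions of `X`. -/
theorem hasDerivAt_of_fieldX {T : ℝ} {γ : ℝ → ℝ × ℝ × ℝ × ℝ}
    (hγ : ∀ s ∈ Icc 0 T, HasDerivAt γ (fieldX (γ s)) s) {X : ℝ}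
    (hX : X ∈ Icc ((γ 0).1 - T) (γ 0).1) :
    HasDerivAt (fun X => (γ ((γ 0).1 - X)).2.1)
      (rateΔ (γ 0).2.2.2 X (γ ((γ 0).1 - X)).2.1 (γ ((γ 0).1 - X)).2.2.1) X ∧
    HasDerivAt (fun X => (γ ((γ 0).1 - X)).2.2.1)
      (rateΩ (γ 0).2.2.2 X (γ ((γ 0).1 - X)).2.1 (γ ((γ 0).1 - X)).2.2.1) X := by
  have hs : (γ 0).1 - X ∈ Icc 0 T := ⟨by linarith [hX.2], by linarith [hX.1]⟩
  obtain ⟨h1, h2⟩ := fieldX_components hγ hs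
  have h1' : (γ ((γ 0).1 - X)).1 = X := by rw [h1]; ring
  have h3 := (hγ _ hs).scomp X ((hasDerivAt_id X).const_sub (γ 0).1)
  simp only [fieldX, h1', h2, Function.comp_def] at h3
  have h4 := hasDerivAt_fst (hasDerivAt_snd h3)
  have h5 := hasDerivAt_fst (hasDerivAt_snd (hasDerivAt_snd h3))
  exact ⟨h4.congr_deriv (by simp), h5.congr_deriv (by simp)⟩

theorem isNewton_of_fieldX {T M : ℝ} {γ : ℝ → ℝ × ℝ × ℝ × ℝ}
    (hγ : ∀ s ∈ Icc 0 T, HasDerivAt γ (fieldX (γ s)) s ∧ γ s ∈ regionX M)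
    (h0 : (γ 0).2.2.2 = 0) :
    IsNewton ((γ 0).1 - T) (γ 0).1 (fun X => (γ ((γ 0).1 - X)).2.1)
      (fun X => (γ ((γ 0).1 - X)).2.2.1) := by
  have hden : ∀ X Δ Ω : ℝ, denX 0 X Δ Ω = -((1 + Ω * X) ^ 2 - X ^ 2) := by
    intro X Δ Ω; simp [denX, brJ, eta_zero]
  have hreg : ∀ X ∈ Icc ((γ 0).1 - T) (γ 0).1, γ ((γ 0).1 - X) ∈ regionX M ∧
      (γ ((γ 0).1 - X)).1 = X ∧ (γ ((γ 0).1 - X)).2.2.2 = 0 := by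
    intro X hX
    have hs : (γ 0).1 - X ∈ Icc 0 T := ⟨by linarith [hX.2], by linarith [hX.1]⟩
    obtain ⟨h1, h2⟩ := fieldX_components (fun s hs => (hγ s hs).1) hs
    exact ⟨(hγ _ hs).2, by rw [h1]; ring, by rw [h2, h0]⟩
  refine ⟨fun X hX => ?_, fun X hX => ?_, fun X hX => ?_, fun X hX => ?_, fun X hX => ?_⟩
  · have := (hasDerivAt_of_fieldX (fun s hs => (hγ s hs).1) hX).1
    refine this.congr_deriv ?_
    simp only [h0, rateΔ, hden, newtonQ, div_neg, numΔ, eta_zero, neg_zero, Real.rpow_zero]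
    ring
  · have := (hasDerivAt_of_fieldX (fun s hs => (hγ s hs).1) hX).2
    refine this.congr_deriv ?_
    simp only [h0, rateΩ, hden, newtonQ, numΩ, eta_zero, neg_zero, Real.rpow_zero,
      sub_zero, one_mul, div_neg]
    ring
  · linarith [(hreg X hX).1.1.1]
  · obtain ⟨h1, h2, h3⟩ := hreg X hX
    have := h1.2.2.2.2.1
    rwa [h2] at this
  · obtain ⟨h1, h2, h3⟩ := hreg X hX
    have := h1.2.2.2.2.2
    rw [h2, h3, hden] at this
    linarith

/-- The `X`-flow from Newtonian data reaches negative `X`, also for nearby data. -/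
theorem exists_flow_near {X₁ Δ₁ Ω₁ : ℝ} (hX₁ : 0 < X₁) (hW : 1 / 3 < 1 + Ω₁ * X₁)
    (hXW : X₁ < 1 + Ω₁ * X₁) (hR : 1 < Δ₁ * (1 + Ω₁ * X₁))
    (hH : 0 < -Ω₁ - 2 * X₁ * (1 + Ω₁ * X₁) *
      ((Δ₁ * (1 + Ω₁ * X₁) - 1) / ((1 + Ω₁ * X₁) ^ 2 - X₁ ^ 2)))
    (hΔ : 3 / 2 < Δ₁) (hΩ : Ω₁ < -1 / 2) :
    ∃ M τ δ : ℝ, 0 < τ ∧ 0 < δ ∧ ∀ y, dist y (X₁, Δ₁, Ω₁, 0) < δ → ∃ β : ℝ → ℝ × ℝ × ℝ × ℝ,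
      β 0 = y ∧ (∀ t ∈ Icc 0 (X₁ + τ), HasDerivAt β (fieldX (β t)) t ∧ β t ∈ regionX M) ∧
      ∀ᶠ t in 𝓝 0, HasDerivAt β (fieldX (β t)) t := by
  obtain ⟨M, hM⟩ := exists_newton_bound hW hXW hR
  set M₁ := max M (max Δ₁ (-Ω₁))
  set K : Set (ℝ × ℝ × ℝ × ℝ) := {y | y.1 ∈ Icc 0 X₁ ∧ y.2.1 ∈ Icc Δ₁ M₁ ∧
    y.2.2.1 ∈ Icc (-M₁) Ω₁ ∧ y.2.2.2 = 0 ∧ 1 + Ω₁ * X₁ ≤ 1 + y.2.2.1 * y.1} with hK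
  have hKc : IsCompact K := by
    have hsub : K ⊆ Icc 0 X₁ ×ˢ Icc Δ₁ M₁ ×ˢ Icc (-M₁) Ω₁ ×ˢ ({0} : Set ℝ) := fun y hy =>
      ⟨hy.1, hy.2.1, hy.2.2.1, hy.2.2.2.1⟩
    refine (isCompact_Icc.prod (isCompact_Icc.prod
      (isCompact_Icc.prod isCompact_singleton))).of_isClosed_subset ?_ hsub
    exact (isClosed_Icc.preimage (by fun_prop : Continuous fun y : ℝ × ℝ × ℝ × ℝ => y.1)).inter
      ((isClosed_Icc.preimage (by fun_prop : Continuous fun y : ℝ × ℝ × ℝ × ℝ => y.2.1)).inter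
      ((isClosed_Icc.preimage (by fun_prop : Continuous fun y : ℝ × ℝ × ℝ × ℝ => y.2.2.1)).inter
      ((isClosed_singleton.preimage
        (by fun_prop : Continuous fun y : ℝ × ℝ × ℝ × ℝ => y.2.2.2)).inter
        (isClosed_Ici.preimage
          (by fun_prop : Continuous fun y : ℝ × ℝ × ℝ × ℝ => 1 + y.2.2.1 * y.1)))))
  have hKU : K ⊆ regionX (M₁ + 1) := by
    rintro ⟨X, Δ, Ω, e⟩ ⟨⟨h1, h2⟩, ⟨h3, h4⟩, ⟨h5, h6⟩, h7, h8⟩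
    simp only at h1 h2 h3 h4 h5 h6 h7 h8
    subst h7
    have h9 : X ^ 2 < (1 + Ω * X) ^ 2 := by
      have : X < 1 + Ω * X := by linarith
      gcongr
    refine ⟨⟨by simp only; linarith, by simp⟩, by simp only; linarith, by simp only; linarith,
      by simp only; linarith, by simp only; linarith, ?_⟩
    simp only [denX, brJ, eta_zero, neg_zero, Real.rpow_zero]
    linarith
  have hx₀K : (X₁, Δ₁, Ω₁, (0 : ℝ)) ∈ K :=
    ⟨⟨hX₁.le, le_rfl⟩, ⟨le_rfl, (le_max_left _ _).trans (le_max_right _ _)⟩,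
      ⟨by have : -Ω₁ ≤ M₁ := (le_max_right _ _).trans (le_max_right _ _)
          simp only; linarith, le_rfl⟩, rfl, le_rfl⟩
  obtain ⟨τ, hτ, γ, hγ0, hγ⟩ := exists_solution_of_bounds (isOpen_regionX (M₁ + 1))
    (contDiffOn_fieldX _) hKc hKU hX₁.le (x₀ := (X₁, Δ₁, Ω₁, (0 : ℝ))) (by
      intro t ht γ hγ0 hγ
      have h0 : (γ 0).1 = X₁ := by rw [hγ0]
      have hcomp : ∀ s ∈ Icc 0 t, (γ s).1 = (γ 0).1 - s ∧ (γ s).2.2.2 = (γ 0).2.2.2 :=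
        fun s hs => fieldX_components (fun s hs => (hγ s hs).1) hs
      have hstrict : ∀ s ∈ Icc 0 t, s < X₁ → γ s ∈ K := by
        intro s hs hsX
        have hγs : ∀ z ∈ Icc 0 s, HasDerivAt γ (fieldX (γ z)) z ∧ γ z ∈ regionX (M₁ + 1) :=
          fun z hz => hγ z ⟨hz.1, hz.2.trans hs.2⟩
        have hN := isNewton_of_fieldX hγs (by rw [hγ0])
        obtain ⟨hc1, hc2⟩ := hcomp s hs
        rw [h0] at hN hc1
        have hb1 : (γ (X₁ - X₁)).2.1 = Δ₁ := by rw [sub_self, hγ0]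
        have hb2 : (γ (X₁ - X₁)).2.2.1 = Ω₁ := by rw [sub_self, hγ0]
        have hHb : 0 < newtonH (fun X => (γ (X₁ - X)).2.1) (fun X => (γ (X₁ - X)).2.2.1) X₁ := by
          simp only [newtonH, newtonQ, hb1, hb2]; exact hH
        have hab : X₁ - s ∈ Icc (X₁ - s) X₁ := ⟨le_rfl, by linarith [hs.1]⟩
        have h1 := hM (X₁ - s) ⟨by linarith, by linarith [hs.1]⟩ _ _ hN hb1 hb2 hHb
        have h2 := hN.monotone_bounds (by linarith) (by simp only [hb2]; exact hW)
          (by simp only [hb1, hb2]; exact hR) hHb hab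
        simp only [hb1, hb2, sub_sub_cancel] at h1 h2
        refine ⟨⟨by rw [hc1]; linarith, by rw [hc1]; linarith [hs.1]⟩,
          ⟨h2.1, h1.1.trans (le_max_left _ _)⟩, ⟨?_, h2.2.1⟩, by rw [hc2, hγ0], ?_⟩
        · have : M ≤ M₁ := le_max_left _ _
          linarith [h1.2]
        · rw [hc1]; exact h2.2.2.1
      rcases lt_or_eq_of_le ht.2 with h | h
      · exact hstrict t ⟨ht.1, le_rfl⟩ h
      · have hlim : Tendsto γ (𝓝[<] t) (𝓝 (γ t)) :=
          (hγ t ⟨ht.1, le_rfl⟩).1.continuousAt.mono_left nhdsWithin_le_nhds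
        refine hKc.isClosed.mem_of_tendsto hlim ?_
        have : Ioo 0 t ∈ 𝓝[<] t := Ioo_mem_nhdsLT (by rw [h]; exact hX₁)
        filter_upwards [this] with s hs
        exact hstrict s ⟨hs.1.le, hs.2.le⟩ (by rw [← h]; exact hs.2)) hx₀K
  obtain ⟨δ, hδ, h⟩ := exists_nearby_solution (isOpen_regionX (M₁ + 1)) (contDiffOn_fieldX _)
    (by linarith) hγ
  rw [hγ0] at h
  exact ⟨M₁ + 1, τ, δ, hτ, hδ, h⟩

end XSystem

section Cubic

theorem cubic_eq_mul {ε w z X : ℝ} (hz : cubic ε w z = 0) :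
    cubic ε w X = (X - z) * (X ^ 2 + (a₂ ε w / a₃ ε w + z) * X
      + (a₁ ε w / a₃ ε w + (a₂ ε w / a₃ ε w + z) * z)) := by
  unfold cubic at hz ⊢
  linear_combination hz

theorem W1gh_eq {ε w z s : ℝ} (hz : cubic ε w z = 0) (hzs : z ≤ -s) (hs : 0 < s)
    (hB : a₂ ε w / a₃ ε w + z ≤ 0)
    (hC : |a₁ ε w / a₃ ε w + (a₂ ε w / a₃ ε w + z) * z| < s ^ 2) : W1gh ε w = z := by
  refine IsLeast.csInf_eq ⟨hz, fun X hX => ?_⟩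
  by_contra! hlt
  have h1 : cubic ε w X = 0 := hX
  rw [cubic_eq_mul hz] at h1
  have h2 := (abs_lt.1 hC).1
  have h3 : 0 ≤ (a₂ ε w / a₃ ε w + z) * X := mul_nonneg_of_nonpos_of_nonpos hB (by linarith)
  have h4 : s ^ 2 ≤ X ^ 2 := by nlinarith
  rcases mul_eq_zero.1 h1 with h | h <;> linarith

theorem cubic_W1RLP {ε w : ℝ} (hz : cubic ε w (W1gh ε w) = 0) (hz0 : W1gh ε w ≠ 0)
    (ha : a₃ ε w ≠ 0)
    (hd : 0 ≤ (a₂ ε w / a₃ ε w + W1gh ε w) ^ 2 + 4 * a₀ ε w / (a₃ ε w * W1gh ε w)) :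
    cubic ε w (W1RLP ε w) = 0 := by
  rw [cubic_eq_mul hz]
  set z := W1gh ε w with hzdef
  have h1 : a₁ ε w / a₃ ε w + (a₂ ε w / a₃ ε w + z) * z = -(a₀ ε w / (a₃ ε w * z)) := by
    unfold cubic at hz
    field_simp
    field_simp at hz
    linarith
  rw [h1]
  have h2 := Real.sq_sqrt hd
  have h3 : 2 * W1RLP ε w + (a₂ ε w / a₃ ε w + z)
      = √((a₂ ε w / a₃ ε w + z) ^ 2 + 4 * a₀ ε w / (a₃ ε w * z)) := by
    rw [W1RLP, ← hzdef]; ring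
  rw [← h3] at h2
  have h4 : W1RLP ε w ^ 2 + (a₂ ε w / a₃ ε w + z) * W1RLP ε w + -(a₀ ε w / (a₃ ε w * z)) = 0 := by
    rw [mul_div_assoc] at h2
    linarith
  rw [h4, mul_zero]

/-- The two first-order Taylor relations at the sonic point. -/
theorem taylor_relations {ε w S P : ℝ} (ha : a₃ ε w ≠ 0) (hS : cubic ε w S = 0)
    (hden : ch ε w + cb ε w * S ≠ 0)
    (hP : P = -((cd ε w * S ^ 2 + ce ε w * S + cc w * cH ε w) / (ch ε w + cb ε w * S))) :
    P * (cH ε w + cb ε w * P + cd ε w * S) = (1 - ε) * ca ε w * (P - S) ∧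
    (S + cc w) * (cH ε w + cb ε w * P + cd ε w * S) = -((1 + ε) * ca ε w * (P - S)) := by
  have h3 : a₃ ε w * S ^ 3 + a₂ ε w * S ^ 2 + a₁ ε w * S + a₀ ε w = 0 := by
    unfold cubic at hS
    field_simp at hS
    linarith
  have hP' : P * (ch ε w + cb ε w * S) = -(cd ε w * S ^ 2 + ce ε w * S + cc w * cH ε w) := by
    rw [hP, neg_mul, div_mul_cancel₀ _ hden]
  constructor
  · have h4 : (ch ε w + cb ε w * S) ^ 2 * (P * (cH ε w + cb ε w * P + cd ε w * S)
        - (1 - ε) * ca ε w * (P - S)) = 0 := by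
      have : (ch ε w + cb ε w * S) ^ 2 * (P * (cH ε w + cb ε w * P + cd ε w * S)
        - (1 - ε) * ca ε w * (P - S)) =
        cb ε w * (P * (ch ε w + cb ε w * S)) ^ 2 + (P * (ch ε w + cb ε w * S)) *
          (ch ε w + cb ε w * S) * (cd ε w * S - cf ε w)
          + (1 - ε) * ca ε w * S * (ch ε w + cb ε w * S) ^ 2 := by
        rw [cf]; ring
      rw [this, hP']
      rw [a₃, a₂, a₁, a₀] at h3
      linear_combination -h3
    rcases mul_eq_zero.1 h4 with h | h
    · exact absurd (pow_eq_zero_iff two_ne_zero |>.1 h) hden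
    · linarith
  · have hce : ce ε w = cH ε w + cc w * cd ε w - (1 + ε) * ca ε w := by
      unfold ce cH cc cd ca; ring
    have hch : ch ε w = (1 + ε) * ca ε w + cb ε w * cc w := rfl
    rw [hce, hch] at hP'
    linear_combination hP'

/-- The slopes of an RLP-type solution at the sonic point. -/
def rlpSlopes (ε w : ℝ) : ℝ × ℝ × ℝ × ℝ :=
  (R1RLP ε w, W1RLP ε w, -2 * cH ε w - eta ε / w * cH ε w * R1RLP ε w,
    -R1RLP ε w / (2 * (1 - ε) * ca ε w))

theorem isSonicSlopes_rlpSlopes {ε w : ℝ} (ha : a₃ ε w ≠ 0) (hS : cubic ε w (W1RLP ε w) = 0)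
    (hden : ch ε w + cb ε w * W1RLP ε w ≠ 0) (hw : w ≠ 0) (hwε : w + ε ≠ 0) (hε : 1 - ε ≠ 0)
    (hN : cH ε w + cb ε w * R1RLP ε w + cd ε w * W1RLP ε w ≠ 0) :
    IsSonicSlopes ε w 0 (fun _ => rlpSlopes ε w) := by
  obtain ⟨hA, hB⟩ := taylor_relations ha hS hden rfl
  set P := R1RLP ε w
  rw [show -((cd ε w * W1RLP ε w ^ 2 + ce ε w * W1RLP ε w + cc w * cH ε w) /
    (ch ε w + cb ε w * W1RLP ε w)) = P from rfl] at hA hB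
  set S := W1RLP ε w
  have hlin : (1 + ε) * P + (1 - ε) * (S + cc w) = 0 := by
    refine (mul_eq_zero.1 (?_ : (cH ε w + cb ε w * P + cd ε w * S) *
      ((1 + ε) * P + (1 - ε) * (S + cc w)) = 0)).resolve_left hN
    linear_combination (1 + ε) * hA + (1 - ε) * hB
  have hca : ca ε w ≠ 0 := mul_ne_zero hw hwε
  have hq : 2 * (1 - ε) * ca ε w * (-P / (2 * (1 - ε) * ca ε w)) = -P := by
    field_simp
  have hPv : P = velD ε w w (-P / (2 * (1 - ε) * ca ε w)) := by
    simp only [velD, smul_eq_mul, mul_one]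
    rw [ca] at hq ⊢
    linear_combination hq
  have hSv : S = velW ε w (-P / (2 * (1 - ε) * ca ε w)) := by
    simp only [velW, smul_eq_mul, mul_one]
    have : (1 - ε) * S = (1 - ε) * (1 - 3 * w + 2 * (1 + ε) * (w * (w + ε) *
        (-P / (2 * (1 - ε) * ca ε w)))) := by
      rw [cc] at hlin
      rw [ca] at hq ⊢
      linear_combination hlin - (1 + ε) * hq
    exact mul_left_cancel₀ hε this
  have hGv : -2 * cH ε w - eta ε / w * cH ε w * P
      = velE ε w (cH ε w) (-P / (2 * (1 - ε) * ca ε w)) := by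
    simp only [velE, smul_eq_mul, mul_one, ca, eta]
    field_simp
    ring
  have halg : denSlope ε w 0 P S (-2 * cH ε w - eta ε / w * cH ε w * P) *
      (-P / (2 * (1 - ε) * ca ε w)) = P - S := by
    have h1 : denSlope ε w 0 P S (-2 * cH ε w - eta ε / w * cH ε w * P)
        = -2 * (cH ε w + cb ε w * P + cd ε w * S) := by
      simp only [denSlope, smul_eq_mul, cb, cd]
      field_simp
      ring
    rw [h1]
    field_simp
    linear_combination hA
  refine ⟨continuousOn_const, ?_, ?_, ?_, ?_, ?_, ?_, ?_⟩
  · intro t ht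
    rw [uIcc_self, mem_singleton_iff] at ht; subst ht; simp
  · intro t ht
    rw [uIcc_self, mem_singleton_iff] at ht; subst ht; simp
  · intro t ht
    rw [uIcc_self, mem_singleton_iff] at ht; subst ht; simp
  · intro t ht
    rw [uIcc_self, mem_singleton_iff] at ht; subst ht
    exact halg
  · exact hPv
  · exact hSv
  · exact hGv

section Limits
variable {σ : ℝ}

theorem tendsto_of_eq {α : Type*} {f : α → ℝ} {l : Filter α} {a b : ℝ}
    (h : Tendsto f l (𝓝 a)) (hab : a = b) : Tendsto f l (𝓝 b) := hab ▸ h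

theorem tendsto_eta_fst : Tendsto (fun p : ℝ × ℝ => eta p.1) (𝓝 (0, σ)) (𝓝 0) := by
  have : ContinuousAt (fun p : ℝ × ℝ => eta p.1) (0, σ) := by
    unfold eta
    exact ContinuousAt.div (by fun_prop) (by fun_prop) (by simp)
  simpa [eta] using this.tendsto

theorem tendsto_cH : Tendsto (fun p : ℝ × ℝ => cH p.1 p.2) (𝓝 (0, σ)) (𝓝 (σ ^ 2)) := by
  have : ContinuousAt (fun p : ℝ × ℝ => cH p.1 p.2) (0, σ) := by unfold cH; fun_prop
  simpa [cH] using this.tendsto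

theorem tendsto_ca : Tendsto (fun p : ℝ × ℝ => ca p.1 p.2) (𝓝 (0, σ)) (𝓝 (σ ^ 2)) := by
  have : ContinuousAt (fun p : ℝ × ℝ => ca p.1 p.2) (0, σ) := by unfold ca; fun_prop
  simpa [ca, sq] using this.tendsto

theorem tendsto_cc : Tendsto (fun p : ℝ × ℝ => cc p.2) (𝓝 (0, σ)) (𝓝 (3 * σ - 1)) := by
  have : ContinuousAt (fun p : ℝ × ℝ => cc p.2) (0, σ) := by unfold cc; fun_prop
  simpa [cc] using this.tendsto

theorem tendsto_cd : Tendsto (fun p : ℝ × ℝ => cd p.1 p.2) (𝓝 (0, σ)) (𝓝 σ) := by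
  have : ContinuousAt (fun p : ℝ × ℝ => cd p.1 p.2) (0, σ) := by unfold cd; fun_prop
  simpa [cd] using this.tendsto

theorem tendsto_ce :
    Tendsto (fun p : ℝ × ℝ => ce p.1 p.2) (𝓝 (0, σ)) (𝓝 (3 * σ ^ 2 - σ)) := by
  have : ContinuousAt (fun p : ℝ × ℝ => ce p.1 p.2) (0, σ) := by unfold ce; fun_prop
  simpa [ce] using this.tendsto

theorem tendsto_fst_zero : Tendsto (fun p : ℝ × ℝ => p.1) (𝓝 (0, σ)) (𝓝 0) :=
  (continuousAt_fst : ContinuousAt Prod.fst ((0 : ℝ), σ))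

theorem tendsto_snd_self : Tendsto (fun p : ℝ × ℝ => p.2) (𝓝 (0, σ)) (𝓝 σ) :=
  (continuousAt_snd : ContinuousAt Prod.snd ((0 : ℝ), σ))

theorem tendsto_cb (hσ : 0 < σ) : Tendsto (fun p : ℝ × ℝ => cb p.1 p.2) (𝓝 (0, σ)) (𝓝 0) := by
  have := ((tendsto_eta_fst (σ := σ)).div_const 2).mul
    ((tendsto_cH (σ := σ)).div tendsto_snd_self hσ.ne')
  have := this.add ((tendsto_fst_zero.const_mul 2).mul (tendsto_snd_self (σ := σ)))
  simpa [cb] using this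

theorem tendsto_cf : Tendsto (fun p : ℝ × ℝ => cf p.1 p.2) (𝓝 (0, σ)) (𝓝 0) := by
  have := (((tendsto_fst_zero (σ := σ)).const_sub 1).mul tendsto_ca).sub tendsto_cH
  simpa [cf] using this

theorem tendsto_ch (hσ : 0 < σ) :
    Tendsto (fun p : ℝ × ℝ => ch p.1 p.2) (𝓝 (0, σ)) (𝓝 (σ ^ 2)) := by
  have := (((tendsto_fst_zero (σ := σ)).const_add 1).mul tendsto_ca).add
    ((tendsto_cb hσ).mul tendsto_cc)
  simpa [ch] using this

theorem tendsto_a₃ (hσ : 0 < σ) :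
    Tendsto (fun p : ℝ × ℝ => a₃ p.1 p.2) (𝓝 (0, σ)) (𝓝 (σ ^ 4)) := by
  have h := (tendsto_cd.mul ((tendsto_cd.mul (tendsto_ch hσ)).sub
    ((tendsto_cb hσ).mul tendsto_ce))).sub ((tendsto_cb hσ).mul ((tendsto_cf.mul tendsto_cd).add
      ((((tendsto_fst_zero (σ := σ)).const_sub 1).mul tendsto_ca).mul (tendsto_cb hσ))))
  exact tendsto_of_eq h (by ring)

theorem tendsto_a₂ (hσ : 0 < σ) :
    Tendsto (fun p : ℝ × ℝ => a₂ p.1 p.2) (𝓝 (0, σ)) (𝓝 (σ ^ 4 * (3 * σ - 1))) := by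
  have hε := (tendsto_fst_zero (σ := σ)).const_sub 1
  have hb := tendsto_cb hσ
  have hh := tendsto_ch hσ
  have h := (((((hb.mul tendsto_cc).mul tendsto_cd).mul tendsto_cH).sub
    (tendsto_ce.mul ((tendsto_cd.mul hh).sub (hb.mul tendsto_ce)))).add
    (hh.mul ((tendsto_cf.mul tendsto_cd).add ((hε.mul tendsto_ca).mul hb)))).add
    (hb.mul ((tendsto_cf.mul tendsto_ce).add ((hε.mul tendsto_ca).mul hh)))
  exact tendsto_of_eq h.neg (by ring)

theorem tendsto_a₁ (hσ : 0 < σ) :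
    Tendsto (fun p : ℝ × ℝ => a₁ p.1 p.2) (𝓝 (0, σ)) (𝓝 (σ ^ 5 * (2 * σ - 1))) := by
  have hε := (tendsto_fst_zero (σ := σ)).const_sub 1
  have hb := tendsto_cb hσ
  have hh := tendsto_ch hσ
  have h := (((((hb.mul tendsto_cc).mul tendsto_ce).mul tendsto_cH).sub
    ((tendsto_cc.mul tendsto_cH).mul ((tendsto_cd.mul hh).sub (hb.mul tendsto_ce)))).add
    (((hb.mul tendsto_cc).mul tendsto_cf).mul tendsto_cH)).add
    (hh.mul ((tendsto_cf.mul tendsto_ce).add ((hε.mul tendsto_ca).mul hh)))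
  exact tendsto_of_eq h.neg (by ring)

theorem tendsto_a₀ (hσ : 0 < σ) :
    Tendsto (fun p : ℝ × ℝ => a₀ p.1 p.2) (𝓝 (0, σ)) (𝓝 0) := by
  have hb := tendsto_cb hσ
  have hh := tendsto_ch hσ
  have h := ((tendsto_cc (σ := σ)).mul tendsto_cH).mul
    (((hb.mul tendsto_cc).mul tendsto_cH).add (tendsto_cf.mul hh))
  exact tendsto_of_eq h.neg (by ring)

theorem eventually_a₃_ne (hσ : 0 < σ) : ∀ᶠ p : ℝ × ℝ in 𝓝 (0, σ), a₃ p.1 p.2 ≠ 0 :=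
  (tendsto_a₃ hσ).eventually_ne (by positivity)

theorem tendsto_ratio₂ (hσ : 0 < σ) :
    Tendsto (fun p : ℝ × ℝ => a₂ p.1 p.2 / a₃ p.1 p.2) (𝓝 (0, σ)) (𝓝 (3 * σ - 1)) :=
  tendsto_of_eq ((tendsto_a₂ hσ).div (tendsto_a₃ hσ) (by positivity)) (by field_simp)

theorem tendsto_ratio₁ (hσ : 0 < σ) :
    Tendsto (fun p : ℝ × ℝ => a₁ p.1 p.2 / a₃ p.1 p.2) (𝓝 (0, σ)) (𝓝 (σ * (2 * σ - 1))) :=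
  tendsto_of_eq ((tendsto_a₁ hσ).div (tendsto_a₃ hσ) (by positivity)) (by field_simp)

theorem tendsto_ratio₀ (hσ : 0 < σ) :
    Tendsto (fun p : ℝ × ℝ => a₀ p.1 p.2 / a₃ p.1 p.2) (𝓝 (0, σ)) (𝓝 0) :=
  tendsto_of_eq ((tendsto_a₀ hσ).div (tendsto_a₃ hσ) (by positivity)) (by simp)

theorem tendsto_cubic (hσ : 0 < σ) (X : ℝ) :
    Tendsto (fun p : ℝ × ℝ => cubic p.1 p.2 X) (𝓝 (0, σ))
      (𝓝 (X * (X + σ) * (X + 2 * σ - 1))) := by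
  have h := (((tendsto_const_nhds (x := X ^ 3)).add ((tendsto_ratio₂ hσ).mul_const (X ^ 2))).add
    ((tendsto_ratio₁ hσ).mul_const X)).add (tendsto_ratio₀ hσ)
  exact tendsto_of_eq h (by ring)

theorem continuous_cubic (ε w : ℝ) : Continuous (cubic ε w) := by
  unfold cubic; fun_prop

theorem eventually_W1gh (hσ : 0 < σ) (hσ2 : σ < 1 / 2) {ρ : ℝ} (hρ : 0 < ρ) :
    ∀ᶠ p : ℝ × ℝ in 𝓝 (0, σ), cubic p.1 p.2 (W1gh p.1 p.2) = 0 ∧ |W1gh p.1 p.2 + σ| ≤ ρ := by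
  -- shrink the radius of the interval around `-σ`
  obtain ⟨s, hs, hsσ, hsρ, hs2, hs3⟩ : ∃ s, 0 < s ∧ s ≤ σ / 2 ∧ s ≤ ρ ∧ s ≤ (1 - 2 * σ) / 2 ∧
      s * (1 + σ) < (σ / 2) ^ 2 / 2 := by
    refine ⟨min (min (σ / 2) ρ) (min ((1 - 2 * σ) / 2) ((σ / 2) ^ 2 / (4 * (1 + σ)))), ?_, ?_, ?_,
      ?_, ?_⟩
    · have : 0 < 1 - 2 * σ := by linarith
      positivity
    · exact (min_le_left _ _).trans (min_le_left _ _)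
    · exact (min_le_left _ _).trans (min_le_right _ _)
    · exact (min_le_right _ _).trans (min_le_left _ _)
    · have h := (min_le_right (min (σ / 2) ρ) _).trans (min_le_right ((1 - 2 * σ) / 2)
        ((σ / 2) ^ 2 / (4 * (1 + σ))))
      rw [le_div_iff₀ (by positivity)] at h
      have : 0 < (σ / 2) ^ 2 := by positivity
      linarith
  have h1 := (tendsto_cubic hσ (-σ - s)).eventually_lt_const (u := 0) (by
    have : 0 < (σ + s) * s * (1 - σ + s) := by
      have : 0 < 1 - σ + s := by linarith
      positivity
    nlinarith)
  have h2 := (tendsto_cubic hσ (-σ + s)).eventually_const_lt (u := 0) (by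
    have : 0 < (σ - s) * s * (1 - σ - s) := by
      have : 0 < 1 - σ - s := by linarith
      have : 0 < σ - s := by linarith
      positivity
    nlinarith)
  have h3 := (tendsto_ratio₂ hσ).eventually_le_const (u := 3 * σ - 1 + (1 - 2 * σ) / 2)
    (by linarith)
  have h4 : Tendsto (fun p : ℝ × ℝ => |a₁ p.1 p.2 / a₃ p.1 p.2 - σ * (2 * σ - 1)|
      + |a₂ p.1 p.2 / a₃ p.1 p.2 - (3 * σ - 1)| * (2 * σ)) (𝓝 (0, σ)) (𝓝 0) := by
    have := (((tendsto_ratio₁ hσ).sub_const (σ * (2 * σ - 1))).abs).add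
      ((((tendsto_ratio₂ hσ).sub_const (3 * σ - 1)).abs).mul_const (2 * σ))
    exact tendsto_of_eq this (by simp)
  have h5 := h4.eventually_lt_const (u := (σ / 2) ^ 2 / 2) (by positivity)
  filter_upwards [h1, h2, h3, h5] with p h1 h2 h3 h5
  obtain ⟨z, hz, hz0⟩ := intermediate_value_Icc (by linarith : -σ - s ≤ -σ + s)
    (continuous_cubic p.1 p.2).continuousOn ⟨h1.le, h2.le⟩
  have hzs : |z + σ| ≤ s := abs_le.2 ⟨by linarith [hz.1], by linarith [hz.2]⟩
  have : W1gh p.1 p.2 = z := by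
    refine W1gh_eq (s := σ / 2) hz0 (by linarith [hz.2]) (by positivity) (by linarith [hz.2]) ?_
    set α := a₂ p.1 p.2 / a₃ p.1 p.2
    set β := a₁ p.1 p.2 / a₃ p.1 p.2
    have e : β + (α + z) * z = (β - σ * (2 * σ - 1)) + (α - (3 * σ - 1)) * z
        + (z + σ) * (z + 2 * σ - 1) := by ring
    have hz2 : |z| ≤ 2 * σ := abs_le.2 ⟨by linarith [hz.1], by linarith [hz.2]⟩
    have hz3 : |z + 2 * σ - 1| ≤ 1 + σ := abs_le.2 ⟨by linarith [hz.1], by linarith [hz.2]⟩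
    have e1 : |(α - (3 * σ - 1)) * z| ≤ |α - (3 * σ - 1)| * (2 * σ) := by
      rw [abs_mul]; gcongr
    have e2 : |(z + σ) * (z + 2 * σ - 1)| ≤ s * (1 + σ) := by
      rw [abs_mul]; gcongr
    rw [e]
    calc _ ≤ |(β - σ * (2 * σ - 1))| + |(α - (3 * σ - 1)) * z| + |(z + σ) * (z + 2 * σ - 1)| :=
          abs_add_three _ _ _
      _ < (σ / 2) ^ 2 := by linarith
  rw [this]
  exact ⟨hz0, hzs.trans hsρ⟩

theorem tendsto_W1gh (hσ : 0 < σ) (hσ2 : σ < 1 / 2) :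
    Tendsto (fun p : ℝ × ℝ => W1gh p.1 p.2) (𝓝 (0, σ)) (𝓝 (-σ)) := by
  rw [Metric.tendsto_nhds]
  intro ρ hρ
  filter_upwards [eventually_W1gh hσ hσ2 (half_pos hρ)] with p hp
  rw [Real.dist_eq, sub_neg_eq_add]
  linarith [hp.2]

theorem tendsto_disc (hσ : 0 < σ) (hσ2 : σ < 1 / 2) :
    Tendsto (fun p : ℝ × ℝ => (a₂ p.1 p.2 / a₃ p.1 p.2 + W1gh p.1 p.2) ^ 2
        + 4 * a₀ p.1 p.2 / (a₃ p.1 p.2 * W1gh p.1 p.2)) (𝓝 (0, σ)) (𝓝 ((1 - 2 * σ) ^ 2)) := by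
  have hne : σ ^ 4 * -σ ≠ 0 := mul_ne_zero (by positivity) (by linarith)
  have h := ((((tendsto_ratio₂ hσ).add (tendsto_W1gh hσ hσ2)).pow 2)).add
    (((tendsto_a₀ hσ).const_mul 4).div ((tendsto_a₃ hσ).mul (tendsto_W1gh hσ hσ2)) hne)
  exact tendsto_of_eq h (by rw [mul_zero, zero_div]; ring)

theorem tendsto_W1RLP (hσ : 0 < σ) (hσ2 : σ < 1 / 2) :
    Tendsto (fun p : ℝ × ℝ => W1RLP p.1 p.2) (𝓝 (0, σ)) (𝓝 (1 - 2 * σ)) := by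
  have h := ((((tendsto_ratio₂ hσ).add (tendsto_W1gh hσ hσ2)).neg).add
    (tendsto_disc hσ hσ2).sqrt).div_const 2
  refine tendsto_of_eq h ?_
  rw [Real.sqrt_sq (by linarith)]
  ring

theorem tendsto_R1RLP (hσ : 0 < σ) (hσ2 : σ < 1 / 2) :
    Tendsto (fun p : ℝ × ℝ => R1RLP p.1 p.2) (𝓝 (0, σ)) (𝓝 (-σ)) := by
  have hW := tendsto_W1RLP hσ hσ2
  have h := (((tendsto_cd.mul (hW.pow 2)).add (tendsto_ce.mul hW)).add
    ((tendsto_cc (σ := σ)).mul tendsto_cH)).div ((tendsto_ch hσ).add ((tendsto_cb hσ).mul hW))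
    (by rw [zero_mul, add_zero]; positivity)
  refine tendsto_of_eq h.neg ?_
  field_simp
  ring

theorem tendsto_rlpSlopes (hσ : 0 < σ) (hσ2 : σ < 1 / 2) :
    Tendsto (fun p : ℝ × ℝ => rlpSlopes p.1 p.2) (𝓝 (0, σ)) (𝓝 (baseSlopes σ)) := by
  have hR := tendsto_R1RLP hσ hσ2
  refine hR.prodMk_nhds ((tendsto_W1RLP hσ hσ2).prodMk_nhds (Tendsto.prodMk_nhds ?_ ?_))
  · have h := (tendsto_cH.const_mul (-2)).sub (((tendsto_eta_fst.div tendsto_snd_self hσ.ne').mul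
      tendsto_cH).mul hR)
    exact tendsto_of_eq h (by ring)
  · have h := hR.neg.div (((tendsto_fst_zero.const_sub 1).const_mul 2).mul tendsto_ca)
      (by positivity)
    refine tendsto_of_eq h ?_
    field_simp
    ring

/-- Near `ε = 0` the RLP slopes satisfy the relations at the sonic point. -/
theorem eventually_isSonicSlopes_rlpSlopes (hσ : 0 < σ) (hσ2 : σ < 1 / 2) :
    ∀ᶠ p : ℝ × ℝ in 𝓝 (0, σ), IsSonicSlopes p.1 p.2 0 (fun _ => rlpSlopes p.1 p.2) := by
  have hW := tendsto_W1RLP hσ hσ2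
  have hden := ((tendsto_ch hσ).add ((tendsto_cb hσ).mul hW)).eventually_ne
    (by rw [zero_mul, add_zero]; positivity)
  have hN := ((tendsto_cH.add ((tendsto_cb hσ).mul (tendsto_R1RLP hσ hσ2))).add
    (tendsto_cd.mul hW)).eventually_ne (by
      have : 0 < 1 - 2 * σ := by linarith
      rw [zero_mul, add_zero]
      positivity)
  have hdisc := (tendsto_disc hσ hσ2).eventually_const_lt (u := 0) (by
    have : 0 < 1 - 2 * σ := by linarith
    positivity)
  filter_upwards [eventually_a₃_ne hσ, hden, hN, hdisc, eventually_W1gh hσ hσ2 (half_pos hσ),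
    (tendsto_snd_self (σ := σ)).eventually_ne hσ.ne',
    ((tendsto_snd_self (σ := σ)).add tendsto_fst_zero).eventually_ne
      (by rw [add_zero]; exact hσ.ne'),
    ((tendsto_fst_zero (σ := σ)).const_sub 1).eventually_ne (b₂ := 0) (by norm_num)]
    with p h1 h2 h3 h4 h5 h6 h7 h8
  have hz : W1gh p.1 p.2 ≠ 0 := by
    intro h
    have := h5.2
    rw [h, zero_add, abs_of_pos hσ] at this
    linarith
  exact isSonicSlopes_rlpSlopes h1 (cubic_W1RLP h5.1 hz h1 h4.le) h2 h6 h7 h8 h3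

end Limits
end Cubic

section Germ

/-- `D` along a sonic germ, as a function of `t = log (x / xs)`. -/
def gD (g : ℝ × ℝ × ℝ → ℝ × ℝ × ℝ × ℝ) (ε w t : ℝ) : ℝ := w + t * (g (t, ε, w)).1

/-- `W` along a sonic germ. -/
def gW (g : ℝ × ℝ × ℝ → ℝ × ℝ × ℝ × ℝ) (ε w t : ℝ) : ℝ := w + t * (g (t, ε, w)).2.1

/-- `E = D^(-η) x^(-2)` along a sonic germ. -/
def gE (g : ℝ × ℝ × ℝ → ℝ × ℝ × ℝ × ℝ) (ε w t : ℝ) : ℝ := cH ε w + t * (g (t, ε, w)).2.2.1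

/-- The sonic denominator over `t x²` along a sonic germ. -/
def gβ (g : ℝ × ℝ × ℝ → ℝ × ℝ × ℝ × ℝ) (ε w t : ℝ) : ℝ :=
  denSlope ε w t (g (t, ε, w)).1 (g (t, ε, w)).2.1 (g (t, ε, w)).2.2.1

/-- A family of slopes near the sonic point for parameters near `(0, σ)`. -/
structure IsSonicGerm (σ : ℝ) (g : ℝ × ℝ × ℝ → ℝ × ℝ × ℝ × ℝ) (r : ℝ) : Prop where
  pos : 0 < r
  base : g (0, 0, σ) = baseSlopes σ
  analytic : ∀ l ε w, |l| < r → |ε| < r → |w - σ| < r → AnalyticAt ℝ g (l, ε, w)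
  slopes : ∀ l ε w, |l| < r → |ε| < r → |w - σ| < r →
    IsSonicSlopes ε w l (fun t => g (t, ε, w))
  unique : ∀ l ε w u, 0 ≤ l → |ε| < r → |w - σ| < r → IsSonicSlopes ε w l u →
    u 0 = rlpSlopes ε w → ∃ l' > 0, ∀ t ∈ Icc 0 l, t ≤ l' → u t = g (t, ε, w)
  posD : ∀ l ε w, |l| < r → |ε| < r → |w - σ| < r → 0 < gD g ε w l
  posW : ∀ l ε w, |l| < r → |ε| < r → |w - σ| < r → 0 < gW g ε w l
  negβ : ∀ l ε w, |l| < r → |ε| < r → |w - σ| < r → gβ g ε w l < 0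
  zero : ∀ ε w, |ε| < r → |w - σ| < r → g (0, ε, w) = rlpSlopes ε w
  lt_one : r < 1

theorem exists_isSonicGerm {σ : ℝ} (hσ : 0 < σ) (hσ2 : σ < 1 / 2) :
    ∃ g r, IsSonicGerm σ g r := by
  obtain ⟨g, r, hr, hbase, han, hsl, huniq⟩ := exists_sonic_germ hσ hσ2
  have hcont : ContinuousAt g (0, 0, σ) :=
    (han 0 0 σ (by simpa) (by simpa) (by simpa)).continuousAt
  have h1 : ContinuousAt (fun p : ℝ × ℝ × ℝ => p.2.2 + p.1 * (g p).1) (0, 0, σ) := by fun_prop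
  have h2 : ContinuousAt (fun p : ℝ × ℝ × ℝ => p.2.2 + p.1 * (g p).2.1) (0, 0, σ) := by fun_prop
  have h3 : ContinuousAt (fun p : ℝ × ℝ × ℝ =>
      denSlope p.2.1 p.2.2 p.1 (g p).1 (g p).2.1 (g p).2.2.1) (0, 0, σ) := by
    unfold denSlope; fun_prop
  have e1 := h1.tendsto.eventually_const_lt (u := 0) (by simpa using hσ)
  have e2 := h2.tendsto.eventually_const_lt (u := 0) (by simpa using hσ)
  have e3 := h3.tendsto.eventually_lt_const (u := 0) (by
    simp only [hbase, baseSlopes, denSlope, smul_eq_mul]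
    nlinarith)
  obtain ⟨ρ, hρ, hρ'⟩ := Metric.eventually_nhds_iff.1 (e1.and (e2.and e3))
  obtain ⟨κ, hκ, hκ'⟩ := Metric.eventually_nhds_iff.1
    ((eventually_isSonicSlopes_rlpSlopes hσ hσ2).and
      (Metric.tendsto_nhds.1 (tendsto_rlpSlopes hσ hσ2) r hr))
  set R := min (min r ρ) (min κ (1 / 2)) with hR
  have hR1 : R ≤ r := (min_le_left _ _).trans (min_le_left _ _)
  have hR2 : R ≤ ρ := (min_le_left _ _).trans (min_le_right _ _)
  have hR3 : R ≤ κ := (min_le_right _ _).trans (min_le_left _ _)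
  have hR4 : R ≤ 1 / 2 := (min_le_right _ _).trans (min_le_right _ _)
  have hdist : ∀ l ε w : ℝ, |l| < R → |ε| < R → |w - σ| < R →
      dist ((l, ε, w) : ℝ × ℝ × ℝ) (0, 0, σ) < ρ := by
    intro l ε w h1 h2 h3
    simp only [Prod.dist_eq, Real.dist_eq, sub_zero]
    exact max_lt (h1.trans_le hR2) (max_lt (h2.trans_le hR2) (h3.trans_le hR2))
  have hdist' : ∀ ε w : ℝ, |ε| < R → |w - σ| < R → dist ((ε, w) : ℝ × ℝ) (0, σ) < κ := by
    intro ε w h2 h3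
    simp only [Prod.dist_eq, Real.dist_eq, sub_zero]
    exact max_lt (h2.trans_le hR3) (h3.trans_le hR3)
  refine ⟨g, R, by positivity, hbase,
    fun l ε w h1 h2 h3 => han l ε w (h1.trans_le hR1) (h2.trans_le hR1) (h3.trans_le hR1),
    fun l ε w h1 h2 h3 => hsl l ε w (h1.trans_le hR1) (h2.trans_le hR1) (h3.trans_le hR1),
    fun l ε w u hl h2 h3 hu hu0 => huniq l ε w u hl (h2.trans_le hR1) (h3.trans_le hR1) hu
      (hu0 ▸ (hκ' (hdist' ε w h2 h3)).2),
    fun l ε w h1 h2 h3 => (hρ' (hdist l ε w h1 h2 h3)).1,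
    fun l ε w h1 h2 h3 => (hρ' (hdist l ε w h1 h2 h3)).2.1,
    fun l ε w h1 h2 h3 => (hρ' (hdist l ε w h1 h2 h3)).2.2, fun ε w h2 h3 => ?_,
    by linarith⟩
  obtain ⟨hs, hd⟩ := hκ' (hdist' ε w h2 h3)
  obtain ⟨l', hl', h⟩ := huniq 0 ε w _ le_rfl (h2.trans_le hR1) (h3.trans_le hR1) hs hd
  exact (h 0 ⟨le_rfl, le_rfl⟩ hl'.le).symm

variable {σ r : ℝ} {g : ℝ × ℝ × ℝ → ℝ × ℝ × ℝ × ℝ}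

theorem hasDerivAt_of_integral_eq {v h : ℝ → ℝ} {t c r : ℝ} (ht : |t| < r)
    (hh : ∀ s, |s| < r → ContinuousAt h s)
    (hv : ∀ s, |s| < r → s * v s = ∫ z in (0 : ℝ)..s, h z) :
    HasDerivAt (fun s => c + s * v s) (h t) t := by
  have hop : IsOpen {s : ℝ | |s| < r} := isOpen_lt continuous_abs continuous_const
  have hint : IntervalIntegrable h MeasureTheory.volume 0 t := by
    refine ContinuousOn.intervalIntegrable fun s hs => (hh s ?_).continuousWithinAt
    refine lt_of_le_of_lt ?_ ht
    rcases mem_uIcc.1 hs with h | h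
    · rw [abs_of_nonneg h.1, abs_of_nonneg (h.1.trans h.2)]; exact h.2
    · rw [abs_of_nonpos h.2, abs_of_nonpos (h.1.trans h.2)]; linarith [h.1]
  have hmeas : StronglyMeasurableAtFilter h (𝓝 t) MeasureTheory.volume :=
    ContinuousOn.stronglyMeasurableAtFilter hop (fun s hs => (hh s hs).continuousWithinAt) t ht
  have h1 := (intervalIntegral.integral_hasDerivAt_right hint hmeas (hh t ht)).const_add c
  refine h1.congr_of_eventuallyEq ?_
  filter_upwards [hop.mem_nhds ht] with s hs
  rw [hv s hs]


theorem IsSonicGerm.continuousAt (hg : IsSonicGerm σ g r) {l ε w : ℝ} (hl : |l| < r) (hε : |ε| < r)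
    (hw : |w - σ| < r) :
    ContinuousAt (fun t => g (t, ε, w)) l :=
  ContinuousAt.comp (f := fun t : ℝ => (t, ε, w)) (hg.analytic l ε w hl hε hw).continuousAt
    (by fun_prop)

theorem IsSonicGerm.analyticAt (hg : IsSonicGerm σ g r) {l ε w : ℝ} (hl : |l| < r) (hε : |ε| < r)
    (hw : |w - σ| < r) :
    AnalyticAt ℝ (fun t => g (t, ε, w)) l :=
  AnalyticAt.fun_comp (f := fun t : ℝ => (t, ε, w)) (hg.analytic l ε w hl hε hw)
    (AnalyticAt.prod analyticAt_id (analyticAt_const (v := (ε, w))))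

theorem IsSonicGerm.analyticAt_gD (hg : IsSonicGerm σ g r) {l ε w : ℝ} (hl : |l| < r)
    (hε : |ε| < r) (hw : |w - σ| < r) :
    AnalyticAt ℝ (gD g ε w) l :=
  analyticAt_const.add (analyticAt_id.mul
    (analyticAt_fst.fun_comp (hg.analyticAt hl hε hw)))

theorem IsSonicGerm.analyticAt_gW (hg : IsSonicGerm σ g r) {l ε w : ℝ} (hl : |l| < r)
    (hε : |ε| < r) (hw : |w - σ| < r) :
    AnalyticAt ℝ (gW g ε w) l :=
  analyticAt_const.add (analyticAt_id.mul
    (analyticAt_fst.fun_comp (analyticAt_snd.fun_comp (hg.analyticAt hl hε hw))))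

theorem IsSonicGerm.hasDerivAt_gD (hg : IsSonicGerm σ g r) {l ε w : ℝ} (hl : |l| < r)
    (hε : |ε| < r) (hw : |w - σ| < r) :
    HasDerivAt (gD g ε w) (velD ε (gD g ε w l) (gW g ε w l) (g (l, ε, w)).2.2.2) l := by
  refine hasDerivAt_of_integral_eq
    (h := fun t => velD ε (gD g ε w t) (gW g ε w t) (g (t, ε, w)).2.2.2) hl (fun s hs => ?_)
    fun s hs => (hg.slopes s ε w hs hε hw).eqP s right_mem_uIcc
  have h := hg.continuousAt hs hε hw
  generalize hv : (fun t => g (t, ε, w)) = v at h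
  have e : ∀ t, g (t, ε, w) = v t := fun t => congrFun hv t
  unfold velD gD gW
  simp only [e, smul_eq_mul]
  fun_prop

theorem IsSonicGerm.hasDerivAt_gW (hg : IsSonicGerm σ g r) {l ε w : ℝ} (hl : |l| < r)
    (hε : |ε| < r) (hw : |w - σ| < r) :
    HasDerivAt (gW g ε w) (velW ε (gW g ε w l) (g (l, ε, w)).2.2.2) l := by
  refine hasDerivAt_of_integral_eq
    (h := fun t => velW ε (gW g ε w t) (g (t, ε, w)).2.2.2) hl (fun s hs => ?_)
    fun s hs => (hg.slopes s ε w hs hε hw).eqS s right_mem_uIcc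
  have h := hg.continuousAt hs hε hw
  generalize hv : (fun t => g (t, ε, w)) = v at h
  have e : ∀ t, g (t, ε, w) = v t := fun t => congrFun hv t
  unfold velW gW
  simp only [e, smul_eq_mul]
  fun_prop

theorem IsSonicGerm.hasDerivAt_gE (hg : IsSonicGerm σ g r) {l ε w : ℝ} (hl : |l| < r)
    (hε : |ε| < r) (hw : |w - σ| < r) :
    HasDerivAt (gE g ε w) (velE ε (gW g ε w l) (gE g ε w l) (g (l, ε, w)).2.2.2) l := by
  refine hasDerivAt_of_integral_eq
    (h := fun t => velE ε (gW g ε w t) (gE g ε w t) (g (t, ε, w)).2.2.2) hl (fun s hs => ?_)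
    fun s hs => (hg.slopes s ε w hs hε hw).eqG s right_mem_uIcc
  have h := hg.continuousAt hs hε hw
  generalize hv : (fun t => g (t, ε, w)) = v at h
  have e : ∀ t, g (t, ε, w) = v t := fun t => congrFun hv t
  unfold velE gE gW
  simp only [e, smul_eq_mul]
  fun_prop

theorem IsSonicGerm.sonic_mul (hg : IsSonicGerm σ g r) {l ε w : ℝ} (hl : |l| < r) (hε : |ε| < r)
    (hw : |w - σ| < r) :
    (gE g ε w l - brJ ε (gD g ε w l) (gW g ε w l)) = l * gβ g ε w l ∧
    (gE g ε w l - brJ ε (gD g ε w l) (gW g ε w l)) * (g (l, ε, w)).2.2.2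
      = gD g ε w l - gW g ε w l := by
  have h1 : gE g ε w l - brJ ε (gD g ε w l) (gW g ε w l) = l * gβ g ε w l := by
    rw [gβ, denSlope_mul]; rfl
  refine ⟨h1, ?_⟩
  rw [h1, mul_assoc, gβ, (hg.slopes l ε w hl hε hw).alg l right_mem_uIcc, gD, gW]
  ring

theorem IsSonicGerm.gE_eq (hg : IsSonicGerm σ g r) {l ε w xs : ℝ} (hl : |l| < r) (hε : |ε| < r)
    (hw : |w - σ| < r)
    (hsonic : w ^ (-eta ε) = cH ε w * xs ^ 2) :
    gD g ε w l ^ (-eta ε) = gE g ε w l * (xs * Real.exp l) ^ 2 := by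
  have hε1 : 1 - ε ≠ 0 := by
    have := (abs_lt.1 hε).2; have := hg.lt_one; linarith
  have hd : ∀ t : ℝ, |t| < r → HasDerivAt
      (fun t => gE g ε w t * gD g ε w t ^ eta ε * (xs * Real.exp t) ^ 2) 0 t := by
    intro t ht
    have hD := hg.posD t ε w ht hε hw
    refine (((hg.hasDerivAt_gE ht hε hw).mul ((hg.hasDerivAt_gD ht hε hw).rpow_const
      (p := eta ε) (Or.inl hD.ne'))).mul
      (((Real.hasDerivAt_exp t).const_mul xs).pow 2)).congr_deriv ?_
    have h1 : gD g ε w t ^ eta ε = gD g ε w t ^ (eta ε - 1) * gD g ε w t := by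
      rw [← Real.rpow_add_one hD.ne']; congr 1; ring
    simp only [Pi.mul_apply, Pi.pow_apply]
    rw [h1]
    simp only [velE, velD, smul_eq_mul, mul_one, eta]
    field_simp
    ring
  have h0 : (fun t => gE g ε w t * gD g ε w t ^ eta ε * (xs * Real.exp t) ^ 2) l
      = (fun t => gE g ε w t * gD g ε w t ^ eta ε * (xs * Real.exp t) ^ 2) 0 := by
    have hconv : Convex ℝ {t : ℝ | |t| < r} := by
      have : {t : ℝ | |t| < r} = Metric.ball 0 r := by ext; simp
      rw [this]; exact convex_ball 0 r
    have hop : IsOpen {s : ℝ | |s| < r} := isOpen_lt continuous_abs continuous_const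
    refine hop.is_const_of_deriv_eq_zero hconv.isPreconnected
      (fun t ht => (hd t ht).differentiableAt.differentiableWithinAt)
      (fun t ht => (hd t ht).deriv) hl (by simpa using hg.pos)
  have hw0 : 0 < w := by
    have := hg.posD 0 ε w (by simpa using hg.pos) hε hw
    simpa [gD] using this
  have h1 : gE g ε w l * gD g ε w l ^ eta ε * (xs * Real.exp l) ^ 2 = 1 := by
    simp only at h0
    rw [h0]
    simp only [gE, gD, zero_mul, add_zero, Real.exp_zero, mul_one]
    have : w ^ (-eta ε) * w ^ eta ε = 1 := by
      rw [← Real.rpow_add hw0]; simp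
    rw [hsonic] at this
    linarith
  rw [Real.rpow_neg (hg.posD l ε w hl hε hw).le]
  refine inv_eq_of_mul_eq_one_left ?_
  linarith

end Germ

section XDerivatives

theorem sonicDen_eq {ε x D W E : ℝ} (h : D ^ (-eta ε) = E * x ^ 2) :
    sonicDen ε x D W = x ^ 2 * (E - brJ ε D W) := by
  rw [sonicDen, h, brJ]; ring

theorem rhsD_eq {ε x D W E q : ℝ} (hx : x ≠ 0) (h : D ^ (-eta ε) = E * x ^ 2)
    (hb : E - brJ ε D W ≠ 0) (hq : (E - brJ ε D W) * q = D - W) :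
    rhsD ε x D W = velD ε D W q / x := by
  rw [rhsD, sonicDen_eq h, ← hq, velD]
  simp only [smul_eq_mul, mul_one]
  field_simp

theorem rhsW_eq {ε x D W E q : ℝ} (hx : x ≠ 0) (h : D ^ (-eta ε) = E * x ^ 2)
    (hb : E - brJ ε D W ≠ 0) (hq : (E - brJ ε D W) * q = D - W) :
    rhsW ε x D W = velW ε W q / x := by
  rw [rhsW, sonicDen_eq h, ← hq, velW]
  simp only [smul_eq_mul, mul_one]
  field_simp

variable {σ r : ℝ} {g : ℝ × ℝ × ℝ → ℝ × ℝ × ℝ × ℝ}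

theorem hasDerivAt_log_div {xs x : ℝ} (hxs : 0 < xs) (hx : 0 < x) :
    HasDerivAt (fun x => Real.log (x / xs)) (1 / x) x :=
  (((hasDerivAt_id x).div_const xs).log (by simp only [id]; positivity)).congr_deriv
    (by simp only [id]; field_simp)

/-- The sonic germ solves the Schwarzschild system to the right of the sonic point. -/
theorem IsSonicGerm.solves (hg : IsSonicGerm σ g r) {ε w xs x : ℝ} (hε : |ε| < r)
    (hw : |w - σ| < r) (hxs : 0 < xs) (hsonic : w ^ (-eta ε) = cH ε w * xs ^ 2) (hx : xs < x)
    (hxr : Real.log (x / xs) < r) :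
    sonicDen ε x (gD g ε w (Real.log (x / xs))) (gW g ε w (Real.log (x / xs))) < 0 ∧
    HasDerivAt (fun x => gD g ε w (Real.log (x / xs)))
      (rhsD ε x (gD g ε w (Real.log (x / xs))) (gW g ε w (Real.log (x / xs)))) x ∧
    HasDerivAt (fun x => gW g ε w (Real.log (x / xs)))
      (rhsW ε x (gD g ε w (Real.log (x / xs))) (gW g ε w (Real.log (x / xs)))) x := by
  have hx0 : 0 < x := hxs.trans hx
  have ht0 : 0 < Real.log (x / xs) := Real.log_pos ((one_lt_div hxs).2 hx)
  have ht : |Real.log (x / xs)| < r := by rwa [abs_of_pos ht0]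
  have hE := hg.gE_eq ht hε hw hsonic
  have hexp : xs * Real.exp (Real.log (x / xs)) = x := by
    rw [Real.exp_log (by positivity)]; field_simp
  rw [hexp] at hE
  obtain ⟨h1, h2⟩ := hg.sonic_mul ht hε hw
  have hneg : gE g ε w (Real.log (x / xs)) - brJ ε (gD g ε w (Real.log (x / xs)))
      (gW g ε w (Real.log (x / xs))) < 0 := by
    rw [h1]; exact mul_neg_of_pos_of_neg ht0 (hg.negβ _ ε w ht hε hw)
  refine ⟨?_, ?_, ?_⟩
  · rw [sonicDen_eq hE]
    exact mul_neg_of_pos_of_neg (by positivity) hneg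
  · rw [rhsD_eq hx0.ne' hE hneg.ne h2]
    exact ((hg.hasDerivAt_gD ht hε hw).comp x (hasDerivAt_log_div hxs hx0)).congr_deriv (mul_one_div _ _)
  · rw [rhsW_eq hx0.ne' hE hneg.ne h2]
    exact ((hg.hasDerivAt_gW ht hε hw).comp x (hasDerivAt_log_div hxs hx0)).congr_deriv (mul_one_div _ _)

theorem brJ_self (ε w : ℝ) : brJ ε w w = cH ε w := by unfold brJ cH; ring

theorem IsRLPSolution.sonic {ε xs : ℝ} {D W : ℝ → ℝ} (h : IsRLPSolution ε xs D W) :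
    W xs ^ (-eta ε) = cH ε (W xs) * xs ^ 2 := by
  have h1 := h.sonic_den
  rw [h.sonic_eq, sonicDen] at h1
  have h2 := brJ_self ε (W xs)
  rw [brJ] at h2
  rw [h2] at h1
  linarith

theorem continuousAt_dslope_zero {f : ℝ → ℝ} {t : ℝ} (hf0 : DifferentiableAt ℝ f 0)
    (hf : ContinuousAt f t) : ContinuousAt (dslope f 0) t := by
  rcases eq_or_ne t 0 with rfl | h
  · exact continuousAt_dslope_same.2 hf0
  · exact (continuousAt_dslope_of_ne h).2 hf

theorem eq_add_mul_dslope (f : ℝ → ℝ) (t : ℝ) : f t = f 0 + t * dslope f 0 t := by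
  have := sub_smul_dslope f 0 t
  rw [smul_eq_mul, sub_zero] at this
  linarith

/-- An RLP-type solution coincides with the sonic germ near the sonic point. -/
theorem IsSonicGerm.eq_of_isRLPSolution (hg : IsSonicGerm σ g r) {ε xs : ℝ} {D W : ℝ → ℝ}
    (hxs : 0 < xs) (hε : |ε| < r) (h : IsRLPSolution ε xs D W) (hw : |W xs - σ| < r) :
    ∃ l > 0, ∀ t ∈ Icc 0 l, D (xs * Real.exp t) = gD g ε (W xs) t ∧
      W (xs * Real.exp t) = gW g ε (W xs) t := by
  set w := W xs with hwdef
  have hr := hg.pos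
  have hε1 : 1 - ε ≠ 0 := by
    have := (abs_lt.1 hε).2; have := hg.lt_one; linarith
  have hsonic : w ^ (-eta ε) = cH ε w * xs ^ 2 := h.sonic
  have hw0 : 0 < w := by rw [hwdef, ← h.sonic_eq]; exact h.pos_D xs (mem_Ici.2 le_rfl)
  set D' : ℝ → ℝ := fun t => D (xs * Real.exp t) with hD'
  set W' : ℝ → ℝ := fun t => W (xs * Real.exp t) with hW'
  set E' : ℝ → ℝ := fun t => D' t ^ (-eta ε) / (xs * Real.exp t) ^ 2 with hE'
  have hmem : ∀ t : ℝ, 0 ≤ t → xs * Real.exp t ∈ Ici xs := fun t ht =>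
    le_mul_of_one_le_right hxs.le (Real.one_le_exp ht)
  have hx : ∀ t, HasDerivAt (fun t => xs * Real.exp t) (xs * Real.exp t) t := fun t =>
    (Real.hasDerivAt_exp t).const_mul xs
  have hDd : ∀ t, 0 ≤ t → HasDerivAt D' (deriv D (xs * Real.exp t) * (xs * Real.exp t)) t :=
    fun t ht => ((h.analytic_D _ (hmem t ht)).differentiableAt.hasDerivAt).comp t (hx t)
  have hWd : ∀ t, 0 ≤ t → HasDerivAt W' (deriv W (xs * Real.exp t) * (xs * Real.exp t)) t :=
    fun t ht => ((h.analytic_W _ (hmem t ht)).differentiableAt.hasDerivAt).comp t (hx t)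
  have hDpos : ∀ t, 0 ≤ t → 0 < D' t := fun t ht => h.pos_D _ (hmem t ht)
  have hEd : ∀ t, 0 ≤ t → HasDerivAt E' (E' t * (-eta ε / D' t *
      (deriv D (xs * Real.exp t) * (xs * Real.exp t)) - 2)) t := by
    intro t ht
    have hx0 : xs * Real.exp t ≠ 0 := by positivity
    have hD0 := hDpos t ht
    refine (((hDd t ht).rpow_const (p := -eta ε) (Or.inl hD0.ne')).div
      ((hx t).pow 2) (pow_ne_zero 2 hx0)).congr_deriv ?_
    have h1 : D' t ^ (-eta ε - 1) = D' t ^ (-eta ε) / D' t := Real.rpow_sub_one hD0.ne' _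
    simp only [hE', Pi.pow_apply]
    rw [h1]
    field_simp
    ring
  have hD0 : D' 0 = w := by simp only [hD', Real.exp_zero, mul_one]; exact h.sonic_eq
  have hW0 : W' 0 = w := by simp only [hW', Real.exp_zero, mul_one]; rfl
  have hE0 : E' 0 = cH ε w := by
    simp only [hE', hD0, Real.exp_zero, mul_one]
    rw [hsonic, mul_div_cancel_right₀ _ (pow_ne_zero 2 hxs.ne')]
  set P := dslope D' 0 with hPdef
  set S := dslope W' 0 with hSdef
  set G := dslope E' 0 with hGdef
  have hDP : ∀ t, D' t = w + t * P t := fun t => hD0 ▸ eq_add_mul_dslope D' t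
  have hWS : ∀ t, W' t = w + t * S t := fun t => hW0 ▸ eq_add_mul_dslope W' t
  have hEG : ∀ t, E' t = cH ε w + t * G t := fun t => hE0 ▸ eq_add_mul_dslope E' t
  have hPc : ∀ t, 0 ≤ t → ContinuousAt P t := fun t ht =>
    continuousAt_dslope_zero (hDd 0 le_rfl).differentiableAt (hDd t ht).continuousAt
  have hSc : ∀ t, 0 ≤ t → ContinuousAt S t := fun t ht =>
    continuousAt_dslope_zero (hWd 0 le_rfl).differentiableAt (hWd t ht).continuousAt
  have hGc : ∀ t, 0 ≤ t → ContinuousAt G t := fun t ht =>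
    continuousAt_dslope_zero (hEd 0 le_rfl).differentiableAt (hEd t ht).continuousAt
  set B : ℝ → ℝ := fun t => denSlope ε w t (P t) (S t) (G t) with hBdef
  have hBc : ∀ t, 0 ≤ t → ContinuousAt B t := by
    intro t ht
    have h1 := hPc t ht
    have h2 := hSc t ht
    have h3 := hGc t ht
    simp only [hBdef, denSlope, smul_eq_mul]
    fun_prop
  have hz := hg.zero ε w hε hw
  have hP0 : P 0 = R1RLP ε w := by
    rw [hPdef, dslope_same, (hDd 0 le_rfl).deriv, Real.exp_zero, mul_one, mul_comm, h.slope_D]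
  have hS0 : S 0 = W1RLP ε w := by
    rw [hSdef, dslope_same, (hWd 0 le_rfl).deriv, Real.exp_zero, mul_one, mul_comm, h.slope_W]
  have hG0 : G 0 = -2 * cH ε w - eta ε / w * cH ε w * R1RLP ε w := by
    rw [hGdef, dslope_same, (hEd 0 le_rfl).deriv, Real.exp_zero, mul_one, mul_comm (deriv D xs),
      h.slope_D, hE0, hD0]
    ring
  have hsl0 := hg.slopes 0 ε w (by simpa using hr) hε hw
  have hB0 : B 0 < 0 := by
    have := hg.negβ 0 ε w (by simpa using hr) hε hw
    simp only [gβ, hz, rlpSlopes] at this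
    simpa only [hBdef, hP0, hS0, hG0] using this
  obtain ⟨d, hd, hBd⟩ := Metric.eventually_nhds_iff.1
    ((hBc 0 le_rfl).eventually (gt_mem_nhds hB0))
  set l := d / 2 with hl
  have hl0 : 0 < l := by positivity
  have hBneg : ∀ t ∈ Icc 0 l, B t < 0 := fun t ht => hBd (by
    rw [Real.dist_eq, sub_zero, abs_of_nonneg ht.1]; linarith [ht.2])
  set q : ℝ → ℝ := fun t => (P t - S t) / B t with hqdef
  have hqc : ∀ t ∈ Icc 0 l, ContinuousAt q t := fun t ht =>
    ((hPc t ht.1).sub (hSc t ht.1)).div (hBc t ht.1) (hBneg t ht).ne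
  have hq0 : q 0 = -R1RLP ε w / (2 * (1 - ε) * ca ε w) := by
    have := hsl0.alg 0 left_mem_uIcc
    simp only [hz, rlpSlopes] at this
    simp only [hqdef]
    rw [div_eq_iff hB0.ne]
    simp only [hBdef, hP0, hS0, hG0]
    linarith
  have hb : ∀ t ∈ Ioc 0 l, E' t - brJ ε (D' t) (W' t) ≠ 0 ∧
      (E' t - brJ ε (D' t) (W' t)) * q t = D' t - W' t := by
    intro t ht
    have hB := (hBneg t ⟨ht.1.le, ht.2⟩).ne
    have h1 : E' t - brJ ε (D' t) (W' t) = t * B t := by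
      rw [hBdef, denSlope_mul, hEG, hDP, hWS]
    refine ⟨h1 ▸ mul_ne_zero ht.1.ne' hB, ?_⟩
    rw [h1, hqdef, hDP, hWS]
    field_simp
    ring
  have hEx : ∀ t, D' t ^ (-eta ε) = E' t * (xs * Real.exp t) ^ 2 := by
    intro t
    simp only [hE']
    have : xs * Real.exp t ≠ 0 := by positivity
    field_simp
  have hD1 : ∀ t ∈ Ioc 0 l, HasDerivAt D' (velD ε (D' t) (W' t) (q t)) t := by
    intro t ht
    have hx0 : xs * Real.exp t ≠ 0 := by positivity
    refine (hDd t ht.1.le).congr_deriv ?_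
    rw [(h.eq_D _ (lt_mul_of_one_lt_right hxs (Real.one_lt_exp_iff.2 ht.1))).deriv]
    change rhsD ε _ (D' t) (W' t) * _ = _
    rw [rhsD_eq hx0 (hEx t) (hb t ht).1 (hb t ht).2, div_mul_cancel₀ _ hx0]
  have hW1 : ∀ t ∈ Ioc 0 l, HasDerivAt W' (velW ε (W' t) (q t)) t := by
    intro t ht
    have hx0 : xs * Real.exp t ≠ 0 := by positivity
    refine (hWd t ht.1.le).congr_deriv ?_
    rw [(h.eq_W _ (lt_mul_of_one_lt_right hxs (Real.one_lt_exp_iff.2 ht.1))).deriv]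
    change rhsW ε _ (D' t) (W' t) * _ = _
    rw [rhsW_eq hx0 (hEx t) (hb t ht).1 (hb t ht).2, div_mul_cancel₀ _ hx0]
  have hE1 : ∀ t ∈ Ioc 0 l, HasDerivAt E' (velE ε (W' t) (E' t) (q t)) t := by
    intro t ht
    refine (hEd t ht.1.le).congr_deriv ?_
    rw [← (hDd t ht.1.le).deriv, (hD1 t ht).deriv]
    have := (hDpos t ht.1.le).ne'
    simp only [velD, velE, smul_eq_mul, mul_one, eta]
    field_simp
    ring
  have hint : ∀ (f v F : ℝ → ℝ) (c : ℝ), (∀ t, f t = c + t * F t) →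
      (∀ t ∈ Icc 0 l, ContinuousAt f t) → (∀ t ∈ Icc 0 l, ContinuousAt v t) →
      (∀ t ∈ Ioc 0 l, HasDerivAt f (v t) t) → ∀ t ∈ uIcc 0 l,
        t * F t = ∫ s in (0 : ℝ)..t, v s := by
    intro f v F c hf hfc hvc hfd t ht
    rw [uIcc_of_le hl0.le] at ht
    have hsub : ∀ s ∈ Icc 0 t, s ∈ Icc 0 l := fun s hs => ⟨hs.1, hs.2.trans ht.2⟩
    rw [intervalIntegral.integral_eq_sub_of_hasDerivAt_of_le ht.1
      (fun s hs => (hfc s (hsub s hs)).continuousWithinAt)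
      (fun s hs => hfd s ⟨hs.1, hs.2.le.trans ht.2⟩)
      (ContinuousOn.intervalIntegrable fun s hs => (hvc s (hsub s
        (by rwa [uIcc_of_le ht.1] at hs))).continuousWithinAt), hf t, hf 0]
    ring
  have hDc : ∀ t ∈ Icc 0 l, ContinuousAt D' t := fun t ht => (hDd t ht.1).continuousAt
  have hWc : ∀ t ∈ Icc 0 l, ContinuousAt W' t := fun t ht => (hWd t ht.1).continuousAt
  have hEc : ∀ t ∈ Icc 0 l, ContinuousAt E' t := fun t ht => (hEd t ht.1).continuousAt
  have hu0 : (P 0, S 0, G 0, q 0) = rlpSlopes ε w := by rw [hP0, hS0, hG0, hq0]; rfl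
  have hu : IsSonicSlopes ε w l (fun t => (P t, S t, G t, q t)) := by
    refine ⟨fun t ht => ?_, ?_, ?_, ?_, fun t ht => ?_, ?_, ?_, ?_⟩
    · rw [uIcc_of_le hl0.le] at ht
      exact ((hPc t ht.1).prodMk ((hSc t ht.1).prodMk
        ((hGc t ht.1).prodMk (hqc t ht)))).continuousWithinAt
    · simp only [← hDP, ← hWS]
      refine hint D' _ P w hDP hDc (fun t ht => ?_) hD1
      have h1 := hDc t ht
      have h2 := hWc t ht
      have h3 := hqc t ht
      simp only [velD, smul_eq_mul]
      fun_prop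
    · simp only [← hWS]
      refine hint W' _ S w hWS hWc (fun t ht => ?_) hW1
      have h2 := hWc t ht
      have h3 := hqc t ht
      simp only [velW, smul_eq_mul]
      fun_prop
    · simp only [← hWS, ← hEG]
      refine hint E' _ G (cH ε w) hEG hEc (fun t ht => ?_) hE1
      have h1 := hEc t ht
      have h2 := hWc t ht
      have h3 := hqc t ht
      simp only [velE, smul_eq_mul]
      fun_prop
    · rw [uIcc_of_le hl0.le] at ht
      simp only [hqdef]
      exact mul_div_cancel₀ _ (hBneg t ht).ne
    · have := hsl0.initP
      rw [hz, ← hu0] at this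
      exact this
    · have := hsl0.initS
      rw [hz, ← hu0] at this
      exact this
    · have := hsl0.initG
      rw [hz, ← hu0] at this
      exact this
  obtain ⟨l', hl', huniq⟩ := hg.unique l ε w _ hl0.le hε hw hu hu0
  refine ⟨min l l', lt_min hl0 hl', fun t ht => ?_⟩
  have := huniq t ⟨ht.1, ht.2.trans (min_le_left _ _)⟩ (ht.2.trans (min_le_right _ _))
  constructor
  · change D' t = _
    rw [hDP, gD, ← this]
  · change W' t = _
    rw [hWS, gW, ← this]

end XDerivatives

section Conversion

theorem mul_numΔ_add_denX (ε X Δ Ω : ℝ) : X * numΔ ε X Δ Ω + denX ε X Δ Ω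
    = (1 + ε) * ((1 + Ω * X + ε) * (Δ * X ^ 2 - (1 + Ω * X))) := by
  unfold numΔ denX brJ; ring

theorem mul_numΩ_add_denX (ε X Δ Ω : ℝ) :
    -((1 - ε) * (Ω * X) * denX ε X Δ Ω + X ^ 2 * numΩ ε X Δ Ω)
    = (1 + ε) * (1 - 3 * (1 + Ω * X)) * denX ε X Δ Ω
      + 2 * (1 + ε) ^ 2 * ((1 + Ω * X) * (1 + Ω * X + ε) * (Δ * X ^ 2 - (1 + Ω * X))) := by
  unfold numΩ denX brJ; ring

/-- The variable `X` of a point `x`. -/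
def toX (ε x : ℝ) : ℝ := x ^ (-(1 / (1 + eta ε)))

theorem one_add_eta {ε : ℝ} (hε : ε < 1) : 1 + eta ε = (1 + ε) / (1 - ε) := by
  have : 1 - ε ≠ 0 := by linarith
  unfold eta; field_simp; ring

theorem one_add_eta_pos {ε : ℝ} (hε0 : 0 < ε) (hε : ε < 1) : 0 < 1 + eta ε := by
  rw [one_add_eta hε]
  have : 0 < 1 - ε := by linarith
  positivity

variable {ε : ℝ}

theorem toX_pos (ε : ℝ) {x : ℝ} (hx : 0 < x) : 0 < toX ε x := Real.rpow_pos_of_pos hx _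

theorem toX_rpow (hε0 : 0 < ε) (hε : ε < 1) {x : ℝ} (hx : 0 < x) :
    toX ε x ^ (-(1 + eta ε)) = x := by
  have := one_add_eta_pos hε0 hε
  rw [toX, ← Real.rpow_mul hx.le]
  have h : -(1 / (1 + eta ε)) * -(1 + eta ε) = 1 := by field_simp
  rw [h, Real.rpow_one]

theorem toX_of_rpow (hε0 : 0 < ε) (hε : ε < 1) {X : ℝ} (hX : 0 < X) :
    toX ε (X ^ (-(1 + eta ε))) = X := by
  have := one_add_eta_pos hε0 hε
  rw [toX, ← Real.rpow_mul hX.le]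
  have h : -(1 + eta ε) * -(1 / (1 + eta ε)) = 1 := by field_simp
  rw [h, Real.rpow_one]

theorem toX_lt (hε0 : 0 < ε) (hε : ε < 1) {x x' : ℝ} (hx : 0 < x) (h : x < x') :
    toX ε x' < toX ε x := by
  have := one_add_eta_pos hε0 hε
  exact Real.rpow_lt_rpow_of_neg hx h (by rw [neg_lt_zero]; positivity)

theorem hasDerivAt_toX (hε : ε < 1) {x : ℝ} (hx : 0 < x) :
    HasDerivAt (toX ε) (-((1 - ε) / (1 + ε)) * toX ε x / x) x := by
  refine (Real.hasDerivAt_rpow_const (p := -(1 / (1 + eta ε))) (Or.inl hx.ne')).congr_deriv ?_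
  rw [Real.rpow_sub_one hx.ne', ← toX, one_add_eta hε, one_div_div]
  ring

theorem analyticAt_rpow_const {x : ℝ} (p : ℝ) (hx : x ≠ 0) :
    AnalyticAt ℝ (fun x : ℝ => x ^ p) x :=
  ContDiffAt.analyticAt (Real.contDiffAt_rpow_const_of_ne hx)

theorem rpow_eta_toX (hε0 : 0 < ε) (hε : ε < 1) {x Δ : ℝ} (hx : 0 < x) (hΔ : 0 < Δ) :
    (Δ * toX ε x ^ 2) ^ (-eta ε) = Δ ^ (-eta ε) * toX ε x ^ 2 * x ^ 2 := by
  have hX := toX_pos ε hx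
  have h1 : x ^ 2 = toX ε x ^ (-(2 + 2 * eta ε)) := by
    conv_lhs => rw [← toX_rpow hε0 hε hx]
    rw [← Real.rpow_natCast, ← Real.rpow_mul hX.le]
    congr 1; push_cast; ring
  rw [Real.mul_rpow hΔ.le (by positivity), h1, mul_assoc, ← Real.rpow_natCast,
    ← Real.rpow_mul hX.le, ← Real.rpow_add hX]
  congr 2; push_cast; ring

/-- Solutions of the `X`-system solve the Schwarzschild system. -/
theorem solves_of_rates (hε0 : 0 < ε) (hε : ε < 1) {Δ Ω : ℝ → ℝ} {x : ℝ} (hx : 0 < x)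
    (hΔ : HasDerivAt Δ (rateΔ ε (toX ε x) (Δ (toX ε x)) (Ω (toX ε x))) (toX ε x))
    (hΩ : HasDerivAt Ω (rateΩ ε (toX ε x) (Δ (toX ε x)) (Ω (toX ε x))) (toX ε x))
    (hpos : 0 < Δ (toX ε x)) (hden : denX ε (toX ε x) (Δ (toX ε x)) (Ω (toX ε x)) < 0) :
    sonicDen ε x (Δ (toX ε x) * toX ε x ^ 2) (1 + Ω (toX ε x) * toX ε x) < 0 ∧
    HasDerivAt (fun x => Δ (toX ε x) * toX ε x ^ 2)
      (rhsD ε x (Δ (toX ε x) * toX ε x ^ 2) (1 + Ω (toX ε x) * toX ε x)) x ∧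
    HasDerivAt (fun x => 1 + Ω (toX ε x) * toX ε x)
      (rhsW ε x (Δ (toX ε x) * toX ε x ^ 2) (1 + Ω (toX ε x) * toX ε x)) x := by
  have hX := toX_pos ε hx
  have hXd := hasDerivAt_toX hε hx
  have hE := rpow_eta_toX hε0 hε hx hpos
  set X := toX ε x with hXdef
  set Δ' := Δ X
  set Ω' := Ω X
  have hb : Δ' ^ (-eta ε) * X ^ 2 - brJ ε (Δ' * X ^ 2) (1 + Ω' * X) = denX ε X Δ' Ω' := rfl
  have h1 := mul_numΔ_add_denX ε X Δ' Ω'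
  have h2 := mul_numΩ_add_denX ε X Δ' Ω'
  have hne : denX ε X Δ' Ω' ≠ 0 := hden.ne
  have hε1 : 1 - ε ≠ 0 := by linarith
  have hε2 : 1 + ε ≠ 0 := by linarith
  have hq : (Δ' ^ (-eta ε) * X ^ 2 - brJ ε (Δ' * X ^ 2) (1 + Ω' * X)) *
      ((Δ' * X ^ 2 - (1 + Ω' * X)) / denX ε X Δ' Ω') = Δ' * X ^ 2 - (1 + Ω' * X) := by
    rw [hb, mul_div_cancel₀ _ hne]
  refine ⟨?_, ?_, ?_⟩
  · rw [sonicDen_eq hE, hb]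
    exact mul_neg_of_pos_of_neg (by positivity) hden
  · rw [rhsD_eq hx.ne' hE (hb ▸ hne) hq]
    refine ((hΔ.comp x hXd).mul (hXd.pow 2)).congr_deriv ?_
    simp only [velD, smul_eq_mul, mul_one, rateΔ, Function.comp_apply, Pi.pow_apply, ← hXdef]
    change 2 * Δ' * numΔ ε X Δ' Ω' / denX ε X Δ' Ω' * _ * _ + Δ' * _ = _
    field_simp
    linear_combination (-2 * X) * h1
  · rw [rhsW_eq hx.ne' hE (hb ▸ hne) hq]
    refine (((hΩ.comp x hXd).mul hXd).const_add 1).congr_deriv ?_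
    simp only [velW, smul_eq_mul, mul_one, rateΩ, Function.comp_apply, ← hXdef]
    change numΩ ε X Δ' Ω' / ((1 - ε) * denX ε X Δ' Ω') * _ * _ + Ω' * _ = _
    field_simp
    linear_combination h2

/-- The Schwarzschild system as an autonomous field on `(x, D, W)`. -/
def fieldS (ε : ℝ) (z : ℝ × ℝ × ℝ) : ℝ × ℝ × ℝ :=
  (1, rhsD ε z.1 z.2.1 z.2.2, rhsW ε z.1 z.2.1 z.2.2)

theorem contDiffAt_fieldS {n : WithTop ℕ∞} {z : ℝ × ℝ × ℝ} (hx : z.1 ≠ 0) (hD : 0 < z.2.1)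
    (hden : sonicDen ε z.1 z.2.1 z.2.2 ≠ 0) : ContDiffAt ℝ n (fieldS ε) z := by
  have h1 : ContDiffAt ℝ n (fun z : ℝ × ℝ × ℝ => z.2.1 ^ (-eta ε)) z :=
    ContDiffAt.rpow (by fun_prop) contDiffAt_const hD.ne'
  have h2 : ContDiffAt ℝ n (fun z : ℝ × ℝ × ℝ => sonicDen ε z.1 z.2.1 z.2.2) z := by
    unfold sonicDen; fun_prop
  unfold fieldS rhsD rhsW
  refine contDiffAt_const.prodMk (ContDiffAt.prodMk (ContDiffAt.neg ?_) (ContDiffAt.add ?_ ?_))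
  · exact ContDiffAt.div (by fun_prop) h2 hden
  · exact ContDiffAt.div (by fun_prop) (by fun_prop) hx
  · exact ContDiffAt.div (by fun_prop) h2 hden

theorem hasDerivAt_fieldS {D W : ℝ → ℝ} {x : ℝ} (hD : HasDerivAt D (rhsD ε x (D x) (W x)) x)
    (hW : HasDerivAt W (rhsW ε x (D x) (W x)) x) :
    HasDerivAt (fun x => (x, D x, W x)) (fieldS ε (x, D x, W x)) x :=
  (hasDerivAt_id x).prodMk (hD.prodMk hW)

/-- Solutions of the Schwarzschild system are analytic. -/
theorem analyticAt_of_solves {D W : ℝ → ℝ} {x : ℝ} (hx : x ≠ 0) (hpos : 0 < D x)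
    (hden : sonicDen ε x (D x) (W x) ≠ 0)
    (h : ∀ᶠ z in 𝓝 x, HasDerivAt D (rhsD ε z (D z) (W z)) z ∧
      HasDerivAt W (rhsW ε z (D z) (W z)) z) : AnalyticAt ℝ D x ∧ AnalyticAt ℝ W x := by
  have h1 : AnalyticAt ℝ (fun x => (x, D x, W x)) x :=
    analyticAt_of_hasDerivAt (contDiffAt_fieldS (z := (x, D x, W x)) hx hpos hden).analyticAt
      (h.mono fun z hz => hasDerivAt_fieldS hz.1 hz.2)
  exact ⟨analyticAt_fst.fun_comp (analyticAt_snd.fun_comp h1),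
    analyticAt_snd.fun_comp (analyticAt_snd.fun_comp h1)⟩

/-- Solutions of the Schwarzschild system with equal values at a point agree near it. -/
theorem eventuallyEq_of_solves {D W D' W' : ℝ → ℝ} {x : ℝ} (hx : x ≠ 0) (hpos : 0 < D x)
    (hden : sonicDen ε x (D x) (W x) ≠ 0)
    (h : ∀ᶠ z in 𝓝 x, HasDerivAt D (rhsD ε z (D z) (W z)) z ∧
      HasDerivAt W (rhsW ε z (D z) (W z)) z)
    (h' : ∀ᶠ z in 𝓝 x, HasDerivAt D' (rhsD ε z (D' z) (W' z)) z ∧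
      HasDerivAt W' (rhsW ε z (D' z) (W' z)) z) (hD : D x = D' x) (hW : W x = W' x) :
    D =ᶠ[𝓝 x] D' ∧ W =ᶠ[𝓝 x] W' := by
  have := eventuallyEq_of_hasDerivAt (γ := fun x => (x, D x, W x))
    (γ' := fun x => (x, D' x, W' x)) (t₀ := x)
    (contDiffAt_fieldS (n := 1) (z := (x, D x, W x)) hx hpos hden)
    (h.mono fun z hz => hasDerivAt_fieldS hz.1 hz.2)
    (h'.mono fun z hz => hasDerivAt_fieldS hz.1 hz.2) (by rw [hD, hW])
  exact ⟨this.mono fun z hz => congrArg (fun p : ℝ × ℝ × ℝ => p.2.1) hz,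
    this.mono fun z hz => congrArg (fun p : ℝ × ℝ × ℝ => p.2.2) hz⟩

end Conversion

section Continuation

/-- An RLP-type solution together with its regular continuation `(Δ, Ω)` through `X = 0`. -/
structure IsContinuation (ε xs κ : ℝ) (D W Δ Ω : ℝ → ℝ) : Prop where
  rlp : IsRLPSolution ε xs D W
  posW : ∀ x ∈ Ici xs, 0 < W x
  lt_toX : κ < toX ε xs
  eq_D : ∀ x, 0 < x → toX ε x ≤ κ → D x = Δ (toX ε x) * toX ε x ^ 2
  eq_W : ∀ x, 0 < x → toX ε x ≤ κ → W x = 1 + Ω (toX ε x) * toX ε x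
  eqΔ : ∀ X ∈ Icc (-κ) κ, HasDerivAt Δ (rateΔ ε X (Δ X) (Ω X)) X
  eqΩ : ∀ X ∈ Icc (-κ) κ, HasDerivAt Ω (rateΩ ε X (Δ X) (Ω X)) X
  ltΔ : ∀ X ∈ Icc (-κ) κ, 3 / 2 < Δ X
  Δlt : ∀ X ∈ Icc (-κ) κ, Δ X < 1 / κ
  ltΩ : ∀ X ∈ Icc (-κ) κ, -(1 / κ) < Ω X
  Ωlt : ∀ X ∈ Icc (-κ) κ, Ω X < -1 / 2
  posWX : ∀ X ∈ Icc (-κ) κ, 0 < 1 + Ω X * X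
  den : ∀ X ∈ Icc (-κ) κ, denX ε X (Δ X) (Ω X) < 0

theorem IsContinuation.mono {ε xs κ κ' : ℝ} {D W Δ Ω : ℝ → ℝ}
    (h : IsContinuation ε xs κ D W Δ Ω) (hκ' : 0 < κ') (hle : κ' ≤ κ) :
    IsContinuation ε xs κ' D W Δ Ω := by
  have hsub : ∀ X ∈ Icc (-κ') κ', X ∈ Icc (-κ) κ := fun X hX =>
    ⟨by linarith [hX.1], hX.2.trans hle⟩
  have hinv : 1 / κ ≤ 1 / κ' := one_div_le_one_div_of_le hκ' hle
  exact ⟨h.rlp, h.posW, hle.trans_lt h.lt_toX, fun x hx hX => h.eq_D x hx (hX.trans hle),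
    fun x hx hX => h.eq_W x hx (hX.trans hle), fun X hX => h.eqΔ X (hsub X hX),
    fun X hX => h.eqΩ X (hsub X hX), fun X hX => h.ltΔ X (hsub X hX),
    fun X hX => (h.Δlt X (hsub X hX)).trans_le hinv,
    fun X hX => by linarith [h.ltΩ X (hsub X hX)], fun X hX => h.Ωlt X (hsub X hX),
    fun X hX => h.posWX X (hsub X hX), fun X hX => h.den X (hsub X hX)⟩

variable {σ r : ℝ} {g : ℝ × ℝ × ℝ → ℝ × ℝ × ℝ × ℝ}

/-- RLP-type solutions with the same sonic values agree. -/
theorem IsSonicGerm.eqOn_of_isRLPSolution (hg : IsSonicGerm σ g r) {ε xs : ℝ}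
    {D W D' W' : ℝ → ℝ} (hxs : 0 < xs) (hε : |ε| < r) (h : IsRLPSolution ε xs D W)
    (h' : IsRLPSolution ε xs D' W') (hw : |W xs - σ| < r) (heq : W' xs = W xs) :
    EqOn D' D (Ici xs) ∧ EqOn W' W (Ici xs) := by
  obtain ⟨l, hl, hl1⟩ := hg.eq_of_isRLPSolution hxs hε h hw
  obtain ⟨l', hl', hl2⟩ := hg.eq_of_isRLPSolution hxs hε h' (by rwa [heq])
  rw [heq] at hl2
  have hm : 0 < min l l' := lt_min hl hl'
  have hev : ∀ᶠ x in 𝓝[>] xs, D' x = D x ∧ W' x = W x := by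
    have : Ioo xs (xs * Real.exp (min l l')) ∈ 𝓝[>] xs :=
      Ioo_mem_nhdsGT (lt_mul_of_one_lt_right hxs (Real.one_lt_exp_iff.2 hm))
    filter_upwards [this] with x hx
    have hx0 : 0 < x := hxs.trans hx.1
    have ht0 : 0 ≤ Real.log (x / xs) := Real.log_nonneg ((one_le_div hxs).2 hx.1.le)
    have ht1 : Real.log (x / xs) ≤ min l l' := by
      rw [Real.log_le_iff_le_exp (by positivity), div_le_iff₀ hxs, mul_comm]
      exact hx.2.le
    have hexp : xs * Real.exp (Real.log (x / xs)) = x := by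
      rw [Real.exp_log (by positivity)]; field_simp
    have e1 := hl1 _ ⟨ht0, ht1.trans (min_le_left _ _)⟩
    have e2 := hl2 _ ⟨ht0, ht1.trans (min_le_right _ _)⟩
    rw [hexp] at e1 e2
    exact ⟨e2.1.trans e1.1.symm, e2.2.trans e1.2.symm⟩
  have hle : 𝓝[>] xs ≤ 𝓝[≠] xs := nhdsWithin_mono _ fun x hx => ne_of_gt hx
  have hfr : ∃ᶠ x in 𝓝[≠] xs, D' x = D x ∧ W' x = W x := hev.frequently.filter_mono hle
  exact ⟨h'.analytic_D.eqOn_of_preconnected_of_frequently_eq h.analytic_D isPreconnected_Ici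
      (mem_Ici.2 le_rfl) (hfr.mono fun x hx => hx.1),
    h'.analytic_W.eqOn_of_preconnected_of_frequently_eq h.analytic_W isPreconnected_Ici
      (mem_Ici.2 le_rfl) (hfr.mono fun x hx => hx.2)⟩

/-- The germ of the Newtonian solution has data from which the `X`-flow exists. -/
theorem IsSonicGerm.exists_newton_data (hg : IsSonicGerm σ g r) (hσ : 1 / 3 ≤ σ)
    (hσ2 : σ < 1 / 2) :
    ∃ t ∈ Ioo 0 r, 0 < gE g 0 σ t ∧ ∃ M τ δ : ℝ, 0 < τ ∧ 0 < δ ∧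
      ∀ y, dist y (√(gE g 0 σ t), gD g 0 σ t / √(gE g 0 σ t) ^ 2,
        (gW g 0 σ t - 1) / √(gE g 0 σ t), 0) < δ → ∃ β : ℝ → ℝ × ℝ × ℝ × ℝ, β 0 = y ∧
      (∀ t' ∈ Icc 0 (√(gE g 0 σ t) + τ), HasDerivAt β (fieldX (β t')) t' ∧ β t' ∈ regionX M) ∧
      ∀ᶠ t' in 𝓝 0, HasDerivAt β (fieldX (β t')) t' := by
  have hr := hg.pos
  have hσ0 : 0 < σ := by linarith
  have h00 : |(0 : ℝ)| < r := by simpa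
  have hσσ : |σ - σ| < r := by simpa
  have hc : ContinuousAt (fun t => g (t, 0, σ)) 0 := hg.continuousAt h00 h00 hσσ
  have hb := hg.base
  generalize hv : (fun t => g (t, 0, σ)) = v at hc
  have hv' : ∀ t, g (t, 0, σ) = v t := fun t => congrFun hv t
  rw [hv'] at hb
  have hS : ContinuousAt (fun t => (v t).2.1) 0 := by fun_prop
  have hWc : ContinuousAt (fun t => gW g 0 σ t) 0 := by
    simp only [gW, hv']; fun_prop
  have hDc : ContinuousAt (fun t => gD g 0 σ t) 0 := by
    simp only [gD, hv']; fun_prop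
  have hEc : ContinuousAt (fun t => gE g 0 σ t) 0 := by
    simp only [gE, hv']; fun_prop
  have hqc : ContinuousAt (fun t => (v t).2.2.2) 0 := by fun_prop
  have hW0 : gW g 0 σ 0 = σ := by simp [gW]
  have hD0 : gD g 0 σ 0 = σ := by simp [gD]
  have hE0 : gE g 0 σ 0 = σ ^ 2 := by simp [gE, cH]
  have hsq : √(σ ^ 2) = σ := Real.sqrt_sq hσ0.le
  have hsc : ContinuousAt (fun t => √(gE g 0 σ t)) 0 := hEc.sqrt
  have hs0 : √(gE g 0 σ 0) = σ := by rw [hE0, hsq]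
  have ev : ∀ (f : ℝ → ℝ) (a : ℝ), ContinuousAt f 0 → a < f 0 → ∀ᶠ t in 𝓝 0, a < f t :=
    fun f a hf ha => hf.eventually (lt_mem_nhds ha)
  have e1 := ev (fun t => (v t).2.1) 0 hS (by simp only [hb, baseSlopes]; linarith)
  have e2 := ev (fun t => gE g 0 σ t) 0 hEc (by simp only [hE0]; positivity)
  have e3 := ev (fun t => 1 - gW g 0 σ t * (v t).2.2.2) 0 (by fun_prop) (by
    simp only [hW0, hb, baseSlopes]; field_simp; norm_num)
  have e4 := ev (fun t => 1 - gW g 0 σ t - 2 * gW g 0 σ t * (1 - gW g 0 σ t * (v t).2.2.2)) 0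
    (by fun_prop) (by
      simp only [hW0, hb, baseSlopes]
      have : 1 - σ - 2 * σ * (1 - σ * (1 / (2 * σ))) = 1 - 2 * σ := by field_simp; ring
      linarith)
  have e5 := ev (fun t => gD g 0 σ t / √(gE g 0 σ t) ^ 2) (3 / 2)
    (hDc.div (hsc.pow 2) (by change √(gE g 0 σ 0) ^ 2 ≠ 0; rw [hs0]; positivity)) (by
      simp only [hD0, hs0]
      rw [lt_div_iff₀ (by positivity)]
      nlinarith)
  have e6 := ev (fun t => -((gW g 0 σ t - 1) / √(gE g 0 σ t))) (1 / 2)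
    ((hWc.sub continuousAt_const).div hsc (by rw [hs0]; positivity)).neg (by
      simp only [hW0, hs0]
      rw [← neg_div, lt_div_iff₀ hσ0]
      linarith)
  have hev := (e1.and (e2.and (e3.and (e4.and (e5.and e6))))).filter_mono
    (nhdsWithin_le_nhds (s := Ioi 0))
  obtain ⟨t, ⟨h1, h2, h3, h4, h5, h6⟩, ht⟩ := (hev.and (Ioo_mem_nhdsGT hr)).exists
  refine ⟨t, ht, h2, ?_⟩
  have htr : |t| < r := by rw [abs_of_pos ht.1]; exact ht.2
  have hX := Real.sqrt_pos.2 h2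
  have hXsq := Real.sq_sqrt h2.le
  set X := √(gE g 0 σ t)
  have hW1 : 1 + (gW g 0 σ t - 1) / X * X = gW g 0 σ t := by field_simp; ring
  have hWσ : σ < gW g 0 σ t := by
    rw [gW, hv']; linarith [mul_pos ht.1 h1]
  obtain ⟨hm1, hm2⟩ := hg.sonic_mul htr h00 hσσ
  have hJ : brJ 0 (gD g 0 σ t) (gW g 0 σ t) = gW g 0 σ t ^ 2 := by simp [brJ]
  rw [hJ, ← hXsq] at hm1 hm2
  have hden : X ^ 2 - gW g 0 σ t ^ 2 < 0 := by
    rw [hm1]; exact mul_neg_of_pos_of_neg ht.1 (hg.negβ t 0 σ htr h00 hσσ)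
  have hWpos := hg.posW t 0 σ htr h00 hσσ
  have hR : gD g 0 σ t / X ^ 2 * gW g 0 σ t - 1
      = (gW g 0 σ t ^ 2 - X ^ 2) * (1 - gW g 0 σ t * (v t).2.2.2) / X ^ 2 := by
    rw [hv'] at hm2
    field_simp
    linear_combination -(gW g 0 σ t) * hm2
  refine exists_flow_near hX (by rw [hW1]; linarith) ?_ ?_ ?_ h5 (by linarith)
  · rw [hW1]
    exact lt_of_pow_lt_pow_left₀ 2 hWpos.le (by linarith)
  · rw [hW1, ← sub_pos, hR]
    have : 0 < gW g 0 σ t ^ 2 - X ^ 2 := by linarith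
    positivity
  · rw [hW1, hR]
    have hne : gW g 0 σ t ^ 2 - X ^ 2 ≠ 0 := by linarith
    have : -((gW g 0 σ t - 1) / X) - 2 * X * gW g 0 σ t *
        ((gW g 0 σ t ^ 2 - X ^ 2) * (1 - gW g 0 σ t * (v t).2.2.2) / X ^ 2 /
          (gW g 0 σ t ^ 2 - X ^ 2))
        = (1 - gW g 0 σ t - 2 * gW g 0 σ t * (1 - gW g 0 σ t * (v t).2.2.2)) / X := by
      field_simp
      ring
    rw [this]
    exact div_pos h4 hX

end Continuation

section Existence

variable {σ r : ℝ} {g : ℝ × ℝ × ℝ → ℝ × ℝ × ℝ × ℝ}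

theorem fieldX_components_near {γ : ℝ → ℝ × ℝ × ℝ × ℝ}
    (hγ : ∀ᶠ s in 𝓝 0, HasDerivAt γ (fieldX (γ s)) s) :
    ∀ᶠ s in 𝓝 0, (γ s).1 = (γ 0).1 - s ∧ (γ s).2.2.2 = (γ 0).2.2.2 := by
  obtain ⟨ρ, hρ, h⟩ := Metric.eventually_nhds_iff_ball.1 hγ
  have h0 : (0 : ℝ) ∈ Metric.ball (0 : ℝ) ρ := Metric.mem_ball_self hρ
  have hpre := (convex_ball (0 : ℝ) ρ).isPreconnected
  have hd1 : ∀ s ∈ Metric.ball (0 : ℝ) ρ, HasDerivAt (fun s => (γ s).1 + s) 0 s := fun s hs =>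
    ((hasDerivAt_fst (h s hs)).add (hasDerivAt_id s)).congr_deriv (by simp [fieldX])
  have hd2 : ∀ s ∈ Metric.ball (0 : ℝ) ρ, HasDerivAt (fun s => (γ s).2.2.2) 0 s := fun s hs =>
    hasDerivAt_snd (hasDerivAt_snd (hasDerivAt_snd (h s hs)))
  filter_upwards [Metric.ball_mem_nhds (0 : ℝ) hρ] with s hs
  have e1 := Metric.isOpen_ball.is_const_of_deriv_eq_zero hpre
    (fun t ht => (hd1 t ht).differentiableAt.differentiableWithinAt)
    (fun t ht => (hd1 t ht).deriv) hs h0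
  have e2 := Metric.isOpen_ball.is_const_of_deriv_eq_zero hpre
    (fun t ht => (hd2 t ht).differentiableAt.differentiableWithinAt)
    (fun t ht => (hd2 t ht).deriv) hs h0
  exact ⟨by linarith, e2⟩

/-- Near the initial point a trajectory solves the `X`-system on both sides. -/
theorem rates_near {M : ℝ} {γ : ℝ → ℝ × ℝ × ℝ × ℝ}
    (hγ : ∀ᶠ s in 𝓝 0, HasDerivAt γ (fieldX (γ s)) s) (h0 : γ 0 ∈ regionX M) :
    ∀ᶠ X in 𝓝 (γ 0).1,
      HasDerivAt (fun X => (γ ((γ 0).1 - X)).2.1)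
        (rateΔ (γ 0).2.2.2 X (γ ((γ 0).1 - X)).2.1 (γ ((γ 0).1 - X)).2.2.1) X ∧
      HasDerivAt (fun X => (γ ((γ 0).1 - X)).2.2.1)
        (rateΩ (γ 0).2.2.2 X (γ ((γ 0).1 - X)).2.1 (γ ((γ 0).1 - X)).2.2.1) X ∧
      0 < (γ ((γ 0).1 - X)).2.1 ∧
      denX (γ 0).2.2.2 X (γ ((γ 0).1 - X)).2.1 (γ ((γ 0).1 - X)).2.2.1 < 0 := by
  have hlim : Tendsto (fun X => (γ 0).1 - X) (𝓝 (γ 0).1) (𝓝 0) := by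
    have : ContinuousAt (fun X => (γ 0).1 - X) (γ 0).1 := by fun_prop
    simpa using this.tendsto
  have hreg := hγ.self_of_nhds.continuousAt.eventually ((isOpen_regionX M).mem_nhds h0)
  filter_upwards [hlim.eventually (hγ.and ((fieldX_components_near hγ).and hreg))]
    with X ⟨hX, ⟨h1, h2⟩, h3⟩
  have h1' : (γ ((γ 0).1 - X)).1 = X := by rw [h1]; ring
  have h4 := hX.scomp X ((hasDerivAt_id X).const_sub (γ 0).1)
  simp only [fieldX, h1', h2, Function.comp_def] at h4
  have h5 := h3.2.2.2.2.2
  rw [h1', h2] at h5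
  exact ⟨(hasDerivAt_fst (hasDerivAt_snd h4)).congr_deriv (by simp),
    (hasDerivAt_fst (hasDerivAt_snd (hasDerivAt_snd h4))).congr_deriv (by simp),
    by linarith [h3.1.1], h5⟩

/-- The state of the germ at time `t`, in the variables of the `X`-system. -/
def germState (g : ℝ × ℝ × ℝ → ℝ × ℝ × ℝ × ℝ) (t : ℝ) (p : ℝ × ℝ) : ℝ × ℝ × ℝ × ℝ :=
  let X := (gE g p.1 p.2 t * gD g p.1 p.2 t ^ eta p.1) ^ (1 / (2 * (1 + eta p.1)))
  (X, gD g p.1 p.2 t / X ^ 2, (gW g p.1 p.2 t - 1) / X, p.1)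

theorem germState_zero (g : ℝ × ℝ × ℝ → ℝ × ℝ × ℝ × ℝ) (σ t : ℝ) :
    germState g t (0, σ) = (√(gE g 0 σ t), gD g 0 σ t / √(gE g 0 σ t) ^ 2,
        (gW g 0 σ t - 1) / √(gE g 0 σ t), 0) := by
  have h : (gE g 0 σ t * gD g 0 σ t ^ eta 0) ^ (1 / (2 * (1 + eta 0))) = √(gE g 0 σ t) := by
    rw [eta_zero, Real.rpow_zero, mul_one, Real.sqrt_eq_rpow]; norm_num
  simp only [germState, h]

theorem IsSonicGerm.continuousAt_germState (hg : IsSonicGerm σ g r) {t : ℝ} (ht : |t| < r)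
    (hE : 0 < gE g 0 σ t) : ContinuousAt (germState g t) (0, σ) := by
  have h00 : |(0 : ℝ)| < r := by simpa using hg.pos
  have hσσ : |σ - σ| < r := by simpa using hg.pos
  have hc : ContinuousAt (fun p : ℝ × ℝ => g (t, p.1, p.2)) (0, σ) :=
    ContinuousAt.comp (f := fun p : ℝ × ℝ => (t, p.1, p.2))
      (hg.analytic t 0 σ ht h00 hσσ).continuousAt (by fun_prop)
  generalize hv : (fun p : ℝ × ℝ => g (t, p.1, p.2)) = v at hc
  have hv' : ∀ p : ℝ × ℝ, g (t, p.1, p.2) = v p := fun p => congrFun hv p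
  have hη : ContinuousAt (fun p : ℝ × ℝ => eta p.1) (0, σ) := by
    unfold eta
    exact ContinuousAt.div (by fun_prop) (by fun_prop) (by simp)
  have hWc : ContinuousAt (fun p : ℝ × ℝ => gW g p.1 p.2 t) (0, σ) := by
    simp only [gW, hv']; fun_prop
  have hDc : ContinuousAt (fun p : ℝ × ℝ => gD g p.1 p.2 t) (0, σ) := by
    simp only [gD, hv']; fun_prop
  have hEc : ContinuousAt (fun p : ℝ × ℝ => gE g p.1 p.2 t) (0, σ) := by
    simp only [gE, hv', cH]; fun_prop
  have hD := hg.posD t 0 σ ht h00 hσσ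
  have hX : ContinuousAt (fun p : ℝ × ℝ =>
      (gE g p.1 p.2 t * gD g p.1 p.2 t ^ eta p.1) ^ (1 / (2 * (1 + eta p.1)))) (0, σ) := by
    refine ContinuousAt.rpow (hEc.mul (hDc.rpow hη (Or.inl hD.ne'))) (ContinuousAt.div
      continuousAt_const (by fun_prop) (by simp [eta_zero])) (Or.inl ?_)
    positivity
  have hX0 : (gE g 0 σ t * gD g 0 σ t ^ eta 0) ^ (1 / (2 * (1 + eta 0))) ≠ 0 := by positivity
  unfold germState
  exact hX.prodMk ((hDc.div (hX.pow 2) (pow_ne_zero 2 hX0)).prodMk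
    (((hWc.sub continuousAt_const).div hX hX0).prodMk continuousAt_fst))

theorem IsSonicGerm.toX_eq (hg : IsSonicGerm σ g r) {t ε w xs : ℝ} (ht : |t| < r) (hε0 : 0 < ε)
    (hε : |ε| < r) (hw : |w - σ| < r) (hxs : 0 < xs)
    (hsonic : w ^ (-eta ε) = cH ε w * xs ^ 2) :
    toX ε (xs * Real.exp t) = (germState g t (ε, w)).1 := by
  have hε1 : ε < 1 := (le_abs_self ε).trans_lt (hε.trans hg.lt_one)
  have hη := one_add_eta_pos hε0 hε1
  have h := hg.gE_eq ht hε hw hsonic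
  have hD := hg.posD t ε w ht hε hw
  have hx : 0 < xs * Real.exp t := by positivity
  have h1 : gE g ε w t * gD g ε w t ^ eta ε = (xs * Real.exp t) ^ (-2 : ℝ) := by
    have h2 : gE g ε w t = gD g ε w t ^ (-eta ε) / (xs * Real.exp t) ^ 2 := by
      rw [h]; field_simp
    rw [h2, Real.rpow_neg hD.le, Real.rpow_neg hx.le, Real.rpow_two]
    have := Real.rpow_pos_of_pos hD (eta ε)
    field_simp
  simp only [germState, h1]
  rw [toX, ← Real.rpow_mul hx.le]
  congr 1
  field_simp

theorem ite_lt_eventuallyEq_left {f h : ℝ → ℝ} {a x : ℝ} (hx : x ≤ a) (hfh : f =ᶠ[𝓝 a] h) :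
    (fun z => if z < a then f z else h z) =ᶠ[𝓝 x] f := by
  rcases lt_or_eq_of_le hx with hx | rfl
  · filter_upwards [gt_mem_nhds hx] with z hz
    exact if_pos hz
  · filter_upwards [hfh] with z hz
    split_ifs
    exacts [rfl, hz.symm]

theorem ite_lt_eventuallyEq_right {f h : ℝ → ℝ} {a x : ℝ} (hx : a ≤ x) (hfh : f =ᶠ[𝓝 a] h) :
    (fun z => if z < a then f z else h z) =ᶠ[𝓝 x] h := by
  rcases lt_or_eq_of_le hx with hx | rfl
  · filter_upwards [lt_mem_nhds hx] with z hz
    exact if_neg (not_lt.2 (le_of_lt hz))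
  · filter_upwards [hfh] with z hz
    split_ifs
    exacts [hz, rfl]

/-- Gluing the sonic germ with a solution of the `X`-system gives an RLP-type solution. -/
theorem IsSonicGerm.isRLPSolution_glue (hg : IsSonicGerm σ g r) {ε w xs t₁ : ℝ} {D₂ W₂ : ℝ → ℝ}
    (hε : |ε| < r) (hw : |w - σ| < r) (hxs : 0 < xs)
    (hsonic : w ^ (-eta ε) = cH ε w * xs ^ 2) (ht₁ : t₁ ∈ Ioo 0 r)
    (hsol : ∀ x, xs * Real.exp t₁ ≤ x → sonicDen ε x (D₂ x) (W₂ x) < 0 ∧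
      HasDerivAt D₂ (rhsD ε x (D₂ x) (W₂ x)) x ∧ HasDerivAt W₂ (rhsW ε x (D₂ x) (W₂ x)) x)
    (hnear : ∀ᶠ x in 𝓝 (xs * Real.exp t₁), HasDerivAt D₂ (rhsD ε x (D₂ x) (W₂ x)) x ∧
      HasDerivAt W₂ (rhsW ε x (D₂ x) (W₂ x)) x)
    (hposD : ∀ x, xs * Real.exp t₁ ≤ x → 0 < D₂ x)
    (hposW : ∀ x, xs * Real.exp t₁ ≤ x → 0 < W₂ x)
    (hD : D₂ (xs * Real.exp t₁) = gD g ε w t₁) (hW : W₂ (xs * Real.exp t₁) = gW g ε w t₁) :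
    ∃ D W : ℝ → ℝ, IsRLPSolution ε xs D W ∧ (∀ x ∈ Ici xs, 0 < W x) ∧ W xs = w ∧
      ∀ x, xs * Real.exp t₁ ≤ x → D x = D₂ x ∧ W x = W₂ x := by
  set x₁ := xs * Real.exp t₁ with hx₁
  have hr := hg.pos
  have hxs1 : xs < x₁ := lt_mul_of_one_lt_right hxs (Real.one_lt_exp_iff.2 ht₁.1)
  have hx10 : 0 < x₁ := hxs.trans hxs1
  have hlog1 : Real.log (x₁ / xs) = t₁ := by
    rw [hx₁, mul_div_cancel_left₀ _ hxs.ne', Real.log_exp]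
  set D₁ : ℝ → ℝ := fun x => gD g ε w (Real.log (x / xs)) with hD₁
  set W₁ : ℝ → ℝ := fun x => gW g ε w (Real.log (x / xs)) with hW₁
  have hlog : ∀ x, xs ≤ x → x ≤ x₁ → |Real.log (x / xs)| < r := by
    intro x h1 h2
    rw [abs_of_nonneg (Real.log_nonneg ((one_le_div hxs).2 h1))]
    refine lt_of_le_of_lt ?_ ht₁.2
    rw [← hlog1]
    have : 0 < x / xs := div_pos (hxs.trans_le h1) hxs
    gcongr
  have hsolG : ∀ x, xs < x → Real.log (x / xs) < r → sonicDen ε x (D₁ x) (W₁ x) < 0 ∧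
      HasDerivAt D₁ (rhsD ε x (D₁ x) (W₁ x)) x ∧ HasDerivAt W₁ (rhsW ε x (D₁ x) (W₁ x)) x :=
    fun x h1 h2 => hg.solves hε hw hxs hsonic h1 h2
  have hD1 : D₁ x₁ = D₂ x₁ := by rw [hD]; simp only [hD₁, hlog1]
  have hW1 : W₁ x₁ = W₂ x₁ := by rw [hW]; simp only [hW₁, hlog1]
  have hlogc : ContinuousAt (fun x => Real.log (x / xs)) x₁ :=
    (hasDerivAt_log_div hxs hx10).continuousAt
  have hnearG : ∀ᶠ x in 𝓝 x₁, HasDerivAt D₁ (rhsD ε x (D₁ x) (W₁ x)) x ∧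
      HasDerivAt W₁ (rhsW ε x (D₁ x) (W₁ x)) x := by
    filter_upwards [lt_mem_nhds hxs1,
      hlogc.eventually (gt_mem_nhds (show Real.log (x₁ / xs) < r by rw [hlog1]; exact ht₁.2))]
      with x h1 h2
    exact (hsolG x h1 h2).2
  obtain ⟨hDeq, hWeq⟩ := eventuallyEq_of_solves hx10.ne' (hD1 ▸ hposD x₁ le_rfl)
    (hsolG x₁ hxs1 (by rw [hlog1]; exact ht₁.2)).1.ne hnearG hnear hD1 hW1
  set D : ℝ → ℝ := fun z => if z < x₁ then D₁ z else D₂ z with hDdef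
  set W : ℝ → ℝ := fun z => if z < x₁ then W₁ z else W₂ z with hWdef
  have hDl : ∀ x ≤ x₁, D =ᶠ[𝓝 x] D₁ := fun x hx => ite_lt_eventuallyEq_left hx hDeq
  have hWl : ∀ x ≤ x₁, W =ᶠ[𝓝 x] W₁ := fun x hx => ite_lt_eventuallyEq_left hx hWeq
  have hDr : ∀ x, x₁ ≤ x → D =ᶠ[𝓝 x] D₂ := fun x hx => ite_lt_eventuallyEq_right hx hDeq
  have hWr : ∀ x, x₁ ≤ x → W =ᶠ[𝓝 x] W₂ := fun x hx => ite_lt_eventuallyEq_right hx hWeq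
  have hsolves : ∀ x, xs < x → sonicDen ε x (D x) (W x) < 0 ∧
      HasDerivAt D (rhsD ε x (D x) (W x)) x ∧ HasDerivAt W (rhsW ε x (D x) (W x)) x := by
    intro x hx
    rcases le_total x x₁ with h | h
    · obtain ⟨h1, h2, h3⟩ := hsolG x hx (lt_of_abs_lt (hlog x hx.le h))
      rw [(hDl x h).eq_of_nhds, (hWl x h).eq_of_nhds]
      exact ⟨h1, h2.congr_of_eventuallyEq (hDl x h), h3.congr_of_eventuallyEq (hWl x h)⟩
    · obtain ⟨h1, h2, h3⟩ := hsol x h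
      rw [(hDr x h).eq_of_nhds, (hWr x h).eq_of_nhds]
      exact ⟨h1, h2.congr_of_eventuallyEq (hDr x h), h3.congr_of_eventuallyEq (hWr x h)⟩
  have hDpos : ∀ x ∈ Ici xs, 0 < D x := by
    intro x hx
    rcases le_total x x₁ with h | h
    · rw [(hDl x h).eq_of_nhds]
      exact hg.posD _ ε w (hlog x hx h) hε hw
    · rw [(hDr x h).eq_of_nhds]; exact hposD x h
  have hWpos : ∀ x ∈ Ici xs, 0 < W x := by
    intro x hx
    rcases le_total x x₁ with h | h
    · rw [(hWl x h).eq_of_nhds]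
      exact hg.posW _ ε w (hlog x hx h) hε hw
    · rw [(hWr x h).eq_of_nhds]; exact hposW x h
  have h00 : |(0 : ℝ)| < r := by simpa
  have hlog0 : Real.log (xs / xs) = 0 := by rw [div_self hxs.ne', Real.log_one]
  have hDxs : D xs = w := by
    rw [(hDl xs hxs1.le).eq_of_nhds]; simp only [hD₁, hlog0, gD, zero_mul, add_zero]
  have hWxs : W xs = w := by
    rw [(hWl xs hxs1.le).eq_of_nhds]; simp only [hW₁, hlog0, gW, zero_mul, add_zero]
  have hz := hg.zero ε w hε hw
  have hsl0 := hg.slopes 0 ε w h00 hε hw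
  have hana : ∀ x ∈ Ici xs, AnalyticAt ℝ D x ∧ AnalyticAt ℝ W x := by
    intro x hx
    have hx0 : 0 < x := hxs.trans_le hx
    rcases eq_or_lt_of_le (mem_Ici.1 hx) with rfl | hlt
    · have h1 : AnalyticAt ℝ (fun x => Real.log (x / xs)) xs :=
        AnalyticAt.log (analyticAt_id.div analyticAt_const hxs.ne') (by
          positivity)
      have h2 := hg.analyticAt_gD (l := Real.log (xs / xs)) (by rw [hlog0]; exact h00) hε hw
      have h3 := hg.analyticAt_gW (l := Real.log (xs / xs)) (by rw [hlog0]; exact h00) hε hw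
      exact ⟨(AnalyticAt.fun_comp (f := fun x => Real.log (x / xs)) h2 h1).congr (hDl xs hxs1.le).symm,
        (AnalyticAt.fun_comp (f := fun x => Real.log (x / xs)) h3 h1).congr (hWl xs hxs1.le).symm⟩
    · refine analyticAt_of_solves hx0.ne' (hDpos x hx) (hsolves x hlt).1.ne ?_
      filter_upwards [lt_mem_nhds hlt] with z hz
      exact (hsolves z hz).2
  refine ⟨D, W, ⟨fun x hx => (hana x hx).1, fun x hx => (hana x hx).2, hDpos,
    hDxs.trans hWxs.symm, ?_, ?_, ?_, fun x hx => (hsolves x hx).1.ne,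
    fun x hx => (hsolves x hx).2.1, fun x hx => (hsolves x hx).2.2⟩, hWpos, hWxs,
    fun x hx => ⟨(hDr x hx).eq_of_nhds, (hWr x hx).eq_of_nhds⟩⟩
  · rw [hDxs, hWxs, sonicDen, hsonic]
    have := brJ_self ε w
    rw [brJ] at this
    rw [this]; ring
  · have h1 := hg.hasDerivAt_gW (l := Real.log (xs / xs)) (by rw [hlog0]; exact h00) hε hw
    have h2 := (h1.comp xs (hasDerivAt_log_div hxs hxs)).congr_of_eventuallyEq (hWl xs hxs1.le)
    have h3 := hsl0.initS
    rw [h2.deriv, hWxs, hlog0]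
    simp only [gW, zero_mul, add_zero]
    rw [← h3, hz]
    simp only [rlpSlopes]
    field_simp
  · have h1 := hg.hasDerivAt_gD (l := Real.log (xs / xs)) (by rw [hlog0]; exact h00) hε hw
    have h2 := (h1.comp xs (hasDerivAt_log_div hxs hxs)).congr_of_eventuallyEq (hDl xs hxs1.le)
    have h3 := hsl0.initP
    rw [h2.deriv, hWxs, hlog0]
    simp only [gD, gW, zero_mul, add_zero]
    rw [← h3, hz]
    simp only [rlpSlopes]
    field_simp

/-- Near each Newtonian solution there are RLP-type solutions with a regular continuation. -/
theorem exists_continuation (hσ : 1 / 3 ≤ σ) (hσ2 : σ < 1 / 2) :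
    ∃ κ > 0, ∀ ε w xs : ℝ, 0 < ε → ε < κ → |w - σ| < κ → 0 < xs →
      w ^ (-eta ε) = cH ε w * xs ^ 2 →
      ∃ D W Δ Ω : ℝ → ℝ, IsContinuation ε xs κ D W Δ Ω ∧ W xs = w ∧
        ∀ D' W' : ℝ → ℝ, IsRLPSolution ε xs D' W' → W' xs = w →
          EqOn D' D (Ici xs) ∧ EqOn W' W (Ici xs) := by
  obtain ⟨g, r, hg⟩ := exists_isSonicGerm (by linarith : 0 < σ) hσ2
  obtain ⟨t₁, ht₁, hE, M, τ, δ, hτ, hδ, hflow⟩ := hg.exists_newton_data hσ hσ2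
  have ht₁r : |t₁| < r := by rw [abs_of_pos ht₁.1]; exact ht₁.2
  have hr := hg.pos
  rw [← germState_zero] at hflow
  set X₁ := √(gE g 0 σ t₁) with hX₁
  have hX₁0 : 0 < X₁ := Real.sqrt_pos.2 hE
  obtain ⟨κ₀, hκ₀, hκ₀'⟩ := Metric.eventually_nhds_iff.1 (Metric.tendsto_nhds.1
    (hg.continuousAt_germState ht₁r hE).tendsto (min δ (min (τ / 2) (X₁ / 2))) (by positivity))
  set κ := min (min κ₀ r) (min (min (τ / 2) (X₁ / 4)) (1 / (|M| + 1))) with hκ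
  have hk1 : κ ≤ κ₀ := (min_le_left _ _).trans (min_le_left _ _)
  have hk2 : κ ≤ r := (min_le_left _ _).trans (min_le_right _ _)
  have hk3 : κ ≤ τ / 2 := (min_le_right _ _).trans ((min_le_left _ _).trans (min_le_left _ _))
  have hk4 : κ ≤ X₁ / 4 := (min_le_right _ _).trans ((min_le_left _ _).trans (min_le_right _ _))
  have hk5 : κ ≤ 1 / (|M| + 1) := (min_le_right _ _).trans (min_le_right _ _)
  have hκpos : 0 < κ := by positivity
  have hM : M < 1 / κ := by
    rw [lt_div_iff₀ hκpos]
    rw [le_div_iff₀ (by positivity)] at hk5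
    nlinarith [le_abs_self M]
  refine ⟨κ, hκpos, fun ε w xs hε0 hεκ hwκ hxs hsonic => ?_⟩
  have hε : |ε| < r := by rw [abs_of_pos hε0]; exact hεκ.trans_le hk2
  have hε1 : ε < 1 := (le_abs_self ε).trans_lt (hε.trans hg.lt_one)
  have hw : |w - σ| < r := hwκ.trans_le hk2
  have hdist := hκ₀' (show dist (ε, w) (0, σ) < κ₀ by
    simp only [Prod.dist_eq, Real.dist_eq, sub_zero]
    exact max_lt (by rw [abs_of_pos hε0]; exact hεκ.trans_le hk1) (hwκ.trans_le hk1))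
  obtain ⟨β, hβ0, hβ, hβn⟩ := hflow _ (hdist.trans_le (min_le_left _ _))
  have hXeq := hg.toX_eq ht₁r hε0 hε hw hxs hsonic
  set x₁ := xs * Real.exp t₁ with hx₁
  have hx₁0 : 0 < x₁ := by positivity
  set Xa := toX ε x₁ with hXa
  have hXa0 : 0 < Xa := toX_pos ε hx₁0
  have hβ1 : (β 0).1 = Xa := by rw [hβ0, ← hXeq]
  have hβ4 : (β 0).2.2.2 = ε := by rw [hβ0]; rfl
  have hclose : |Xa - X₁| < min (τ / 2) (X₁ / 2) := by
    have h1 : dist (germState g t₁ (ε, w)).1 (germState g t₁ (0, σ)).1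
        ≤ dist (germState g t₁ (ε, w)) (germState g t₁ (0, σ)) := le_max_left _ _
    have h2 := h1.trans_lt (hdist.trans_le (min_le_right _ _))
    rwa [germState_zero, ← hXeq, Real.dist_eq] at h2
  obtain ⟨hc1, hc2⟩ := abs_lt.1 (hclose.trans_le (min_le_left _ _))
  obtain ⟨hc3, hc4⟩ := abs_lt.1 (hclose.trans_le (min_le_right _ _))
  have hβd : ∀ s ∈ Icc 0 (X₁ + τ), HasDerivAt β (fieldX (β s)) s := fun s hs => (hβ s hs).1
  set Δ : ℝ → ℝ := fun X => (β (Xa - X)).2.1 with hΔ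
  set Ω : ℝ → ℝ := fun X => (β (Xa - X)).2.2.1 with hΩ
  have hrate : ∀ X ∈ Icc (-κ) Xa, HasDerivAt Δ (rateΔ ε X (Δ X) (Ω X)) X ∧
      HasDerivAt Ω (rateΩ ε X (Δ X) (Ω X)) X := by
    intro X hX
    have := hasDerivAt_of_fieldX hβd (X := X)
      (by rw [hβ1]; exact ⟨by linarith [hX.1], hX.2⟩)
    rwa [hβ1, hβ4] at this
  have hreg : ∀ X ∈ Icc (-κ) Xa, 3 / 2 < Δ X ∧ Δ X < M ∧ -M < Ω X ∧ Ω X < -1 / 2 ∧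
      0 < 1 + Ω X * X ∧ denX ε X (Δ X) (Ω X) < 0 := by
    intro X hX
    have hs : Xa - X ∈ Icc 0 (X₁ + τ) := ⟨by linarith [hX.2], by linarith [hX.1]⟩
    obtain ⟨h1, h2⟩ := fieldX_components hβd hs
    have h3 := (hβ _ hs).2
    have h1' : (β (Xa - X)).1 = X := by rw [h1, hβ1]; ring
    simp only [regionX, mem_ofPred_eq, h1', h2, hβ4] at h3
    exact ⟨h3.1.1, h3.2⟩
  have hnear : ∀ᶠ X in 𝓝 Xa, HasDerivAt Δ (rateΔ ε X (Δ X) (Ω X)) X ∧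
      HasDerivAt Ω (rateΩ ε X (Δ X) (Ω X)) X ∧ 0 < Δ X ∧ denX ε X (Δ X) (Ω X) < 0 := by
    have := rates_near hβn (hβ 0 ⟨le_rfl, by linarith⟩).2
    rwa [hβ1, hβ4] at this
  have hmem : ∀ x, x₁ ≤ x → toX ε x ∈ Icc (-κ) Xa := by
    intro x hx
    have h0 := toX_pos ε (hx₁0.trans_le hx)
    refine ⟨by linarith, ?_⟩
    rcases eq_or_lt_of_le hx with h | h
    · rw [← h]
    · exact (toX_lt hε0 hε1 hx₁0 h).le
  have hDa : Δ Xa * Xa ^ 2 = gD g ε w t₁ := by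
    simp only [hΔ, sub_self, hβ0]
    rw [hXeq] at hXa0 ⊢
    simp only [germState] at hXa0 ⊢
    field_simp
  have hWa : 1 + Ω Xa * Xa = gW g ε w t₁ := by
    simp only [hΩ, sub_self, hβ0]
    rw [hXeq] at hXa0 ⊢
    simp only [germState] at hXa0 ⊢
    field_simp
    ring
  clear_value Δ Ω
  have hsol : ∀ x, x₁ ≤ x →
      sonicDen ε x (Δ (toX ε x) * toX ε x ^ 2) (1 + Ω (toX ε x) * toX ε x) < 0 ∧
      HasDerivAt (fun x => Δ (toX ε x) * toX ε x ^ 2)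
        (rhsD ε x (Δ (toX ε x) * toX ε x ^ 2) (1 + Ω (toX ε x) * toX ε x)) x ∧
      HasDerivAt (fun x => 1 + Ω (toX ε x) * toX ε x)
        (rhsW ε x (Δ (toX ε x) * toX ε x ^ 2) (1 + Ω (toX ε x) * toX ε x)) x := by
    intro x hx
    obtain ⟨h1, h2⟩ := hrate _ (hmem x hx)
    obtain ⟨h3, -, -, -, -, h4⟩ := hreg _ (hmem x hx)
    exact solves_of_rates hε0 hε1 (hx₁0.trans_le hx) h1 h2 (by linarith) h4
  have hsolnear : ∀ᶠ x in 𝓝 x₁,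
      HasDerivAt (fun x => Δ (toX ε x) * toX ε x ^ 2)
        (rhsD ε x (Δ (toX ε x) * toX ε x ^ 2) (1 + Ω (toX ε x) * toX ε x)) x ∧
      HasDerivAt (fun x => 1 + Ω (toX ε x) * toX ε x)
        (rhsW ε x (Δ (toX ε x) * toX ε x ^ 2) (1 + Ω (toX ε x) * toX ε x)) x := by
    have hcont : Tendsto (toX ε) (𝓝 x₁) (𝓝 Xa) :=
      (hasDerivAt_toX hε1 hx₁0).continuousAt.tendsto
    refine ((hcont.eventually hnear).and (lt_mem_nhds hx₁0)).mono fun x hx => ?_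
    obtain ⟨⟨h1, h2, h3, h4⟩, h5⟩ := hx
    exact (solves_of_rates hε0 hε1 h5 h1 h2 h3 h4).2
  have hposD : ∀ x, x₁ ≤ x → 0 < Δ (toX ε x) * toX ε x ^ 2 := by
    intro x hx
    have h1 := (hreg _ (hmem x hx)).1
    have h2 := toX_pos ε (hx₁0.trans_le hx)
    have : 0 < Δ (toX ε x) := by linarith
    positivity
  clear_value Xa x₁ κ X₁
  subst hx₁
  obtain ⟨D, W, hrlp, hWpos, hWxs, heq⟩ := hg.isRLPSolution_glue hε hw hxs hsonic ht₁
    (D₂ := fun x => Δ (toX ε x) * toX ε x ^ 2) (W₂ := fun x => 1 + Ω (toX ε x) * toX ε x)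
    hsol hsolnear hposD (fun x hx => (hreg _ (hmem x hx)).2.2.2.2.1)
    (by rw [← hXa]; exact hDa) (by rw [← hXa]; exact hWa)
  have hκXa : κ < Xa := by linarith
  have hx₁le : ∀ x, 0 < x → toX ε x ≤ κ → xs * Real.exp t₁ ≤ x := by
    intro x hx hX
    by_contra! h
    have := toX_lt hε0 hε1 hx h
    rw [← hXa] at this
    linarith
  have hsub : ∀ X ∈ Icc (-κ) κ, X ∈ Icc (-κ) Xa := fun X hX => ⟨hX.1, hX.2.trans hκXa.le⟩
  refine ⟨D, W, Δ, Ω, ⟨hrlp, hWpos, ?_, fun x hx hX => (heq x (hx₁le x hx hX)).1,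
    fun x hx hX => (heq x (hx₁le x hx hX)).2, fun X hX => (hrate X (hsub X hX)).1,
    fun X hX => (hrate X (hsub X hX)).2, fun X hX => (hreg X (hsub X hX)).1,
    fun X hX => (hreg X (hsub X hX)).2.1.trans hM,
    fun X hX => by linarith [(hreg X (hsub X hX)).2.2.1],
    fun X hX => (hreg X (hsub X hX)).2.2.2.1, fun X hX => (hreg X (hsub X hX)).2.2.2.2.1,
    fun X hX => (hreg X (hsub X hX)).2.2.2.2.2⟩, hWxs, fun D' W' h' hw' => ?_⟩
  · have := toX_lt hε0 hε1 hxs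
      (lt_mul_of_one_lt_right hxs (Real.one_lt_exp_iff.2 ht₁.1))
    rw [← hXa] at this
    exact hκXa.trans this
  · exact hg.eqOn_of_isRLPSolution hxs hε hrlp h' (by rw [hWxs]; exact hw) (hw'.trans hWxs.symm)

end Existence

section Window

theorem cH_lt_cH {ε w w' : ℝ} (hε : 0 < ε) (hw : 0 < w) (h : w < w') :
    cH ε w < cH ε w' := by
  have h1 : w ^ 2 < w' ^ 2 := by gcongr
  unfold cH
  nlinarith [mul_pos hε (sub_pos.2 h), mul_pos hε (sub_pos.2 h1)]

theorem eta_pos {ε : ℝ} (hε : 0 < ε) (hε1 : ε < 1) : 0 < eta ε :=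
  div_pos (by linarith) (by linarith)

/-- The sonic condition determines the common value of `D` and `W` at the sonic point. -/
theorem sonic_value_unique {ε xs w w' : ℝ} (hε : 0 < ε) (hε1 : ε < 1) (hxs : 0 < xs)
    (hw : 0 < w) (hw' : 0 < w') (h : w ^ (-eta ε) = cH ε w * xs ^ 2)
    (h' : w' ^ (-eta ε) = cH ε w' * xs ^ 2) : w = w' := by
  have key : ∀ a b : ℝ, 0 < a → a < b → a ^ (-eta ε) = cH ε a * xs ^ 2 →
      b ^ (-eta ε) = cH ε b * xs ^ 2 → False := by
    intro a b ha hab h1 h2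
    have h3 := Real.rpow_lt_rpow_of_neg ha hab (neg_neg_of_pos (eta_pos hε hε1))
    have h4 := mul_lt_mul_of_pos_right (cH_lt_cH hε ha hab) (pow_pos hxs 2)
    linarith
  rcases lt_trichotomy w w' with hlt | heq | hlt
  · exact (key w w' hw hlt h h').elim
  · exact heq
  · exact (key w' w hw' hlt h' h).elim

theorem cH_third (ε : ℝ) : cH ε (1 / 3) = (1 / 3 + ε) ^ 2 := by
  unfold cH; ring

theorem continuous_cH (ε : ℝ) : Continuous (cH ε) := by
  unfold cH; fun_prop

theorem exists_sonic_value {ε xs s : ℝ} (hε : 0 < ε) (hs : 1 / 3 ≤ s) (hxs0 : 0 < xs)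
    (hxs : xs ≤ xMax ε) (h : s ^ (-eta ε) ≤ cH ε s * xs ^ 2) :
    ∃ w ∈ Icc (1 / 3) s, w ^ (-eta ε) = cH ε w * xs ^ 2 := by
  have hcont : ContinuousOn (fun w => cH ε w * xs ^ 2 - w ^ (-eta ε)) (Icc (1 / 3) s) := by
    refine ((continuous_cH ε).continuousOn.mul continuousOn_const).sub
      (continuousOn_id.rpow_const fun w hw => Or.inl ?_)
    have : (0 : ℝ) < w := by linarith [hw.1]
    exact this.ne'
  have h0 : cH ε (1 / 3) * xs ^ 2 - (1 / 3 : ℝ) ^ (-eta ε) ≤ 0 := by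
    have h1 := sonicDen_xMax hε
    have h2 : (1 / 3 : ℝ) ^ (-eta ε) = cH ε (1 / 3) * xMax ε ^ 2 := by
      unfold sonicDen at h1
      unfold cH
      linarith
    rw [h2, cH_third]
    have : xs ^ 2 ≤ xMax ε ^ 2 := by gcongr
    nlinarith [sq_nonneg (1 / 3 + ε)]
  obtain ⟨w, hw, hw'⟩ := intermediate_value_Icc hs hcont (show (0 : ℝ) ∈ _ from
    ⟨h0, by simpa using h⟩)
  exact ⟨w, hw, (sub_eq_zero.1 hw').symm⟩

theorem eventually_sonic_value_le {s a : ℝ} (hs : 0 < s) (h : 1 < s * a) (ha : 0 < a) :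
    ∀ᶠ ε in 𝓝 (0 : ℝ), ∀ x, a ≤ x → s ^ (-eta ε) ≤ cH ε s * x ^ 2 := by
  have h1 : ContinuousAt (fun ε => cH ε s * a ^ 2 - s ^ (-eta ε)) 0 := by
    have : ContinuousAt (fun ε : ℝ => -eta ε) 0 := by
      unfold eta
      refine (ContinuousAt.div (by fun_prop) (by fun_prop) (by norm_num)).neg
    refine ContinuousAt.sub ?_ (continuousAt_const.rpow this (Or.inl hs.ne'))
    unfold cH
    fun_prop
  have h2 : 0 < cH 0 s * a ^ 2 - s ^ (-eta 0) := by
    rw [eta_zero]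
    simp only [cH, neg_zero, Real.rpow_zero]
    nlinarith [mul_pos hs ha]
  have h3 : ∀ᶠ ε in 𝓝 (0 : ℝ), 0 < cH ε s := by
    have : ContinuousAt (fun ε => cH ε s) 0 := by unfold cH; fun_prop
    refine this.eventually (lt_mem_nhds ?_)
    simp only [cH]
    nlinarith
  filter_upwards [h1.eventually (lt_mem_nhds h2), h3] with ε h4 h5 x hx
  have : a ^ 2 ≤ x ^ 2 := by gcongr
  nlinarith

/-- Uniform version of `exists_continuation` on a compact interval of sonic values. -/
theorem exists_continuation_uniform {s : ℝ} (hs2 : s < 1 / 2) :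
    ∃ κ > 0, ∀ ε w xs : ℝ, w ∈ Icc (1 / 3) s → 0 < ε → ε < κ → 0 < xs →
      w ^ (-eta ε) = cH ε w * xs ^ 2 → ∃ D W Δ Ω, IsContinuation ε xs κ D W Δ Ω ∧ W xs = w ∧
        ∀ D' W', IsRLPSolution ε xs D' W' → W' xs = w →
          EqOn D' D (Ici xs) ∧ EqOn W' W (Ici xs) := by
  refine isCompact_Icc.induction_on (p := fun S => ∃ κ > 0, ∀ ε w xs : ℝ, w ∈ S → 0 < ε → ε < κ →
      0 < xs → w ^ (-eta ε) = cH ε w * xs ^ 2 → ∃ D W Δ Ω, IsContinuation ε xs κ D W Δ Ω ∧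
        W xs = w ∧ ∀ D' W', IsRLPSolution ε xs D' W' → W' xs = w →
          EqOn D' D (Ici xs) ∧ EqOn W' W (Ici xs)) ?_ ?_ ?_ ?_
  · exact ⟨1, one_pos, fun ε w xs hw => hw.elim⟩
  · rintro S T hST ⟨κ, hκ, h⟩
    exact ⟨κ, hκ, fun ε w xs hw => h ε w xs (hST hw)⟩
  · rintro S T ⟨κ, hκ, h⟩ ⟨κ', hκ', h'⟩
    refine ⟨min κ κ', lt_min hκ hκ', fun ε w xs hw hε hεκ hxs hsonic => ?_⟩
    rcases hw with hw | hw
    · obtain ⟨D, W, Δ, Ω, hc, hr⟩ := h ε w xs hw hε (hεκ.trans_le (min_le_left _ _)) hxs hsonic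
      exact ⟨D, W, Δ, Ω, hc.mono (lt_min hκ hκ') (min_le_left _ _), hr⟩
    · obtain ⟨D, W, Δ, Ω, hc, hr⟩ := h' ε w xs hw hε (hεκ.trans_le (min_le_right _ _)) hxs hsonic
      exact ⟨D, W, Δ, Ω, hc.mono (lt_min hκ hκ') (min_le_right _ _), hr⟩
  · intro σ hσ
    obtain ⟨κ, hκ, h⟩ := exists_continuation hσ.1 (hσ.2.trans_lt hs2)
    refine ⟨Metric.ball σ κ, mem_nhdsWithin_of_mem_nhds (Metric.ball_mem_nhds σ hκ), κ, hκ,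
      fun ε w xs hw hε hεκ hxs hsonic => h ε w xs hε hεκ ?_ hxs hsonic⟩
    rwa [Metric.mem_ball, Real.dist_eq] at hw

/-- For small `ε` every sonic point in the window has a unique RLP-type solution, which continues
regularly through `X = 0` with uniform bounds. -/
theorem exists_continuation_window {δ₀ : ℝ} (hδ₀ : 0 < δ₀) :
    ∃ κ > 0, κ < 1 ∧ ∀ ε ∈ Ioo 0 κ, ∀ xs ∈ Icc (2 + δ₀) (xMax ε),
      ∃ D W Δ Ω, IsContinuation ε xs κ D W Δ Ω ∧
        ∀ D' W', IsRLPSolution ε xs D' W' → EqOn D' D (Ici xs) ∧ EqOn W' W (Ici xs) := by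
  obtain ⟨s, hs1, hs2⟩ := exists_between
    (max_lt (by norm_num) (one_div_lt_one_div_of_lt two_pos (by linarith)) :
      max (1 / 3 : ℝ) (1 / (2 + δ₀)) < 1 / 2)
  have hs3 : 1 / 3 ≤ s := (le_max_left _ _).trans hs1.le
  have hs0 : 0 < s := by linarith
  have hs4 : 1 < s * (2 + δ₀) := by
    rw [← div_lt_iff₀ (by linarith)]
    exact (le_max_right _ _).trans_lt hs1
  obtain ⟨κ, hκ, h⟩ := exists_continuation_uniform hs2
  obtain ⟨e, he, he'⟩ := Metric.eventually_nhds_iff.1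
    (eventually_sonic_value_le hs0 hs4 (by linarith))
  have hk : 0 < min (min κ e) (1 / 2) := lt_min (lt_min hκ he) (by norm_num)
  have hkκ : min (min κ e) (1 / 2) ≤ κ := (min_le_left _ _).trans (min_le_left _ _)
  have hke : min (min κ e) (1 / 2) ≤ e := (min_le_left _ _).trans (min_le_right _ _)
  refine ⟨min (min κ e) (1 / 2), hk, (min_le_right _ _).trans_lt (by norm_num),
    fun ε hε xs hxs => ?_⟩
  have hε1 : ε < 1 := hε.2.trans ((min_le_right _ _).trans_lt (by norm_num))
  have hxs0 : 0 < xs := by linarith [hxs.1]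
  have hse := he' (y := ε) (by
    rw [Real.dist_eq, sub_zero, abs_of_pos hε.1]; exact hε.2.trans_le hke) xs hxs.1
  obtain ⟨w, hw, hsonic⟩ := exists_sonic_value hε.1 hs3 hxs0 hxs.2 hse
  obtain ⟨D, W, Δ, Ω, hc, hWxs, hu⟩ := h ε w xs hw hε.1 (hε.2.trans_le hkκ) hxs0 hsonic
  refine ⟨D, W, Δ, Ω, hc.mono hk hkκ, fun D' W' h' => hu D' W' h' ?_⟩
  have hW' : 0 < W' xs := by
    rw [← h'.sonic_eq]; exact h'.pos_D xs (mem_Ici.2 le_rfl)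
  exact (sonic_value_unique hε.1 hε1 hxs0 (by linarith [hw.1]) hW' hsonic h'.sonic).symm

end Window

section Inversion

/-- A continuous function on an interval is the derivative of a function on the line. -/
theorem exists_primitive {f : ℝ → ℝ} {a b : ℝ} (hab : a ≤ b) (hf : ContinuousOn f (Icc a b)) :
    ∃ g : ℝ → ℝ, Continuous g ∧ (∀ x, ∃ z ∈ Icc a b, g x = f z) ∧ EqOn g f (Icc a b) ∧
      ∀ c, ∃ F : ℝ → ℝ, F c = 0 ∧ ∀ x, HasDerivAt F (g x) x := by
  have hg : Continuous (IccExtend hab ((Icc a b).domRestrict f)) := hf.domRestrict.Icc_extend'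
  refine ⟨_, hg, fun x => ⟨projIcc a b hab x, (projIcc a b hab x).2, rfl⟩, fun x hx => ?_,
    fun c => ⟨fun x => ∫ t in c..x, IccExtend hab ((Icc a b).domRestrict f) t, by simp,
      fun x => (hg.integral_hasStrictDerivAt c x).hasDerivAt⟩⟩
  rw [IccExtend_of_mem _ _ hx]; rfl

theorem exists_inverse_of_deriv_pos {Y Y' : ℝ → ℝ} {a b : ℝ} (hab : a < b)
    (hY : ∀ X ∈ Icc a b, HasDerivAt Y (Y' X) X) (hcont : ContinuousOn Y' (Icc a b))
    (hpos : ∀ X ∈ Icc a b, 0 < Y' X) :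
    StrictMonoOn Y (Icc a b) ∧ ∃ Z : ℝ → ℝ, ∀ X ∈ Icc a b,
      Z (Y X) = X ∧ HasDerivAt Z (Y' X)⁻¹ (Y X) := by
  obtain ⟨g, hg, hgz, hgeq, hF⟩ := exists_primitive hab.le hcont
  obtain ⟨F, hFa, hF'⟩ := hF a
  have hgpos : ∀ x, 0 < g x := fun x => by
    obtain ⟨z, hz, h⟩ := hgz x
    rw [h]; exact hpos z hz
  have hmono : StrictMono F := strictMono_of_deriv_pos fun x => by
    rw [(hF' x).deriv]; exact hgpos x
  have hFY : ∀ X ∈ Icc a b, F X = Y X - Y a := by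
    have hd : ∀ x ∈ Icc a b, HasDerivAt (fun x => F x - Y x) 0 x := fun x hx =>
      ((hF' x).sub (hY x hx)).congr_deriv (by rw [hgeq hx, sub_self])
    intro X hX
    have := constant_of_has_deriv_right_zero
      (fun x hx => (hd x hx).continuousAt.continuousWithinAt)
      (fun x hx => (hd x (Ico_subset_Icc_self hx)).hasDerivWithinAt) X hX
    linarith
  have hcontF : Continuous F := continuous_iff_continuousAt.2 fun x => (hF' x).continuousAt
  obtain ⟨z₀, hz₀, hmin⟩ := isCompact_Icc.exists_isMinOn (nonempty_Icc.2 hab.le) hcont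
  have hglow : ∀ x, Y' z₀ ≤ g x := fun x => by
    obtain ⟨z, hz, h⟩ := hgz x
    rw [h]; exact hmin hz
  have hm := hpos z₀ hz₀
  have hlow : ∀ x y, x ≤ y → Y' z₀ * (y - x) ≤ F y - F x := fun x y hxy =>
    mul_sub_le_image_sub_of_le_deriv (fun x => (hF' x).differentiableAt)
      (fun x => by rw [(hF' x).deriv]; exact hglow x) hxy
  have htop : Tendsto F atTop atTop := by
    refine tendsto_atTop_mono' _ (f₁ := fun x => Y' z₀ * (x - a)) ?_
      ((tendsto_atTop_add_const_right _ (-a) tendsto_id).const_mul_atTop hm)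
    filter_upwards [eventually_ge_atTop a] with x hx
    have := hlow a x hx
    linarith
  have hbot : Tendsto F atBot atBot := by
    refine tendsto_atBot_mono' _ (f₁ := fun x => Y' z₀ * (x - a)) ?_
      ((tendsto_atBot_add_const_right _ (-a) tendsto_id).const_mul_atBot hm)
    filter_upwards [eventually_le_atBot a] with x hx
    have := hlow x a hx
    linarith
  set e := hmono.orderIsoOfSurjective F (hcontF.surjective htop hbot) with he
  have heF : ∀ x, e x = F x := fun x => rfl
  have hesymm : ∀ x, e.symm (F x) = x := fun x => e.symm_apply_apply x
  refine ⟨fun x hx y hy hxy => ?_, fun y => e.symm (y - Y a), fun X hX => ?_⟩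
  · have := hmono hxy
    rw [hFY x hx, hFY y hy] at this
    linarith
  · have h1 : Y X - Y a = F X := (hFY X hX).symm
    refine ⟨by simp only [h1, hesymm], ?_⟩
    have h2 : HasDerivAt e.symm (g X)⁻¹ (F X) := by
      refine HasDerivAt.of_local_left_inverse e.symm.continuous.continuousAt (f := F) ?_
        (hgpos X).ne' (Eventually.of_forall fun y => e.apply_symm_apply y)
      rw [hesymm]; exact hF' X
    rw [← hgeq hX]
    rw [← h1] at h2
    exact h2.comp_sub_const (Y X) (Y a)

variable {E : Type*} [NormedAddCommGroup E] [NormedSpace ℝ E]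

/-- A curve that solves an autonomous equation off a point solves it at the point. -/
theorem hasDerivAt_of_eventually_ne {f : E → E} {γ : ℝ → E} {t₀ : ℝ}
    (hγ : ContinuousAt γ t₀) (hf : ContinuousAt f (γ t₀))
    (h : ∀ᶠ t in 𝓝[≠] t₀, HasDerivAt γ (f (γ t)) t) : HasDerivAt γ (f (γ t₀)) t₀ := by
  have hlim : Tendsto (fun t => f (γ t)) (𝓝 t₀) (𝓝 (f (γ t₀))) := hf.tendsto.comp hγ.tendsto
  have hd : Tendsto (deriv γ) (𝓝[≠] t₀) (𝓝 (f (γ t₀))) :=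
    (hlim.mono_left nhdsWithin_le_nhds).congr' (h.mono fun t ht => ht.deriv.symm)
  have hs : {t | HasDerivAt γ (f (γ t)) t} ∈ 𝓝[≠] t₀ := h
  have hr : 𝓝[>] t₀ ≤ 𝓝[≠] t₀ := nhdsWithin_mono _ fun x hx => ne_of_gt hx
  have hl : 𝓝[<] t₀ ≤ 𝓝[≠] t₀ := nhdsWithin_mono _ fun x hx => ne_of_lt hx
  have hdiff : DifferentiableOn ℝ γ {t | HasDerivAt γ (f (γ t)) t} := fun t ht =>
    HasDerivAt.differentiableAt ht |>.differentiableWithinAt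
  have h1 := hasDerivWithinAt_Ici_of_tendsto_deriv hdiff hγ.continuousWithinAt (hr hs)
    (hd.mono_left hr)
  have h2 := hasDerivWithinAt_Iic_of_tendsto_deriv hdiff hγ.continuousWithinAt (hl hs)
    (hd.mono_left hl)
  have := h2.union h1
  rwa [Iic_union_Ici, hasDerivWithinAt_univ] at this

end Inversion

section Uniqueness

/-- `𝒞/χ²` in the variables `d = aY²`, `w = 1 + bY`, `e = a^(-η)/χ²`. -/
def denY (ε Y a b e : ℝ) : ℝ := e * Y ^ 2 - brJ ε (a * Y ^ 2) (1 + b * Y)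

def numA (ε Y a b e : ℝ) : ℝ :=
  -ε * (1 + ε) * b - 2 * ε * b ^ 2 * Y
    + Y * (a * ((1 + ε) * (1 + b * Y + ε) + 4 * ε * (1 + b * Y)) - e)

def numB (ε Y a b e : ℝ) : ℝ :=
  2 * ε * (1 + ε) ^ 2 * b ^ 2 + 4 * ε * (1 + ε) * b ^ 3 * Y
    + 2 * ε * b * Y * (e - (1 - ε) * b ^ 2 - 4 * ε * a * (1 + b * Y))
    - 2 * (1 + ε) * (1 + b * Y)
      * (a * ((1 + ε) * (1 + b * Y + ε) + 4 * ε * (1 + b * Y)) - e)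

theorem mul_numA_add_denY (ε Y a b e : ℝ) : Y * numA ε Y a b e + denY ε Y a b e
    = (1 + ε) * ((1 + b * Y + ε) * (a * Y ^ 2 - (1 + b * Y))) := by
  unfold numA denY brJ; ring

theorem mul_numB_add_denY (ε Y a b e : ℝ) :
    -((1 - ε) * (b * Y) * denY ε Y a b e + Y ^ 2 * numB ε Y a b e)
    = (1 + ε) * (1 - 3 * (1 + b * Y)) * denY ε Y a b e
      + 2 * (1 + ε) ^ 2 * ((1 + b * Y) * (1 + b * Y + ε) * (a * Y ^ 2 - (1 + b * Y))) := by
  unfold numB denY brJ; ring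

/-- The `(d, w, χ)` system in the variables `(Y, d/Y², (w-1)/Y, χ)`; it is regular at `Y = 0`. -/
def fieldY (ε : ℝ) (y : ℝ × ℝ × ℝ × ℝ) : ℝ × ℝ × ℝ × ℝ :=
  (1,
   2 * y.2.1 / (1 + ε) * (y.2.2.1 + (1 + y.2.2.1 * y.1 + ε) *
      numA ε y.1 y.2.1 y.2.2.1 (y.2.1 ^ (-eta ε) / y.2.2.2 ^ 2) /
        denY ε y.1 y.2.1 y.2.2.1 (y.2.1 ^ (-eta ε) / y.2.2.2 ^ 2)),
   (y.2.2.1 ^ 2 + (1 + y.2.2.1 * y.1 + ε) *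
      numB ε y.1 y.2.1 y.2.2.1 (y.2.1 ^ (-eta ε) / y.2.2.2 ^ 2) /
        ((1 - ε) * denY ε y.1 y.2.1 y.2.2.1 (y.2.1 ^ (-eta ε) / y.2.2.2 ^ 2))) / (1 + ε),
   -(y.2.2.1 * y.2.2.2) / (1 - ε))

variable {ε : ℝ}

theorem contDiffAt_fieldY {n : WithTop ℕ∞} {y : ℝ × ℝ × ℝ × ℝ} (hε : ε < 1) (ha : 0 < y.2.1)
    (hχ : y.2.2.2 ≠ 0)
    (hd : denY ε y.1 y.2.1 y.2.2.1 (y.2.1 ^ (-eta ε) / y.2.2.2 ^ 2) ≠ 0) :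
    ContDiffAt ℝ n (fieldY ε) y := by
  have h1 : ContDiffAt ℝ n (fun y : ℝ × ℝ × ℝ × ℝ => y.2.1 ^ (-eta ε) / y.2.2.2 ^ 2) y :=
    (ContDiffAt.rpow (n := n) (f := fun y : ℝ × ℝ × ℝ × ℝ => y.2.1) (g := fun _ => -eta ε)
      (by fun_prop) contDiffAt_const ha.ne').div
      (g := fun y : ℝ × ℝ × ℝ × ℝ => y.2.2.2 ^ 2) (by fun_prop) (pow_ne_zero 2 hχ)
  have h2 : ContDiffAt ℝ n (fun y : ℝ × ℝ × ℝ × ℝ =>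
      denY ε y.1 y.2.1 y.2.2.1 (y.2.1 ^ (-eta ε) / y.2.2.2 ^ 2)) y := by
    unfold denY brJ; fun_prop
  have h3 : ContDiffAt ℝ n (fun y : ℝ × ℝ × ℝ × ℝ =>
      numA ε y.1 y.2.1 y.2.2.1 (y.2.1 ^ (-eta ε) / y.2.2.2 ^ 2)) y := by
    unfold numA; fun_prop
  have h4 : ContDiffAt ℝ n (fun y : ℝ × ℝ × ℝ × ℝ =>
      numB ε y.1 y.2.1 y.2.2.1 (y.2.1 ^ (-eta ε) / y.2.2.2 ^ 2)) y := by
    unfold numB; fun_prop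
  unfold fieldY
  refine contDiffAt_const.prodMk (ContDiffAt.prodMk ?_ (ContDiffAt.prodMk ?_ (by fun_prop)))
  · refine ContDiffAt.mul (by fun_prop) (ContDiffAt.add (by fun_prop) (ContDiffAt.div ?_ h2 hd))
    fun_prop
  · refine ContDiffAt.div_const (ContDiffAt.add (by fun_prop) (ContDiffAt.div ?_ ?_ ?_)) _
    · fun_prop
    · fun_prop
    · exact mul_ne_zero (by linarith) hd

theorem denC_eq_denY {Y a b χ : ℝ} (hY : Y ≠ 0) (hχ : χ ≠ 0) :
    denC ε Y (a * Y ^ 2) (1 + b * Y) χ = χ ^ 2 * denY ε Y a b (a ^ (-eta ε) / χ ^ 2) := by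
  have : a * Y ^ 2 / Y ^ 2 = a := by field_simp
  unfold denC denY brJ
  rw [this]
  field_simp

/-- Solutions of the `(d, w, χ)` system in the regular variables. -/
theorem hasDerivAt_regular (hε0 : 0 < ε) (hε : ε < 1) {d w χ : ℝ → ℝ} {Y : ℝ} (hY : Y ≠ 0)
    (hχ0 : χ Y ≠ 0) (hC : denC ε Y (d Y) (w Y) (χ Y) ≠ 0)
    (hd : HasDerivAt d
      (2 * χ Y ^ 2 / Y * (d Y * (w Y + ε) ^ 2 * (d Y - w Y) / denC ε Y (d Y) (w Y) (χ Y))) Y)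
    (hw : HasDerivAt w
      (-((w Y + ε) * (1 - 3 * w Y) / ((1 - ε) * Y))
        - 2 * (1 + ε) * χ Y ^ 2 / ((1 - ε) * Y)
          * (w Y * (w Y + ε) ^ 2 * (d Y - w Y) / denC ε Y (d Y) (w Y) (χ Y))) Y)
    (hχ : HasDerivAt χ ((1 - w Y) / ((1 - ε) * Y) * χ Y) Y) :
    HasDerivAt (fun Y => (Y, d Y / Y ^ 2, (w Y - 1) / Y, χ Y))
      (fieldY ε (Y, d Y / Y ^ 2, (w Y - 1) / Y, χ Y)) Y := by
  have hda : d Y = d Y / Y ^ 2 * Y ^ 2 := by field_simp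
  have hwb : w Y = 1 + (w Y - 1) / Y * Y := by field_simp; ring
  have h1 : HasDerivAt (fun Y => d Y / Y ^ 2) _ Y := hd.div (hasDerivAt_pow 2 Y) (pow_ne_zero 2 hY)
  have h2 : HasDerivAt (fun Y => (w Y - 1) / Y) _ Y := (hw.sub_const 1).div (hasDerivAt_id Y) hY
  rw [hda, hwb, denC_eq_denY hY hχ0] at hC
  have hQ : denY ε Y (d Y / Y ^ 2) ((w Y - 1) / Y) ((d Y / Y ^ 2) ^ (-eta ε) / χ Y ^ 2) ≠ 0 :=
    right_ne_zero_of_mul hC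
  have hCQ : denC ε Y (d Y) (w Y) (χ Y) = χ Y ^ 2 *
      denY ε Y (d Y / Y ^ 2) ((w Y - 1) / Y) ((d Y / Y ^ 2) ^ (-eta ε) / χ Y ^ 2) := by
    conv_lhs => rw [hda, hwb]
    exact denC_eq_denY hY hχ0
  have e1 := mul_numA_add_denY ε Y (d Y / Y ^ 2) ((w Y - 1) / Y)
    ((d Y / Y ^ 2) ^ (-eta ε) / χ Y ^ 2)
  have e2 := mul_numB_add_denY ε Y (d Y / Y ^ 2) ((w Y - 1) / Y)
    ((d Y / Y ^ 2) ^ (-eta ε) / χ Y ^ 2)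
  have hε1 : 1 - ε ≠ 0 := by linarith
  have hε2 : 1 + ε ≠ 0 := by linarith
  refine (hasDerivAt_id Y).prodMk (HasDerivAt.prodMk (h1.congr_deriv ?_)
    (HasDerivAt.prodMk (h2.congr_deriv ?_) (hχ.congr_deriv ?_)))
  · simp only [hCQ]
    rw [← hwb, ← hda] at e1
    rw [← hwb]
    generalize hQd : denY ε Y (d Y / Y ^ 2) ((w Y - 1) / Y)
      ((d Y / Y ^ 2) ^ (-eta ε) / χ Y ^ 2) = Q at *
    generalize numA ε Y (d Y / Y ^ 2) ((w Y - 1) / Y)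
      ((d Y / Y ^ 2) ^ (-eta ε) / χ Y ^ 2) = A at *
    generalize d Y = D at *
    generalize w Y = V at *
    generalize χ Y = x at *
    field_simp
    linear_combination (-2 * D * Y * (V + ε)) * e1
  · simp only [hCQ]
    rw [← hwb, ← hda] at e2
    rw [← hwb]
    generalize hQd : denY ε Y (d Y / Y ^ 2) ((w Y - 1) / Y)
      ((d Y / Y ^ 2) ^ (-eta ε) / χ Y ^ 2) = Q at *
    generalize numB ε Y (d Y / Y ^ 2) ((w Y - 1) / Y)
      ((d Y / Y ^ 2) ^ (-eta ε) / χ Y ^ 2) = B at *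
    generalize d Y = D at *
    generalize w Y = V at *
    generalize χ Y = x at *
    field_simp at e2 ⊢
    linear_combination (V + ε) * e2
  · simp only
    field_simp
    ring

theorem IsExtension.eventually_regular {d₂ w₁ : ℝ} {I : Set ℝ} {d w χ : ℝ → ℝ}
    (h : IsExtension ε d₂ w₁ I d w χ) (hε0 : 0 < ε) (hε : ε < 1) (hd₂ : 0 < d₂)
    (hI : I ∈ 𝓝 (0 : ℝ)) :
    ∀ᶠ Y in 𝓝 (0 : ℝ), HasDerivAt
      (fun Y => (Y, Function.update (fun Y => d Y / Y ^ 2) 0 d₂ Y,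
        Function.update (fun Y => (w Y - 1) / Y) 0 w₁ Y, χ Y))
      (fieldY ε (Y, Function.update (fun Y => d Y / Y ^ 2) 0 d₂ Y,
        Function.update (fun Y => (w Y - 1) / Y) 0 w₁ Y, χ Y)) Y := by
  set γ : ℝ → ℝ × ℝ × ℝ × ℝ := fun Y => (Y, Function.update (fun Y => d Y / Y ^ 2) 0 d₂ Y,
    Function.update (fun Y => (w Y - 1) / Y) 0 w₁ Y, χ Y) with hγ
  have h0 : (0 : ℝ) ∈ I := mem_of_mem_nhds hI
  have hχc := (h.analytic_chi 0 h0).continuousAt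
  have hne : ∀ᶠ Y in 𝓝[≠] (0 : ℝ), HasDerivAt γ (fieldY ε (γ Y)) Y := by
    have h1 : ∀ᶠ Y in 𝓝 (0 : ℝ), χ Y ≠ 0 := hχc.eventually_ne (by rw [h.chi_zero]; norm_num)
    filter_upwards [mem_nhdsWithin_of_mem_nhds hI, mem_nhdsWithin_of_mem_nhds h1,
      self_mem_nhdsWithin] with Y hYI hχ hY
    have hY' : Y ≠ 0 := hY
    have h2 := hasDerivAt_regular hε0 hε hY' hχ (h.den_neg Y hYI).ne (h.eq_d Y hYI hY')
      (h.eq_w Y hYI hY') (h.eq_chi Y hYI hY')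
    have h3 : γ =ᶠ[𝓝 Y] fun Y => (Y, d Y / Y ^ 2, (w Y - 1) / Y, χ Y) := by
      filter_upwards [isOpen_ne.mem_nhds hY'] with Z hZ
      have hZ' : Z ≠ 0 := hZ
      simp [hγ, Function.update_of_ne hZ']
    rw [h3.eq_of_nhds]
    exact h2.congr_of_eventuallyEq h3
  have hcont : ContinuousAt γ 0 := by
    refine continuousAt_id.prodMk (ContinuousAt.prodMk ?_ (ContinuousAt.prodMk ?_ hχc))
    · exact continuousAt_update_same.2 h.lim_d
    · refine continuousAt_update_same.2 ?_
      have := (h.analytic_w 0 h0).differentiableAt.hasDerivAt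
      rw [h.deriv_w_zero, hasDerivAt_iff_tendsto_slope] at this
      refine this.congr' ?_
      filter_upwards with Y
      rw [slope_def_field, h.w_zero, sub_zero]
  have hat : HasDerivAt γ (fieldY ε (γ 0)) 0 := by
    refine hasDerivAt_of_eventually_ne hcont ?_ hne
    refine (contDiffAt_fieldY (n := 0) hε ?_ ?_ ?_).continuousAt
    · simpa [hγ] using hd₂
    · simp [hγ, h.chi_zero]
    · simp only [hγ, Function.update_self, denY, brJ]
      have : 0 < (1 + ε) ^ 2 := by positivity
      intro h'
      ring_nf at h' this
      linarith
  rw [eventually_nhdsWithin_iff] at hne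
  filter_upwards [hne] with Y hY
  rcases eq_or_ne Y 0 with rfl | hY0
  · exact hat
  · exact hY hY0

/-- Uniqueness of the local extension. -/
theorem IsExtension.eqOn {d₂ w₁ Y₁ : ℝ} {d w χ d' w' χ' : ℝ → ℝ} (hY₁ : 0 < Y₁)
    (h : IsExtension ε d₂ w₁ (Ioo (-Y₁) Y₁) d w χ)
    (h' : IsExtension ε d₂ w₁ (Ioo (-Y₁) Y₁) d' w' χ') (hε0 : 0 < ε) (hε : ε < 1)
    (hd₂ : 0 < d₂) :
    EqOn d' d (Ioo (-Y₁) Y₁) ∧ EqOn w' w (Ioo (-Y₁) Y₁) ∧ EqOn χ' χ (Ioo (-Y₁) Y₁) := by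
  have h0 : (0 : ℝ) ∈ Ioo (-Y₁) Y₁ := ⟨by linarith, hY₁⟩
  have hI : Ioo (-Y₁) Y₁ ∈ 𝓝 (0 : ℝ) := Ioo_mem_nhds h0.1 h0.2
  have key := eventuallyEq_of_hasDerivAt (f := fieldY ε) (t₀ := 0)
    (γ := fun Y => (Y, Function.update (fun Y => d' Y / Y ^ 2) 0 d₂ Y,
        Function.update (fun Y => (w' Y - 1) / Y) 0 w₁ Y, χ' Y))
    (γ' := fun Y => (Y, Function.update (fun Y => d Y / Y ^ 2) 0 d₂ Y,
        Function.update (fun Y => (w Y - 1) / Y) 0 w₁ Y, χ Y)) (by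
      refine contDiffAt_fieldY hε ?_ ?_ ?_
      · simpa using hd₂
      · simp [h'.chi_zero]
      · simp only [Function.update_self, denY, brJ]
        have : 0 < (1 + ε) ^ 2 := by positivity
        intro h'
        ring_nf at h' this
        linarith)
    (h'.eventually_regular hε0 hε hd₂ hI) (h.eventually_regular hε0 hε hd₂ hI)
    (by simp [h.chi_zero, h'.chi_zero])
  have hfr : ∃ᶠ Y in 𝓝[≠] (0 : ℝ), d' Y = d Y ∧ w' Y = w Y ∧ χ' Y = χ Y := by
    refine Eventually.frequently ?_
    filter_upwards [mem_nhdsWithin_of_mem_nhds key, self_mem_nhdsWithin] with Y hY hY0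
    have hY0' : Y ≠ 0 := hY0
    simp only [Prod.mk.injEq, Function.update_of_ne hY0', true_and] at hY
    obtain ⟨h1, h2, h3⟩ := hY
    field_simp at h1 h2
    exact ⟨h1, by linarith, h3⟩
  exact ⟨h'.analytic_d.eqOn_of_preconnected_of_frequently_eq h.analytic_d isPreconnected_Ioo h0
      (hfr.mono fun x hx => hx.1),
    h'.analytic_w.eqOn_of_preconnected_of_frequently_eq h.analytic_w isPreconnected_Ioo h0
      (hfr.mono fun x hx => hx.2.1),
    h'.analytic_chi.eqOn_of_preconnected_of_frequently_eq h.analytic_chi isPreconnected_Ioo h0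
      (hfr.mono fun x hx => hx.2.2)⟩

end Uniqueness

section Gauge

/-- The gauge `ψ = Y/X` between the Schwarzschild and the comoving variables, with the inverse `Z`
of `X ↦ X ψ(X)`, and `ϖ = (W - 1)/X` on the whole exterior of the sonic point. -/
structure IsGauge (ε xs κ : ℝ) (W Ω ϖ ψ Z : ℝ → ℝ) : Prop where
  eq_Ω : ∀ X ∈ Icc (-κ) κ, ϖ X = Ω X
  eq_W : ∀ X ∈ Ioc 0 (toX ε xs), W (X ^ (-(1 + eta ε))) = 1 + ϖ X * X
  ψ_zero : ψ 0 = 1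
  ψ_pos : ∀ X, 0 < ψ X
  deriv_ψ : ∀ X ∈ Icc (-κ) (toX ε xs), HasDerivAt ψ (-ϖ X / (1 + ϖ X * X + ε) * ψ X) X
  inv : ∀ X ∈ Icc (-κ) (toX ε xs), Z (X * ψ X) = X
  deriv_Z : ∀ X ∈ Icc (-κ) (toX ε xs),
    HasDerivAt Z ((1 + ϖ X * X + ε) / ((1 + ε) * ψ X)) (X * ψ X)
  mono : StrictMonoOn (fun X => X * ψ X) (Icc (-κ) (toX ε xs))

variable {ε xs κ : ℝ} {D W Δ Ω ϖ ψ Z : ℝ → ℝ}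

theorem rpow_mem_Ici (hε0 : 0 < ε) (hε : ε < 1) (hxs : 0 < xs) {X : ℝ}
    (hX : X ∈ Ioc 0 (toX ε xs)) : X ^ (-(1 + eta ε)) ∈ Ici xs := by
  have := Real.rpow_le_rpow_of_nonpos hX.1 hX.2
    (neg_nonpos.2 (one_add_eta_pos hε0 hε).le)
  rwa [toX_rpow hε0 hε hxs] at this

theorem IsContinuation.exists_gauge (h : IsContinuation ε xs κ D W Δ Ω) (hε0 : 0 < ε)
    (hε : ε < 1) (hxs : 0 < xs) (hκ : 0 < κ) : ∃ ϖ ψ Z, IsGauge ε xs κ W Ω ϖ ψ Z := by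
  set ϖ : ℝ → ℝ := fun X => if X ≤ κ then Ω X else (W (X ^ (-(1 + eta ε))) - 1) / X with hϖ
  have eqΩ : ∀ X, X ≤ κ → ϖ X = Ω X := fun X hX => by simp only [hϖ, if_pos hX]
  have eqW : ∀ X, 0 < X → ϖ X = (W (X ^ (-(1 + eta ε))) - 1) / X := by
    intro X hX
    by_cases hXκ : X ≤ κ
    · have := h.eq_W (X ^ (-(1 + eta ε))) (Real.rpow_pos_of_pos hX _)
        (by rwa [toX_of_rpow hε0 hε hX])
      rw [toX_of_rpow hε0 hε hX] at this
      rw [eqΩ X hXκ, this]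
      field_simp
      ring
    · simp only [hϖ, if_neg hXκ]
  have hpos : ∀ X ∈ Icc (-κ) (toX ε xs), 0 < 1 + ϖ X * X := by
    intro X hX
    by_cases hXκ : X ≤ κ
    · rw [eqΩ X hXκ]; exact h.posWX X ⟨hX.1, hXκ⟩
    · have hX0 : 0 < X := by linarith
      rw [eqW X hX0, div_mul_cancel₀ _ hX0.ne', add_sub_cancel]
      exact h.posW _ (rpow_mem_Ici hε0 hε hxs ⟨hX0, hX.2⟩)
  have hlt := h.lt_toX
  have hcont : ContinuousOn ϖ (Icc (-κ) (toX ε xs)) := by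
    rw [← Icc_union_Icc_eq_Icc (by linarith : -κ ≤ κ) hlt.le]
    refine ContinuousOn.union_of_isClosed ?_ ?_ isClosed_Icc isClosed_Icc
    · exact ContinuousOn.congr (fun X hX => (h.eqΩ X hX).continuousAt.continuousWithinAt)
        fun X hX => eqΩ X hX.2
    · refine ContinuousOn.congr (f := fun X => (W (X ^ (-(1 + eta ε))) - 1) / X) ?_
        fun X hX => eqW X (hκ.trans_le hX.1)
      intro X hX
      have hX0 : 0 < X := hκ.trans_le hX.1
      have h1 := (h.rlp.analytic_W _ (rpow_mem_Ici hε0 hε hxs ⟨hX0, hX.2⟩)).continuousAt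
      have h2 : ContinuousAt (fun X : ℝ => X ^ (-(1 + eta ε))) X :=
        Real.continuousAt_rpow_const _ _ (Or.inl hX0.ne')
      exact (((ContinuousAt.comp (f := fun X : ℝ => X ^ (-(1 + eta ε))) h1 h2).sub
        continuousAt_const).div continuousAt_id hX0.ne').continuousWithinAt
  have hle : -κ ≤ toX ε xs := by linarith
  have hqcont : ContinuousOn (fun X => -ϖ X / (1 + ϖ X * X + ε)) (Icc (-κ) (toX ε xs)) :=
    hcont.neg.div (((continuousOn_const.add (hcont.mul continuousOn_id))).add continuousOn_const)
      fun X hX => by have := hpos X hX; linarith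
  obtain ⟨q, -, -, hq, hF⟩ := exists_primitive hle hqcont
  obtain ⟨F, hF0, hF'⟩ := hF 0
  have hψ : ∀ X ∈ Icc (-κ) (toX ε xs), HasDerivAt (fun X => Real.exp (F X))
      (-ϖ X / (1 + ϖ X * X + ε) * Real.exp (F X)) X := fun X hX =>
    (hF' X).exp.congr_deriv (by rw [hq hX, mul_comm])
  have hψc : ContinuousOn (fun X => Real.exp (F X)) (Icc (-κ) (toX ε xs)) := fun X hX =>
    (hψ X hX).continuousAt.continuousWithinAt
  obtain ⟨hmono, Z, hZ⟩ := exists_inverse_of_deriv_pos (a := -κ) (b := toX ε xs)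
    (Y := fun X => X * Real.exp (F X))
    (Y' := fun X => (1 + ε) * Real.exp (F X) / (1 + ϖ X * X + ε)) (by linarith)
    (fun X hX => by
      refine ((hasDerivAt_id X).mul (hψ X hX)).congr_deriv ?_
      have : 1 + ϖ X * X + ε ≠ 0 := by linarith [hpos X hX]
      have e := div_mul_cancel₀ (-ϖ X) this
      rw [eq_div_iff this, id_eq]
      linear_combination (X * Real.exp (F X)) * e)
    (by
      refine (continuousOn_const.mul hψc).div
        ((continuousOn_const.add (hcont.mul continuousOn_id)).add continuousOn_const)
        fun X hX => ?_
      have := hpos X hX; linarith)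
    (fun X hX => by
      have : 0 < 1 + ϖ X * X + ε := by linarith [hpos X hX]
      positivity)
  refine ⟨ϖ, fun X => Real.exp (F X), Z, fun X hX => eqΩ X hX.2, fun X hX => ?_,
    by simp [hF0], fun X => Real.exp_pos _, hψ, fun X hX => (hZ X hX).1,
    fun X hX => (hZ X hX).2.congr_deriv (inv_div _ _), hmono⟩
  rw [eqW X hX.1, div_mul_cancel₀ _ hX.1.ne', add_sub_cancel]

theorem IsGauge.exists_eq (h : IsGauge ε xs κ W Ω ϖ ψ Z) {a b : ℝ} (hab : a ≤ b)
    (ha : -κ ≤ a) (hb : b ≤ toX ε xs) {Y : ℝ} (hY : Y ∈ Icc (a * ψ a) (b * ψ b)) :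
    ∃ X ∈ Icc a b, X * ψ X = Y := by
  have hc : ContinuousOn (fun X => X * ψ X) (Icc a b) := fun X hX =>
    (continuousAt_id.mul (h.deriv_ψ X ⟨ha.trans hX.1, hX.2.trans hb⟩).continuousAt
      ).continuousWithinAt
  obtain ⟨X, hX, hXY⟩ := intermediate_value_Icc hab hc hY
  exact ⟨X, hX, hXY⟩

/-- The comoving radius. -/
theorem IsGauge.isComovingRadius (h : IsGauge ε xs κ W Ω ϖ ψ Z) (hε0 : 0 < ε) (hε : ε < 1)
    (hxs : 0 < xs) (hκ : 0 < κ) :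
    IsComovingRadius ε xs W (fun y => Z (toX ε y) ^ (-(1 + eta ε)))
      ((toX ε xs * ψ (toX ε xs)) ^ (-(1 + eta ε))) := by
  have hXs := toX_pos ε hxs
  have hp := one_add_eta_pos hε0 hε
  have hYs : 0 < toX ε xs * ψ (toX ε xs) := mul_pos hXs (h.ψ_pos _)
  set ys := (toX ε xs * ψ (toX ε xs)) ^ (-(1 + eta ε)) with hys
  have hyspos : 0 < ys := Real.rpow_pos_of_pos hYs _
  have htoXys : toX ε ys = toX ε xs * ψ (toX ε xs) := toX_of_rpow hε0 hε hYs
  have hex : ∀ y ∈ Ici ys, ∃ X ∈ Ioc 0 (toX ε xs), X * ψ X = toX ε y ∧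
      (ys < y → X < toX ε xs) := by
    intro y hy
    have hy0 : 0 < y := hyspos.trans_le hy
    have hle : toX ε y ≤ toX ε xs * ψ (toX ε xs) := by
      rw [← htoXys]
      rcases (mem_Ici.1 hy).eq_or_lt with heq | hlt
      · rw [heq]
      · exact (toX_lt hε0 hε hyspos hlt).le
    obtain ⟨X, hX, hXY⟩ := h.exists_eq (a := 0) hXs.le (by linarith) le_rfl
      (Y := toX ε y) ⟨by simpa using (toX_pos ε hy0).le, hle⟩
    refine ⟨X, ⟨?_, hX.2⟩, hXY, fun hlt => lt_of_le_of_ne hX.2 ?_⟩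
    · rcases hX.1.eq_or_lt with heq | hlt
      · rw [← heq, zero_mul] at hXY
        exact absurd hXY (toX_pos ε hy0).ne
      · exact hlt
    · rintro rfl
      have := toX_lt hε0 hε hyspos hlt
      rw [htoXys, hXY] at this
      exact lt_irrefl _ this
  have hderiv : ∀ y ∈ Ici ys, HasDerivAt (fun y => Z (toX ε y) ^ (-(1 + eta ε)))
      (Z (toX ε y) ^ (-(1 + eta ε)) * (W (Z (toX ε y) ^ (-(1 + eta ε))) + ε) / ((1 + ε) * y))
      y := by
    intro y hy
    have hy0 : 0 < y := hyspos.trans_le hy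
    obtain ⟨X, hX, hXY, -⟩ := hex y hy
    have hXm : X ∈ Icc (-κ) (toX ε xs) := ⟨by linarith [hX.1], hX.2⟩
    have hZ := h.deriv_Z X hXm
    have hZX : Z (toX ε y) = X := by rw [← hXY]; exact h.inv X hXm
    have hW := h.eq_W X hX
    rw [hXY] at hZ
    have h1 := hZ.comp y (hasDerivAt_toX hε hy0)
    have h2 := h1.rpow_const (p := -(1 + eta ε)) (Or.inl (by
      simp only [Function.comp_apply, hZX]; exact hX.1.ne'))
    refine h2.congr_deriv ?_
    simp only [Function.comp_apply, hZX, hW]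
    rw [Real.rpow_sub_one hX.1.ne', ← hXY]
    have h3 := h.ψ_pos X
    have h4 : 1 - ε ≠ 0 := by linarith
    have h5 : 1 + ε ≠ 0 := by linarith
    have h6 := hX.1.ne'
    generalize X ^ (-(1 + eta ε)) = P
    rw [one_add_eta hε]
    field_simp
  refine ⟨hyspos, fun y hy => (hderiv y hy).continuousAt.continuousWithinAt, ?_, ?_,
    fun y hy => hderiv y (mem_Ioi.1 hy).le, ?_⟩
  · simp only [htoXys]
    rw [h.inv _ ⟨by linarith, le_rfl⟩, toX_rpow hε0 hε hxs]
  · intro y hy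
    obtain ⟨X, hX, hXY, hlt⟩ := hex y (mem_Ioi.1 hy).le
    have hXm : X ∈ Icc (-κ) (toX ε xs) := ⟨by linarith [hX.1], hX.2⟩
    rw [← hXY, h.inv X hXm]
    have := Real.rpow_lt_rpow_of_neg hX.1 (hlt hy) (neg_neg_of_pos hp)
    rwa [toX_rpow hε0 hε hxs] at this
  · have h0m : (0 : ℝ) ∈ Icc (-κ) (toX ε xs) := ⟨by linarith, hXs.le⟩
    have hZ0 : Z 0 = 0 := by simpa using h.inv 0 h0m
    have hZc : Tendsto Z (𝓝 0) (𝓝 0) := by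
      have := (h.deriv_Z 0 h0m).continuousAt.tendsto
      simpa [hZ0] using this
    have hXlim : Tendsto (toX ε) atTop (𝓝 0) := tendsto_rpow_neg_atTop (by positivity)
    have hψlim : Tendsto ψ (𝓝 0) (𝓝 1) := by
      have := (h.deriv_ψ 0 h0m).continuousAt.tendsto
      rwa [h.ψ_zero] at this
    have hlim := (hψlim.comp (hZc.comp hXlim)).rpow_const (p := 1 + eta ε) (Or.inl one_ne_zero)
    rw [Real.one_rpow] at hlim
    refine hlim.congr' ?_
    filter_upwards [eventually_ge_atTop ys] with y hy
    have hy0 : 0 < y := hyspos.trans_le hy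
    obtain ⟨X, hX, hXY, -⟩ := hex y hy
    have hXm : X ∈ Icc (-κ) (toX ε xs) := ⟨by linarith [hX.1], hX.2⟩
    have hψX := h.ψ_pos X
    have hZX : Z (toX ε y) = X := by rw [← hXY]; exact h.inv X hXm
    have hyX : y = (X * ψ X) ^ (-(1 + eta ε)) := by rw [hXY, toX_rpow hε0 hε hy0]
    simp only [Function.comp_apply, hZX]
    conv_rhs => rw [hyX]
    rw [Real.mul_rpow hX.1.le hψX.le, Real.rpow_neg hψX.le]
    have h1 : X ^ (-(1 + eta ε)) ≠ 0 := (Real.rpow_pos_of_pos hX.1 _).ne'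
    have h2 : ψ X ^ (1 + eta ε) ≠ 0 := (Real.rpow_pos_of_pos hψX _).ne'
    field_simp

end Gauge

section Extension

variable {ε xs κ : ℝ} {D W Δ Ω ϖ ψ Z : ℝ → ℝ}

theorem IsContinuation.analyticAt (h : IsContinuation ε xs κ D W Δ Ω) (hε : ε < 1) {X : ℝ}
    (hX : X ∈ Ioo (-κ) κ) : AnalyticAt ℝ Δ X ∧ AnalyticAt ℝ Ω X := by
  have hXm := Ioo_subset_Icc_self hX
  have h1 : AnalyticAt ℝ (fun t => (-t, Δ (-t), Ω (-t), ε)) (-X) := by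
    refine analyticAt_of_hasDerivAt (f := fieldX) ?_ ?_
    · refine (contDiffAt_fieldX ?_ hε ?_).analyticAt
      · simp only [neg_neg]; linarith [h.ltΔ X hXm]
      · simp only [neg_neg]; exact (h.den X hXm).ne
    · have : Ioo (-κ) κ ∈ 𝓝 (-X) := Ioo_mem_nhds (by linarith [hX.2]) (by linarith [hX.1])
      filter_upwards [this] with t ht
      have htm : -t ∈ Icc (-κ) κ := ⟨by linarith [ht.2], by linarith [ht.1]⟩
      have e1 := (h.eqΔ (-t) htm).comp t (hasDerivAt_neg t)
      have e2 := (h.eqΩ (-t) htm).comp t (hasDerivAt_neg t)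
      exact (hasDerivAt_neg t).prodMk ((e1.congr_deriv (mul_neg_one _)).prodMk
        ((e2.congr_deriv (mul_neg_one _)).prodMk (hasDerivAt_const t ε)))
  have h2 : AnalyticAt ℝ (fun t : ℝ => -t) X := analyticAt_id.neg
  have h3 := analyticAt_fst.fun_comp (analyticAt_snd.fun_comp (h1.fun_comp_of_eq h2 rfl))
  have h4 := analyticAt_fst.fun_comp (analyticAt_snd.fun_comp
    (analyticAt_snd.fun_comp (h1.fun_comp_of_eq h2 rfl)))
  simp only [neg_neg] at h3 h4
  exact ⟨h3, h4⟩

/-- The constants at infinity. -/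
theorem IsContinuation.tendsto (h : IsContinuation ε xs κ D W Δ Ω) (hε0 : 0 < ε) (hε : ε < 1)
    (hκ : 0 < κ) :
    Tendsto (fun x => D x * x ^ (2 / (1 + eta ε))) atTop (𝓝 (Δ 0)) ∧
      Tendsto (fun x => (W x - 1) * x ^ (1 / (1 + eta ε))) atTop (𝓝 (Ω 0)) := by
  have hp := one_add_eta_pos hε0 hε
  have hlim : Tendsto (toX ε) atTop (𝓝 0) := tendsto_rpow_neg_atTop (by positivity)
  have h0 : (0 : ℝ) ∈ Icc (-κ) κ := ⟨by linarith, hκ.le⟩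
  have hev : ∀ᶠ x in atTop, 0 < x ∧ toX ε x ≤ κ :=
    (eventually_gt_atTop 0).and ((hlim.eventually (gt_mem_nhds hκ)).mono fun x hx => hx.le)
  constructor
  · refine ((h.eqΔ 0 h0).continuousAt.tendsto.comp hlim).congr' ?_
    filter_upwards [hev] with x hx
    rw [h.eq_D x hx.1 hx.2, Function.comp_apply, mul_assoc, toX, ← Real.rpow_natCast,
      ← Real.rpow_mul hx.1.le, ← Real.rpow_add hx.1]
    have : -(1 / (1 + eta ε)) * (2 : ℕ) + 2 / (1 + eta ε) = 0 := by push_cast; ring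
    rw [this, Real.rpow_zero, mul_one]
  · refine ((h.eqΩ 0 h0).continuousAt.tendsto.comp hlim).congr' ?_
    filter_upwards [hev] with x hx
    rw [h.eq_W x hx.1 hx.2, Function.comp_apply, add_sub_cancel_left, mul_assoc, toX,
      ← Real.rpow_add hx.1, neg_add_cancel, Real.rpow_zero, mul_one]

theorem denC_eq_denX {X a b p : ℝ} (ha : 0 < a) (hp : 0 < p) :
    denC ε (X * p) (a * X ^ 2) (1 + b * X) (p ^ (1 + eta ε))
      = (p ^ (1 + eta ε)) ^ 2 * denX ε X a b := by
  rcases eq_or_ne X 0 with rfl | hX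
  · simp [denC, denX, brJ]
  have h1 : a * X ^ 2 / (X * p) ^ 2 = a / p ^ 2 := by field_simp
  have h2 : (a / p ^ 2) ^ (-eta ε) * p ^ 2 = (p ^ (1 + eta ε)) ^ 2 * a ^ (-eta ε) := by
    rw [Real.div_rpow ha.le (by positivity), Real.rpow_neg (x := p ^ 2) (by positivity),
      div_inv_eq_mul, mul_assoc, mul_comm (a ^ (-eta ε)), Real.rpow_add hp, Real.rpow_one,
      ← Real.rpow_natCast p 2, ← Real.rpow_mul hp.le, mul_comm _ (eta ε), Real.rpow_mul hp.le,
      Real.rpow_natCast, Real.rpow_natCast]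
    ring
  unfold denC denX brJ
  rw [h1, mul_pow]
  linear_combination X ^ 2 * h2

theorem IsGauge.spec (g : IsGauge ε xs κ W Ω ϖ ψ Z) (hlt : κ < toX ε xs) (hκ : 0 < κ) {Y : ℝ}
    (hY : Y ∈ Ioo (-κ * ψ (-κ)) (κ * ψ κ)) : Z Y ∈ Ioo (-κ) κ ∧ Z Y * ψ (Z Y) = Y := by
  obtain ⟨X, hX, hXY⟩ := g.exists_eq (by linarith : -κ ≤ κ) le_rfl hlt.le
    (Ioo_subset_Icc_self hY)
  have hZ : Z Y = X := by rw [← hXY]; exact g.inv X ⟨hX.1, hX.2.trans hlt.le⟩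
  rw [hZ]
  refine ⟨⟨lt_of_le_of_ne hX.1 ?_, lt_of_le_of_ne hX.2 ?_⟩, hXY⟩
  · rintro rfl; exact hY.1.ne hXY
  · rintro rfl; exact hY.2.ne hXY.symm

theorem IsGauge.hasDerivAt_Z (g : IsGauge ε xs κ W Ω ϖ ψ Z) (hlt : κ < toX ε xs) (hκ : 0 < κ)
    {Y : ℝ} (hY : Y ∈ Ioo (-κ * ψ (-κ)) (κ * ψ κ)) :
    HasDerivAt Z ((1 + Ω (Z Y) * Z Y + ε) / ((1 + ε) * ψ (Z Y))) Y := by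
  obtain ⟨h1, h2⟩ := g.spec hlt hκ hY
  have := g.deriv_Z (Z Y) ⟨h1.1.le, (h1.2.trans hlt).le⟩
  rwa [h2, g.eq_Ω _ (Ioo_subset_Icc_self h1)] at this

theorem IsGauge.hasDerivAt_ψ (g : IsGauge ε xs κ W Ω ϖ ψ Z) (hlt : κ < toX ε xs) {X : ℝ}
    (hX : X ∈ Icc (-κ) κ) : HasDerivAt ψ (-Ω X / (1 + Ω X * X + ε) * ψ X) X := by
  have := g.deriv_ψ X ⟨hX.1, (hX.2.trans hlt.le)⟩
  rwa [g.eq_Ω X hX] at this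

theorem IsGauge.analyticAt_ψ (g : IsGauge ε xs κ W Ω ϖ ψ Z)
    (h : IsContinuation ε xs κ D W Δ Ω) (hε0 : 0 < ε) (hε : ε < 1) {X : ℝ}
    (hX : X ∈ Ioo (-κ) κ) : AnalyticAt ℝ ψ X := by
  have hΩ := (h.analyticAt hε hX).2
  have hden : 1 + Ω X * X + ε ≠ 0 := by linarith [h.posWX X (Ioo_subset_Icc_self hX)]
  have hf : AnalyticAt ℝ (fun p : ℝ × ℝ => ((1 : ℝ), -Ω p.1 / (1 + Ω p.1 * p.1 + ε) * p.2))
      (X, ψ X) := by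
    have h1 : AnalyticAt ℝ (fun p : ℝ × ℝ => Ω p.1) (X, ψ X) :=
      hΩ.fun_comp_of_eq analyticAt_fst rfl
    exact analyticAt_const.prod ((h1.neg.div (((analyticAt_const.add
      (h1.mul analyticAt_fst)).add analyticAt_const)) hden).mul analyticAt_snd)
  have := analyticAt_of_hasDerivAt (γ := fun X => (X, ψ X)) (t₀ := X) hf (by
    filter_upwards [isOpen_Ioo.mem_nhds hX] with t ht
    exact (hasDerivAt_id t).prodMk (g.hasDerivAt_ψ h.lt_toX (Ioo_subset_Icc_self ht)))
  exact analyticAt_snd.fun_comp this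

theorem IsGauge.analyticAt_Z (g : IsGauge ε xs κ W Ω ϖ ψ Z)
    (h : IsContinuation ε xs κ D W Δ Ω) (hε0 : 0 < ε) (hε : ε < 1) (hκ : 0 < κ) {Y : ℝ}
    (hY : Y ∈ Ioo (-κ * ψ (-κ)) (κ * ψ κ)) : AnalyticAt ℝ Z Y := by
  have hX := (g.spec h.lt_toX hκ hY).1
  have hψ := g.ψ_pos (Z Y)
  refine analyticAt_of_hasDerivAt
    (f := fun z => (1 + Ω z * z + ε) / ((1 + ε) * ψ z)) ?_ ?_
  · exact ((analyticAt_const.add ((h.analyticAt hε hX).2.mul analyticAt_id)).add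
      analyticAt_const).div (analyticAt_const.mul (g.analyticAt_ψ h hε0 hε hX))
      (by positivity)
  · filter_upwards [isOpen_Ioo.mem_nhds hY] with t ht
    exact g.hasDerivAt_Z h.lt_toX hκ ht

theorem IsGauge.isExtension (g : IsGauge ε xs κ W Ω ϖ ψ Z)
    (h : IsContinuation ε xs κ D W Δ Ω) (hε0 : 0 < ε) (hε : ε < 1) (hκ : 0 < κ) :
    IsExtension ε (Δ 0) (Ω 0) (Ioo (-κ * ψ (-κ)) (κ * ψ κ)) (fun Y => Δ (Z Y) * Z Y ^ 2)
      (fun Y => 1 + Ω (Z Y) * Z Y) (fun Y => ψ (Z Y) ^ (1 + eta ε)) := by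
  have hlt := h.lt_toX
  have hε1 : 1 - ε ≠ 0 := by linarith
  have hε2 : 1 + ε ≠ 0 := by linarith
  have h0 : (0 : ℝ) ∈ Ioo (-κ * ψ (-κ)) (κ * ψ κ) :=
    ⟨by have := mul_pos hκ (g.ψ_pos (-κ)); linarith, mul_pos hκ (g.ψ_pos κ)⟩
  have hZ0 : Z 0 = 0 := by
    have := (g.spec hlt hκ h0).2
    exact (mul_eq_zero.1 this).resolve_right (g.ψ_pos _).ne'
  have hden : ∀ Y ∈ Ioo (-κ * ψ (-κ)) (κ * ψ κ),
      denC ε Y (Δ (Z Y) * Z Y ^ 2) (1 + Ω (Z Y) * Z Y) (ψ (Z Y) ^ (1 + eta ε)) =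
        (ψ (Z Y) ^ (1 + eta ε)) ^ 2 * denX ε (Z Y) (Δ (Z Y)) (Ω (Z Y)) := by
    intro Y hY
    obtain ⟨hX, hXY⟩ := g.spec hlt hκ hY
    have := denC_eq_denX (ε := ε) (X := Z Y) (b := Ω (Z Y))
      (by linarith [h.ltΔ _ (Ioo_subset_Icc_self hX)] : 0 < Δ (Z Y)) (g.ψ_pos (Z Y))
    rwa [hXY] at this
  have hne : ∀ Y ∈ Ioo (-κ * ψ (-κ)) (κ * ψ κ), Y ≠ 0 → Z Y ≠ 0 := by
    intro Y hY hY0 hZ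
    have := (g.spec hlt hκ hY).2
    rw [hZ, zero_mul] at this
    exact hY0 this.symm
  have hdZ : HasDerivAt Z 1 0 := by
    have := g.hasDerivAt_Z hlt hκ h0
    rw [hZ0, g.ψ_zero] at this
    refine this.congr_deriv ?_
    field_simp
    ring
  have h0m : (0 : ℝ) ∈ Icc (-κ) κ := ⟨by linarith, hκ.le⟩
  have hanZ : ∀ Y ∈ Ioo (-κ * ψ (-κ)) (κ * ψ κ), AnalyticAt ℝ Z Y := fun Y hY =>
    g.analyticAt_Z h hε0 hε hκ hY
  refine ⟨fun Y hY => ?_, fun Y hY => ?_, fun Y hY => ?_, fun Y hY hY0 => ?_, fun Y hY => ?_,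
    fun Y hY hY0 => ?_, fun Y hY hY0 => ?_, fun Y hY hY0 => ?_, ?_, by simp [hZ0], ?_,
    by simp [hZ0, g.ψ_zero]⟩
  · exact ((h.analyticAt hε (g.spec hlt hκ hY).1).1.fun_comp (hanZ Y hY)).mul ((hanZ Y hY).pow 2)
  · exact analyticAt_const.add
      (((h.analyticAt hε (g.spec hlt hκ hY).1).2.fun_comp (hanZ Y hY)).mul (hanZ Y hY))
  · exact (analyticAt_rpow_const (1 + eta ε) (g.ψ_pos (Z Y)).ne').fun_comp
      (f := fun Y => ψ (Z Y))
      ((g.analyticAt_ψ h hε0 hε (g.spec hlt hκ hY).1).fun_comp (hanZ Y hY))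
  · have := h.ltΔ _ (Ioo_subset_Icc_self (g.spec hlt hκ hY).1)
    have h1 := hne Y hY hY0
    have : 0 < Δ (Z Y) := by linarith
    positivity
  · rw [hden Y hY]
    have := Real.rpow_pos_of_pos (g.ψ_pos (Z Y)) (1 + eta ε)
    exact mul_neg_of_pos_of_neg (by positivity)
      (h.den _ (Ioo_subset_Icc_self (g.spec hlt hκ hY).1))
  · obtain ⟨hX, hXY⟩ := g.spec hlt hκ hY
    have hXm := Ioo_subset_Icc_self hX
    have hZ := g.hasDerivAt_Z hlt hκ hY
    have hχ : ψ (Z Y) ^ (1 + eta ε) ≠ 0 := (Real.rpow_pos_of_pos (g.ψ_pos (Z Y)) _).ne'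
    have hQ := (h.den _ hXm).ne
    have hψ := (g.ψ_pos (Z Y)).ne'
    have hX0 := hne Y hY hY0
    have e := mul_numΔ_add_denX ε (Z Y) (Δ (Z Y)) (Ω (Z Y))
    have hd := ((h.eqΔ _ hXm).comp Y hZ).mul (hZ.pow 2)
    refine hd.congr_deriv ?_
    simp only [hden Y hY, rateΔ, Function.comp_apply, Pi.pow_apply]
    generalize denX ε (Z Y) (Δ (Z Y)) (Ω (Z Y)) = Q at *
    generalize numΔ ε (Z Y) (Δ (Z Y)) (Ω (Z Y)) = N at *
    generalize ψ (Z Y) ^ (1 + eta ε) = P at *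
    generalize Δ (Z Y) = a at *
    generalize Ω (Z Y) = b at *
    generalize ψ (Z Y) = p at *
    generalize Z Y = X at *
    rw [← hXY]
    field_simp
    linear_combination (2 * a * X * (1 + b * X + ε)) * e
  · obtain ⟨hX, hXY⟩ := g.spec hlt hκ hY
    have hXm := Ioo_subset_Icc_self hX
    have hZ := g.hasDerivAt_Z hlt hκ hY
    have hχ : ψ (Z Y) ^ (1 + eta ε) ≠ 0 := (Real.rpow_pos_of_pos (g.ψ_pos (Z Y)) _).ne'
    have hQ := (h.den _ hXm).ne
    have hψ := (g.ψ_pos (Z Y)).ne'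
    have hX0 := hne Y hY hY0
    have e := mul_numΩ_add_denX ε (Z Y) (Δ (Z Y)) (Ω (Z Y))
    have hd := (((h.eqΩ _ hXm).comp Y hZ).mul hZ).const_add 1
    refine hd.congr_deriv ?_
    simp only [hden Y hY, rateΩ, Function.comp_apply]
    generalize denX ε (Z Y) (Δ (Z Y)) (Ω (Z Y)) = Q at *
    generalize numΩ ε (Z Y) (Δ (Z Y)) (Ω (Z Y)) = N at *
    generalize ψ (Z Y) ^ (1 + eta ε) = P at *
    generalize Δ (Z Y) = a at *
    generalize Ω (Z Y) = b at *
    generalize ψ (Z Y) = p at *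
    generalize Z Y = X at *
    rw [← hXY]
    field_simp
    linear_combination (-(1 + b * X + ε)) * e
  · obtain ⟨hX, hXY⟩ := g.spec hlt hκ hY
    have hXm := Ioo_subset_Icc_self hX
    have hZ := g.hasDerivAt_Z hlt hκ hY
    have hψ := (g.ψ_pos (Z Y)).ne'
    have hX0 := hne Y hY hY0
    have hw : 1 + Ω (Z Y) * Z Y + ε ≠ 0 := by linarith [h.posWX _ hXm]
    have hd := ((g.hasDerivAt_ψ hlt hXm).comp Y hZ).rpow_const (p := 1 + eta ε) (Or.inl hψ)
    refine hd.congr_deriv ?_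
    simp only [Function.comp_apply]
    rw [add_sub_cancel_left, Real.rpow_add (g.ψ_pos (Z Y)), Real.rpow_one, one_add_eta hε]
    generalize ψ (Z Y) ^ eta ε = P at *
    generalize Ω (Z Y) = b at *
    generalize ψ (Z Y) = p at *
    generalize Z Y = X at *
    generalize hv : 1 + b * X + ε = v at *
    rw [← hXY]
    have : 1 + b * X = v - ε := by linarith
    field_simp
    ring
  · have hc := (h.eqΔ 0 h0m).continuousAt.tendsto
    have hZc := hdZ.continuousAt.tendsto
    rw [hZ0] at hZc
    have hψc := (g.hasDerivAt_ψ hlt h0m).continuousAt.tendsto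
    rw [g.ψ_zero] at hψc
    have hlim := (hc.comp hZc).div ((hψc.comp hZc).pow 2) (by norm_num)
    rw [one_pow, div_one] at hlim
    refine (hlim.mono_left nhdsWithin_le_nhds).congr' ?_
    filter_upwards [mem_nhdsWithin_of_mem_nhds (isOpen_Ioo.mem_nhds h0), self_mem_nhdsWithin]
      with Y hY hY0
    have h1 := (g.spec hlt hκ hY).2
    have h2 := hne Y hY hY0
    have h3 := (g.ψ_pos (Z Y)).ne'
    simp only [Pi.div_apply, Function.comp_apply]
    have : Δ (Z Y) * Z Y ^ 2 / Y ^ 2 = Δ (Z Y) * Z Y ^ 2 / (Z Y * ψ (Z Y)) ^ 2 := by rw [h1]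
    rw [this]
    field_simp
  · have e := h.eqΩ 0 h0m
    rw [← hZ0] at e
    have := ((e.comp 0 hdZ).mul hdZ).const_add 1
    refine HasDerivAt.deriv (this.congr_deriv ?_)
    simp [hZ0]

theorem IsExtension.mono {d₂ w₁ : ℝ} {I J : Set ℝ} {d w χ : ℝ → ℝ}
    (h : IsExtension ε d₂ w₁ J d w χ) (hIJ : I ⊆ J) : IsExtension ε d₂ w₁ I d w χ :=
  ⟨h.analytic_d.mono hIJ, h.analytic_w.mono hIJ, h.analytic_chi.mono hIJ,
    fun Y hY => h.pos_d Y (hIJ hY), fun Y hY => h.den_neg Y (hIJ hY),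
    fun Y hY => h.eq_d Y (hIJ hY), fun Y hY => h.eq_w Y (hIJ hY),
    fun Y hY => h.eq_chi Y (hIJ hY), h.lim_d, h.w_zero, h.deriv_w_zero, h.chi_zero⟩

theorem IsGauge.ψ_bounds (g : IsGauge ε xs κ W Ω ϖ ψ Z)
    (h : IsContinuation ε xs κ D W Δ Ω) (hε0 : 0 < ε) (hκ : 0 < κ) (hκ1 : κ < 1) {X : ℝ}
    (hX : X ∈ Icc (-(κ ^ 2 / 16)) (κ ^ 2 / 16)) : 1 / 2 ≤ ψ X ∧ ψ X ≤ 2 := by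
  have hsub : ∀ X ∈ Icc (-(κ ^ 2 / 16)) (κ ^ 2 / 16), X ∈ Icc (-κ) κ := fun X hX =>
    ⟨by nlinarith [hX.1], by nlinarith [hX.2]⟩
  have hd : ∀ X ∈ Icc (-(κ ^ 2 / 16)) (κ ^ 2 / 16), HasDerivWithinAt (fun X => Real.log (ψ X))
      (-Ω X / (1 + Ω X * X + ε)) (Icc (-(κ ^ 2 / 16)) (κ ^ 2 / 16)) X := fun X hX => by
    have hψ := (g.ψ_pos X).ne'
    refine (((g.hasDerivAt_ψ h.lt_toX (hsub X hX)).log hψ).congr_deriv ?_).hasDerivWithinAt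
    rw [mul_div_assoc, div_self hψ, mul_one]
  have hb : ∀ X ∈ Icc (-(κ ^ 2 / 16)) (κ ^ 2 / 16), ‖-Ω X / (1 + Ω X * X + ε)‖ ≤ 2 / κ := by
    intro X hX
    have h1 := h.ltΩ X (hsub X hX)
    have h2 := h.Ωlt X (hsub X hX)
    have hk : κ * (1 / κ) = 1 := mul_one_div_cancel hκ.ne'
    have hΩκ : -Ω X * κ < 1 := by nlinarith
    have hXa : |X| ≤ κ ^ 2 / 16 := abs_le.2 hX
    have hΩX : |Ω X * X| ≤ 1 / 16 := by
      rw [abs_mul, abs_of_neg (by linarith : Ω X < 0)]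
      calc -Ω X * |X| ≤ -Ω X * (κ ^ 2 / 16) := by gcongr; linarith
        _ = (-Ω X * κ) * κ / 16 := by ring
        _ ≤ 1 / 16 := by nlinarith
    have h3 := (abs_le.1 hΩX).1
    have h4 : 1 / 2 ≤ 1 + Ω X * X + ε := by linarith
    rw [Real.norm_eq_abs, abs_of_nonneg (div_nonneg (by linarith) (by linarith)),
      div_le_div_iff₀ (by linarith) hκ]
    linarith
  have hm : (0 : ℝ) ∈ Icc (-(κ ^ 2 / 16)) (κ ^ 2 / 16) :=
    ⟨by have := pow_pos hκ 2; linarith, by positivity⟩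
  have := (convex_Icc _ _).norm_image_sub_le_of_norm_hasDerivWithin_le hd hb hm hX
  rw [g.ψ_zero, Real.log_one, sub_zero, sub_zero, Real.norm_eq_abs, Real.norm_eq_abs] at this
  have hlog : |Real.log (ψ X)| ≤ Real.log 2 := by
    refine this.trans (le_trans (mul_le_mul_of_nonneg_left (abs_le.2 hX) (by positivity)) ?_)
    have : 2 / κ * (κ ^ 2 / 16) = κ / 8 := by field_simp; norm_num
    rw [this]
    linarith [Real.log_two_gt_d9]
  obtain ⟨h1, h2⟩ := abs_le.1 hlog
  rw [← Real.log_inv] at h1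
  have hψ := g.ψ_pos X
  exact ⟨by rw [one_div]; exact (Real.log_le_log_iff (by norm_num) hψ).1 h1,
    (Real.log_le_log_iff hψ two_pos).1 h2⟩

end Extension

section Estimates

variable {ε xs κ : ℝ} {D W Δ Ω ϖ ψ Z : ℝ → ℝ}

/-- The values of `Y` of interest in terms of `X`. -/
theorem IsGauge.exists_small (g : IsGauge ε xs κ W Ω ϖ ψ Z)
    (h : IsContinuation ε xs κ D W Δ Ω) (hε0 : 0 < ε) (hκ : 0 < κ) (hκ1 : κ < 1) {Y : ℝ}
    (hY : Y ∈ Icc (-(κ ^ 2 / 64)) (κ ^ 2 / 64)) :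
    ∃ X ∈ Icc (-(κ ^ 2 / 16)) (κ ^ 2 / 16), X * ψ X = Y ∧ Z Y = X := by
  have hk : 0 < κ ^ 2 / 16 := by positivity
  have hk2 : κ ^ 2 / 16 < κ := by nlinarith
  have h1 := (g.ψ_bounds h hε0 hκ hκ1 ⟨le_rfl, by linarith⟩).1
  have h2 := (g.ψ_bounds h hε0 hκ hκ1 ⟨by linarith, le_rfl⟩).1
  obtain ⟨X, hX, hXY⟩ := g.exists_eq (by linarith : -(κ ^ 2 / 16) ≤ κ ^ 2 / 16)
    (by linarith) (hk2.trans h.lt_toX).le (Y := Y)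
    ⟨by nlinarith [hY.1], by nlinarith [hY.2]⟩
  refine ⟨X, hX, hXY, ?_⟩
  rw [← hXY]
  exact g.inv X ⟨by linarith [hX.1], by linarith [hX.2, h.lt_toX]⟩

theorem IsGauge.Icc_subset (g : IsGauge ε xs κ W Ω ϖ ψ Z)
    (h : IsContinuation ε xs κ D W Δ Ω) (hε0 : 0 < ε) (hκ : 0 < κ) (hκ1 : κ < 1) :
    Icc (-(κ ^ 2 / 64)) (κ ^ 2 / 64) ⊆ Ioo (-κ * ψ (-κ)) (κ * ψ κ) := by
  intro Y hY
  have hk2 : κ ^ 2 / 16 < κ := by nlinarith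
  have hlt := h.lt_toX
  obtain ⟨X, hX, hXY, -⟩ := g.exists_small h hε0 hκ hκ1 hY
  rw [← hXY]
  have hXm : X ∈ Icc (-κ) (toX ε xs) := ⟨by linarith [hX.1], by linarith [hX.2]⟩
  exact ⟨g.mono ⟨le_rfl, by linarith⟩ hXm (by linarith [hX.1]),
    g.mono hXm ⟨by linarith, hlt.le⟩ (by linarith [hX.2])⟩

/-- At the left end point. -/
theorem IsGauge.left_bounds (g : IsGauge ε xs κ W Ω ϖ ψ Z)
    (h : IsContinuation ε xs κ D W Δ Ω) (hε0 : 0 < ε) (hε : ε ≤ 1 / 2) (hκ : 0 < κ)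
    (hκ1 : κ < 1) {Y : ℝ} (hY : Y = -(κ ^ 2 / 64)) :
    Y ^ 2 / 4 < Δ (Z Y) * Z Y ^ 2 ∧ 1 / 8 ≤ ψ (Z Y) ^ (1 + eta ε) ∧
      1 + Ω (Z Y) * Z Y ≤ 17 / 16 ∧
      Y ^ 2 / 4 < Δ (Z Y) * Z Y ^ 2 / (1 + Ω (Z Y) * Z Y) ∧
      Δ (Z Y) * Z Y ^ 2 / (1 + Ω (Z Y) * Z Y) < 1 / 100 ∧
      1 + -Y / 4 < 1 + Ω (Z Y) * Z Y := by
  have hk : 0 < κ ^ 2 := by positivity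
  have hk2 : κ ^ 2 / 16 < κ := by nlinarith
  obtain ⟨X, hX, hXY, hZ⟩ := g.exists_small h hε0 hκ hκ1 (Y := Y)
    ⟨hY.ge, by rw [hY]; linarith⟩
  obtain ⟨hψ1, hψ2⟩ := g.ψ_bounds h hε0 hκ hκ1 hX
  rw [hZ]
  have hXm : X ∈ Icc (-κ) κ := ⟨by linarith [hX.1], by linarith [hX.2]⟩
  have hX0 : X < 0 := by
    by_contra! hX0
    have := mul_nonneg hX0 (g.ψ_pos X).le
    rw [hXY, hY] at this
    linarith
  have hXhalf : X ≤ Y / 2 := by nlinarith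
  have hΔ1 := h.ltΔ X hXm
  have hΔ2 := h.Δlt X hXm
  have hΩ1 := h.ltΩ X hXm
  have hΩ2 := h.Ωlt X hXm
  have hkk : κ * (1 / κ) = 1 := mul_one_div_cancel hκ.ne'
  have hΔκ : Δ X * κ < 1 := by nlinarith
  have hΩκ : -Ω X * κ < 1 := by nlinarith
  have hXκ : -X ≤ κ ^ 2 / 16 := by linarith [hX.1]
  have hΩX1 : Ω X * X ≤ 1 / 16 := by
    calc Ω X * X = -Ω X * -X := by ring
      _ ≤ -Ω X * (κ ^ 2 / 16) := mul_le_mul_of_nonneg_left hXκ (by linarith)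
      _ = (-Ω X * κ) * κ / 16 := by ring
      _ ≤ 1 / 16 := by nlinarith
  have hΩX2 : -Y / 4 < Ω X * X := by nlinarith
  have hY0 : Y < 0 := by rw [hY]; linarith
  have hX2 : Y ^ 2 / 4 ≤ X ^ 2 := by nlinarith
  have hYsq : 0 < Y ^ 2 := sq_pos_of_ne_zero hY0.ne
  have hd1 : 3 / 8 * Y ^ 2 ≤ Δ X * X ^ 2 := by nlinarith
  have hd2 : Δ X * X ^ 2 ≤ 1 / 256 := by
    have h1 : X ^ 2 ≤ (κ ^ 2 / 16) ^ 2 := by nlinarith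
    calc Δ X * X ^ 2 ≤ Δ X * (κ ^ 2 / 16) ^ 2 := mul_le_mul_of_nonneg_left h1 (by linarith)
      _ = (Δ X * κ) * κ ^ 3 / 256 := by ring
      _ ≤ 1 / 256 := by
        have : κ ^ 3 ≤ 1 := pow_le_one₀ hκ.le hκ1.le
        have : 0 < κ ^ 3 := by positivity
        nlinarith
  have hw1 : 1 < 1 + Ω X * X := by linarith
  refine ⟨by linarith, ?_, by linarith, ?_, ?_, by linarith⟩
  · have hη : 1 + eta ε ≤ (3 : ℕ) := by
      rw [one_add_eta (by linarith), div_le_iff₀ (by linarith)]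
      push_cast
      linarith
    have hp := one_add_eta_pos hε0 (by linarith : ε < 1)
    calc (1 / 8 : ℝ) = (1 / 2) ^ ((3 : ℕ) : ℝ) := by rw [Real.rpow_natCast]; norm_num
      _ ≤ (1 / 2) ^ (1 + eta ε) :=
        Real.rpow_le_rpow_of_exponent_ge (by norm_num) (by norm_num) hη
      _ ≤ ψ X ^ (1 + eta ε) := Real.rpow_le_rpow (by norm_num) hψ1 hp.le
  · rw [lt_div_iff₀ (by linarith)]
    nlinarith
  · rw [div_lt_iff₀ (by linarith)]
    linarith

/-- The mean density `χ²w(d/Y²)^(1+η)` to the left of `Y = 0`. -/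
theorem IsGauge.density_bound (g : IsGauge ε xs κ W Ω ϖ ψ Z)
    (h : IsContinuation ε xs κ D W Δ Ω) (hε0 : 0 < ε) (hε : ε ≤ 1 / 2) (hκ : 0 < κ)
    (hκ1 : κ < 1) {Y : ℝ} (hY : Y ∈ Icc (-(κ ^ 2 / 64)) 0) :
    1 + 1 / 4 < (ψ (Z Y) ^ (1 + eta ε)) ^ 2 * (1 + Ω (Z Y) * Z Y) *
      (Function.update (fun Y => Δ (Z Y) * Z Y ^ 2 / Y ^ 2) 0 (Δ 0) Y) ^ (1 + eta ε) := by
  have hk : 0 < κ ^ 2 := by positivity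
  have hk2 : κ ^ 2 / 16 < κ := by nlinarith
  obtain ⟨X, hX, hXY, hZ⟩ := g.exists_small h hε0 hκ hκ1 (Y := Y)
    ⟨hY.1, by linarith [hY.2]⟩
  have hψ := g.ψ_pos X
  have hXm : X ∈ Icc (-κ) κ := ⟨by linarith [hX.1], by linarith [hX.2]⟩
  have hΔ := h.ltΔ X hXm
  have hX0 : X ≤ 0 := by
    by_contra! hX0
    have := mul_pos hX0 (g.ψ_pos X)
    linarith [hY.2]
  have hw : 1 ≤ 1 + Ω X * X := by nlinarith [h.Ωlt X hXm]
  have hp : 1 ≤ 1 + eta ε := by linarith [eta_pos hε0 (by linarith : ε < 1)]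
  have hval : Function.update (fun Y => Δ (Z Y) * Z Y ^ 2 / Y ^ 2) 0 (Δ 0) Y
      = Δ X / ψ X ^ 2 := by
    rcases eq_or_ne Y 0 with rfl | hY0
    · have hX0 : X = 0 := (mul_eq_zero.1 hXY).resolve_right hψ.ne'
      rw [Function.update_self, hX0, g.ψ_zero]
      simp
    · rw [Function.update_of_ne hY0, hZ, ← hXY]
      have : X ≠ 0 := by
        rintro rfl
        rw [zero_mul] at hXY
        exact hY0 hXY.symm
      field_simp
  rw [hval, hZ, Real.div_rpow (by linarith) (by positivity), ← Real.rpow_natCast (ψ X) 2,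
    ← Real.rpow_natCast (ψ X ^ (1 + eta ε)) 2, ← Real.rpow_mul hψ.le, ← Real.rpow_mul hψ.le,
    mul_comm (((2 : ℕ) : ℝ)) (1 + eta ε)]
  have hP : 0 < ψ X ^ ((1 + eta ε) * ((2 : ℕ) : ℝ)) := Real.rpow_pos_of_pos hψ _
  have hΔp : Δ X ≤ Δ X ^ (1 + eta ε) := by
    conv_lhs => rw [← Real.rpow_one (Δ X)]
    exact Real.rpow_le_rpow_of_exponent_le (by linarith) hp
  have : ψ X ^ ((1 + eta ε) * ((2 : ℕ) : ℝ)) * (1 + Ω X * X) *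
      (Δ X ^ (1 + eta ε) / ψ X ^ ((1 + eta ε) * ((2 : ℕ) : ℝ)))
      = (1 + Ω X * X) * Δ X ^ (1 + eta ε) := by
    field_simp
  rw [this]
  nlinarith

/-- The extension coincides with the solution in Schwarzschild coordinates for `Y > 0`. -/
theorem IsGauge.coincide (g : IsGauge ε xs κ W Ω ϖ ψ Z)
    (h : IsContinuation ε xs κ D W Δ Ω) (hε0 : 0 < ε) (hε : ε < 1) (hκ : 0 < κ)
    {Y : ℝ} (hY0 : 0 < Y) (hY : Y ∈ Ioo (-κ * ψ (-κ)) (κ * ψ κ)) :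
    (toX ε xs * ψ (toX ε xs)) ^ (-(1 + eta ε)) < Y ^ (-(1 + eta ε)) ∧
    Δ (Z Y) * Z Y ^ 2 = D (Z (toX ε (Y ^ (-(1 + eta ε)))) ^ (-(1 + eta ε))) ∧
    1 + Ω (Z Y) * Z Y = W (Z (toX ε (Y ^ (-(1 + eta ε)))) ^ (-(1 + eta ε))) ∧
    ψ (Z Y) ^ (1 + eta ε)
      = Z (toX ε (Y ^ (-(1 + eta ε)))) ^ (-(1 + eta ε)) / Y ^ (-(1 + eta ε)) := by
  have hp := one_add_eta_pos hε0 hε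
  have hlt := h.lt_toX
  obtain ⟨hX, hXY⟩ := g.spec hlt hκ hY
  have hψ := g.ψ_pos (Z Y)
  have hX0 : 0 < Z Y := by
    by_contra! hX0
    have := mul_nonpos_of_nonpos_of_nonneg hX0 hψ.le
    linarith
  rw [toX_of_rpow hε0 hε hY0]
  have hx : 0 < Z Y ^ (-(1 + eta ε)) := Real.rpow_pos_of_pos hX0 _
  have htoX : toX ε (Z Y ^ (-(1 + eta ε))) = Z Y := toX_of_rpow hε0 hε hX0
  have e1 := h.eq_D _ hx (by rw [htoX]; exact hX.2.le)
  have e2 := h.eq_W _ hx (by rw [htoX]; exact hX.2.le)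
  rw [htoX] at e1 e2
  refine ⟨?_, e1.symm, e2.symm, ?_⟩
  · refine Real.rpow_lt_rpow_of_neg hY0 (hY.2.trans ?_) (neg_neg_of_pos hp)
    exact g.mono ⟨by linarith, hlt.le⟩ ⟨by linarith, le_rfl⟩ hlt
  · have : Y ^ (-(1 + eta ε)) = Z Y ^ (-(1 + eta ε)) * ψ (Z Y) ^ (-(1 + eta ε)) := by
      rw [← Real.mul_rpow hX0.le hψ.le, hXY]
    rw [this, Real.rpow_neg hψ.le]
    have h1 : ψ (Z Y) ^ (1 + eta ε) ≠ 0 := (Real.rpow_pos_of_pos hψ _).ne'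
    field_simp

end Estimates

end RLP

end

theorem theorem7 (δ₀ : ℝ) (hδ₀ : 0 < δ₀) :
    ∃ ε₀ : ℝ, 0 < ε₀ ∧ ε₀ < 1 ∧ ∃ Y₀ : ℝ, Y₀ < 0 ∧
    ∃ δ : ℝ, 0 < δ ∧ ∃ c₀ : ℝ, 0 < c₀ ∧ ∃ δ' : ℝ, 0 < δ' ∧ ∃ c_w : ℝ, 0 < c_w ∧
    ∀ ε ∈ Set.Ioc 0 ε₀, ∀ xs ∈ Set.Icc (2 + δ₀) (RLP.xMax ε),
    -- the RLP-type solution with sonic point `xs`, unique, in both coordinate systems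
    ∃ D W : ℝ → ℝ, RLP.IsRLPSolution ε xs D W ∧
    (∀ D' W' : ℝ → ℝ, RLP.IsRLPSolution ε xs D' W' →
      Set.EqOn D' D (Set.Ici xs) ∧ Set.EqOn W' W (Set.Ici xs)) ∧
    ∃ (r : ℝ → ℝ) (ys : ℝ), RLP.IsComovingRadius ε xs W r ys ∧
    -- its asymptotic constants
    ∃ d₂ w₁ : ℝ,
    Filter.Tendsto (fun x => D x * x ^ (2 / (1 + RLP.eta ε))) Filter.atTop (nhds d₂) ∧
    Filter.Tendsto (fun x => (W x - 1) * x ^ (1 / (1 + RLP.eta ε))) Filter.atTop (nhds w₁) ∧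
    -- the local extension, existence and uniqueness
    ∃ d w χ : ℝ → ℝ,
    RLP.IsExtension ε d₂ w₁ (Set.Icc Y₀ (-Y₀)) d w χ ∧
    (∀ d' w' χ' : ℝ → ℝ, RLP.IsExtension ε d₂ w₁ (Set.Ioo Y₀ (-Y₀)) d' w' χ' →
      Set.EqOn d' d (Set.Ioo Y₀ (-Y₀)) ∧ Set.EqOn w' w (Set.Ioo Y₀ (-Y₀)) ∧
        Set.EqOn χ' χ (Set.Ioo Y₀ (-Y₀))) ∧
    -- part (a)
    (δ < d Y₀ ∧ δ < χ Y₀ ∧ w Y₀ < 1 / δ) ∧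
    -- part (b), where `d / Y²` has the value `d₂` at `Y = 0`
    (∀ Y ∈ Set.Icc Y₀ 0,
      1 + c₀ < χ Y ^ 2 * w Y *
        (Function.update (fun Z => d Z / Z ^ 2) 0 d₂ Y) ^ (1 + RLP.eta ε)) ∧
    -- part (c)
    (δ' < d Y₀ / w Y₀ ∧ d Y₀ / w Y₀ < 1 / 100) ∧
    -- part (d)
    1 + c_w < w Y₀ ∧
    -- coincidence with the RLP-type solution for `Y > 0`, where `y = Y ^ (-(1 + η))`
    (∀ Y ∈ Set.Ioc 0 (-Y₀),
      ys < Y ^ (-(1 + RLP.eta ε)) ∧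
      d Y = D (r (Y ^ (-(1 + RLP.eta ε)))) ∧
      w Y = W (r (Y ^ (-(1 + RLP.eta ε)))) ∧
      χ Y = r (Y ^ (-(1 + RLP.eta ε))) / Y ^ (-(1 + RLP.eta ε))) := by
  obtain ⟨κ, hκ, hκ1, hwin⟩ := RLP.exists_continuation_window hδ₀
  have hk : 0 < κ ^ 2 / 64 := by positivity
  have hk1 : κ ^ 2 / 64 < 1 / 64 := by nlinarith
  refine ⟨κ / 2, by positivity, by linarith, -(κ ^ 2 / 64), by linarith, (κ ^ 2 / 64) ^ 2 / 4,
    by positivity, 1 / 4, by norm_num, (κ ^ 2 / 64) ^ 2 / 4, by positivity, κ ^ 2 / 64 / 4,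
    by positivity, fun ε hε xs hxs => ?_⟩
  have hε0 : 0 < ε := hε.1
  have hε2 : ε ≤ 1 / 2 := by linarith [hε.2]
  have hε1 : ε < 1 := by linarith
  have hxs0 : 0 < xs := by linarith [hxs.1]
  obtain ⟨D, W, Δ, Ω, h, hu⟩ := hwin ε ⟨hε0, by linarith [hε.2]⟩ xs hxs
  obtain ⟨ϖ, ψ, Z, g⟩ := h.exists_gauge hε0 hε1 hxs0 hκ
  have hsub := g.Icc_subset h hε0 hκ hκ1
  have hext := g.isExtension h hε0 hε1 hκ
  obtain ⟨hlim1, hlim2⟩ := h.tendsto hε0 hε1 hκ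
  obtain ⟨b1, b2, b3, b4, b5, b6⟩ := g.left_bounds h hε0 hε2 hκ hκ1 rfl
  rw [neg_sq] at b1 b4
  rw [neg_neg] at b6
  refine ⟨D, W, h.rlp, hu, _, _, g.isComovingRadius hε0 hε1 hxs0 hκ, Δ 0, Ω 0, hlim1, hlim2,
    _, _, _, hext.mono (by rw [neg_neg]; exact hsub), ?_, ⟨b1, ?_, ?_⟩, ?_, ⟨b4, b5⟩, b6, ?_⟩
  · rw [neg_neg]
    intro d' w' χ' h'
    exact RLP.IsExtension.eqOn hk (hext.mono (Set.Ioo_subset_Icc_self.trans hsub)) h' hε0 hε1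
      (by linarith [h.ltΔ 0 ⟨by linarith, hκ.le⟩])
  · refine lt_of_lt_of_le ?_ b2
    nlinarith
  · refine b3.trans_lt ?_
    rw [lt_div_iff₀ (by positivity)]
    nlinarith
  · intro Y hY
    exact g.density_bound h hε0 hε2 hκ hκ1 hY
  · rw [neg_neg]
    intro Y hY
    exact g.coincide h hε0 hε1 hκ hY.1 (hsub ⟨by linarith [hY.1], hY.2⟩)
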